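/- Fix a field $\mathbb{K}$ (for instance $\mathbb{R}$ or $\mathbb{C}$) and write $[k]=\{1,\dots,k\}$. **Modules and ProPs.** An $\mathfrak S\times\mathfrak S^{op}$-module is a family $P=(P(k,l))_{k,l\ge 0}$ of $\mathbb{K}$-vector spaces with commuting linear actions of $\mathfrak S_l$ on the left and of $\mathfrak S_k$ on the right of $P(k,l)$; a morphism is a family of equivariant linear maps. A ProP is an $\mathfrak S\times\mathfrak S^{op}$-module $P$ together with a bilinear associative horizontal product $*:P(k,l)\times P(k',l')\to P(k+k',l+l')$ with unit $I_0\in P(0,0)$, and a bilinear associative vertical product $\circ:P(l,m)\times P(k,l)\to P(k,m)$ and an element $I_1\in P(1,1)$ such that, with $I_n=I_1^{*n}$ and $I_1^{*0}=I_0$, one has $p\circ I_k=p=I_l\circ p$ for $p\in P(k,l)$, subject to: $(p*p')\circ(q*q')=(p\circ q)*(p'\circ q')$; $\sigma\cdot(p\circ q)=(\sigma\cdot p)\circ q$, $(p\circ q)\cdot\nu=p\circ(q\cdot\nu)$, $(p\cdot\tau)\circ q=p\circ(\tau\cdot q)$; $(\sigma\cdot p)*(\sigma'\cdot p')=(\sigma\otimes\sigma')\cdot(p*p')$,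 $(p\cdot\tau)*(p'\cdot\tau')=(p*p')\cdot(\tau\otimes\tau')$, where $\alpha\otimes\beta$ acts by $\alpha$ on the first block and by $\beta$ on the last; and $c_{l,l'}\cdot(p*p')=(p'*p)\cdot c_{k,k'}$ for $p\in P(k,l)$, $p'\in P(k',l')$, where $c_{m,n}\in\mathfrak S_{m+n}$ sends $i\le m$ to $i+n$ and $i>m$ to $i-m$. A morphism of ProPs is a morphism of $\mathfrak S\times\mathfrak S^{op}$-modules that preserves $*$, $\circ$, $I_0$ and $I_1$. **The ProP of graphs.** A graph $G$ with $k$ inputs and $l$ outputs consists of finite sets $V,E,I,O,IO,L$ (vertices, internal edges, input edges, output edges, input-output edges, loops without endpoints), a source map $s:E\sqcup O\to V$, a target map $t:E\sqcup I\to V$, and bijections $\alpha:I\sqcup IO\to[k]$, $\beta:O\sqcup IO\to[l]$. An isomorphism of graphs is a family of six bijections compatible with $s,t,\alpha,\beta$. Let $\mathbf{Gr}^{\circlearrowright}(k,l)$ be the $\mathbb{K}$-vector space with basis the isomorphism classes of graphs with $k$ inputs and $l$ outputs. The element $\sigma\cdot G$ is $G$ with $\beta$ replaced by $\sigma\circ\beta$,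 and $G\cdot\tau$ is $G$ with $\alpha$ replaced by $\tau^{-1}\circ\alpha$. The product $G*G'$ is the disjoint union, the inputs and outputs of $G'$ being numbered after those of $G$. The product $G'\circ G$ is obtained by gluing, for every $i$, the $i$-th output of $G$ to the $i$-th input of $G'$ (the loops of $G$ and of $G'$ are kept). $I_0$ is the empty graph and $I_1$ is the graph reduced to one input-output edge. This makes $\mathbf{Gr}^{\circlearrowright}$ a ProP. **Indecomposable graphs.** A graph $G$ is indecomposable if either it consists of a single loop (and nothing else), or all of the following hold: $V(G)\ne\emptyset$, $IO(G)=\emptyset$, $L(G)=\emptyset$; whenever $G\cong G'\circ G''$, then $V(G')=\emptyset$ or $V(G'')=\emptyset$; whenever $G\cong\sigma\cdot(G'*G'')\cdot\tau$ with permutations $\sigma,\tau$, then $V(G')=\emptyset$ or $V(G'')=\emptyset$. The isomorphism classes of indecomposable graphs span an $\mathfrak S\times\mathfrak S^{op}$-submodule $\mathbf{Gr}^{\circlearrowright}_{\mathrm{ind}}$ of $\mathbf{Gr}^{\circlearrowright}$. **Theorem.** $\mathbf{Gr}^{\circlearrowright}$ is the free ProP generated by $\mathbf{Gr}^{\circlearrowright}_{\mathrm{ind}}$: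 for every ProP $P$ over $\mathbb{K}$ and every morphism of $\mathfrak S\times\mathfrak S^{op}$-modules $\phi:\mathbf{Gr}^{\circlearrowright}_{\mathrm{ind}}\to P$, there exists a unique morphism of ProPs $\Phi:\mathbf{Gr}^{\circlearrowright}\to P$ such that $\Phi|_{\mathbf{Gr}^{\circlearrowright}_{\mathrm{ind}}}=\phi$. -/

import Mathlib

universe u v w

/-! ## Modules over the symmetric groups, and ProPs -/

/-- An `𝔖 × 𝔖ᵒᵖ`-module: a family of vector spaces `P(k, l)` together with commuting linear actions of
`𝔖_l` on the left and of `𝔖_k` on the right (`lact σ p` is `σ · p` and `ract τ p` is `p · τ`). -/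
structure SBimodule (𝕜 : Type u) [Field 𝕜] where
  carrier : ℕ → ℕ → Type v
  [addCommGroup : ∀ k l, AddCommGroup (carrier k l)]
  [module : ∀ k l, Module 𝕜 (carrier k l)]
  lact : ∀ {k l : ℕ}, Equiv.Perm (Fin l) → carrier k l →ₗ[𝕜] carrier k l
  ract : ∀ {k l : ℕ}, Equiv.Perm (Fin k) → carrier k l →ₗ[𝕜] carrier k l
  one_lact : ∀ {k l : ℕ} (p : carrier k l), lact 1 p = p
  one_ract : ∀ {k l : ℕ} (p : carrier k l), ract 1 p = p
  lact_lact : ∀ {k l : ℕ} (σ σ' : Equiv.Perm (Fin l)) (p : carrier k l),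
    lact σ (lact σ' p) = lact (σ * σ') p
  lact_ract : ∀ {k l : ℕ} (σ : Equiv.Perm (Fin l)) (τ : Equiv.Perm (Fin k)) (p : carrier k l),
    lact σ (ract τ p) = ract τ (lact σ p)
  ract_ract : ∀ {k l : ℕ} (τ τ' : Equiv.Perm (Fin k)) (p : carrier k l),
    ract τ' (ract τ p) = ract (τ * τ') p

attribute [instance] SBimodule.addCommGroup SBimodule.module

namespace SBimodule

variable {𝕜 : Type u} [Field 𝕜]

/-- The identification of `P(k, l)` with `P(k', l')` when `k = k'` and `l = l'`. -/
def castTo (P : SBimodule.{u, v} 𝕜) {k k' l l' : ℕ} (hk : k = k') (hl : l = l')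
    (p : P.carrier k l) : P.carrier k' l' :=
  cast (congrArg₂ P.carrier hk hl) p

/-- A morphism of `𝔖 × 𝔖ᵒᵖ`-modules: a family of equivariant linear maps. -/
@[ext]
structure Hom (P : SBimodule.{u, v} 𝕜) (Q : SBimodule.{u, w} 𝕜) where
  toFun : ∀ {k l : ℕ}, P.carrier k l →ₗ[𝕜] Q.carrier k l
  map_lact : ∀ {k l : ℕ} (σ : Equiv.Perm (Fin l)) (p : P.carrier k l),
    toFun (P.lact σ p) = Q.lact σ (toFun p)
  map_ract : ∀ {k l : ℕ} (τ : Equiv.Perm (Fin k)) (p : P.carrier k l),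
    toFun (P.ract τ p) = Q.ract τ (toFun p)

end SBimodule

/-- The permutation `α ⊗ β` of `m + n` letters: `α` on the first `m` letters, `β` on the last `n`. -/
def permTensor {m n : ℕ} (α : Equiv.Perm (Fin m)) (β : Equiv.Perm (Fin n)) :
    Equiv.Perm (Fin (m + n)) :=
  finSumFinEquiv.permCongr (Equiv.sumCongr α β)

/-- The permutation `c_{m,n}` of `m + n` letters: `i ↦ i + n` on the first `m` letters,
`i ↦ i - m` on the last `n`. -/
def blockSwap (m n : ℕ) : Equiv.Perm (Fin (m + n)) :=
  finAddFlip.trans (finCongr (Nat.add_comm n m))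

/-- The operations of a ProP on an `𝔖 × 𝔖ᵒᵖ`-module: horizontal concatenation `hcomp p q = p * q`,
vertical concatenation `vcomp p q = p ∘ q`, and the two units `I₀` and `I₁`. -/
structure ProPData (𝕜 : Type u) [Field 𝕜] extends SBimodule.{u, v} 𝕜 where
  hcomp : ∀ {k l k' l' : ℕ},
    carrier k l →ₗ[𝕜] carrier k' l' →ₗ[𝕜] carrier (k + k') (l + l')
  vcomp : ∀ {k l m : ℕ}, carrier l m →ₗ[𝕜] carrier k l →ₗ[𝕜] carrier k m
  unit0 : carrier 0 0
  unit1 : carrier 1 1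

/-- `I_n = I₁ * ⋯ * I₁` (`n` factors). -/
def ProPData.idn {𝕜 : Type u} [Field 𝕜] (P : ProPData.{u, v} 𝕜) : ∀ n : ℕ, P.carrier n n
  | 0 => P.unit0
  | n + 1 => P.hcomp (P.idn n) P.unit1

/-- A ProP over the field `𝕜`. -/
structure ProP (𝕜 : Type u) [Field 𝕜] extends ProPData.{u, v} 𝕜 where
  hcomp_assoc : ∀ {k l k' l' k'' l'' : ℕ}
    (p : carrier k l) (p' : carrier k' l') (p'' : carrier k'' l''),
    hcomp p (hcomp p' p'') =
      toSBimodule.castTo (Nat.add_assoc k k' k'') (Nat.add_assoc l l' l'')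
        (hcomp (hcomp p p') p'')
  hcomp_unit0 : ∀ {k l : ℕ} (p : carrier k l), hcomp p unit0 = p
  unit0_hcomp : ∀ {k l : ℕ} (p : carrier k l),
    toSBimodule.castTo (Nat.zero_add k) (Nat.zero_add l) (hcomp unit0 p) = p
  vcomp_assoc : ∀ {k l m n : ℕ} (p : carrier m n) (q : carrier l m) (r : carrier k l),
    vcomp p (vcomp q r) = vcomp (vcomp p q) r
  vcomp_idn : ∀ {k l : ℕ} (p : carrier k l), vcomp p (toProPData.idn k) = p
  idn_vcomp : ∀ {k l : ℕ} (p : carrier k l), vcomp (toProPData.idn l) p = p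
  interchange : ∀ {k l m k' l' m' : ℕ} (p : carrier l m) (p' : carrier l' m')
    (q : carrier k l) (q' : carrier k' l'),
    vcomp (hcomp p p') (hcomp q q') = hcomp (vcomp p q) (vcomp p' q')
  lact_vcomp : ∀ {k l m : ℕ} (σ : Equiv.Perm (Fin m)) (p : carrier l m) (q : carrier k l),
    lact σ (vcomp p q) = vcomp (lact σ p) q
  ract_vcomp : ∀ {k l m : ℕ} (ν : Equiv.Perm (Fin k)) (p : carrier l m) (q : carrier k l),
    ract ν (vcomp p q) = vcomp p (ract ν q)
  vcomp_middle : ∀ {k l m : ℕ} (τ : Equiv.Perm (Fin l)) (p : carrier l m) (q : carrier k l),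
    vcomp (ract τ p) q = vcomp p (lact τ q)
  lact_hcomp : ∀ {k l k' l' : ℕ} (σ : Equiv.Perm (Fin l)) (σ' : Equiv.Perm (Fin l'))
    (p : carrier k l) (p' : carrier k' l'),
    hcomp (lact σ p) (lact σ' p') = lact (permTensor σ σ') (hcomp p p')
  ract_hcomp : ∀ {k l k' l' : ℕ} (τ : Equiv.Perm (Fin k)) (τ' : Equiv.Perm (Fin k'))
    (p : carrier k l) (p' : carrier k' l'),
    hcomp (ract τ p) (ract τ' p') = ract (permTensor τ τ') (hcomp p p')
  hcomp_comm : ∀ {k l k' l' : ℕ} (p : carrier k l) (p' : carrier k' l'),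
    lact (blockSwap l l') (hcomp p p') =
      ract (blockSwap k k')
        (toSBimodule.castTo (Nat.add_comm k' k) (Nat.add_comm l' l) (hcomp p' p))

/-- A morphism of ProPs: a morphism of `𝔖 × 𝔖ᵒᵖ`-modules compatible with both concatenations and
with the units. -/
@[ext]
structure ProP.Hom {𝕜 : Type u} [Field 𝕜] (P : ProP.{u, v} 𝕜) (Q : ProP.{u, w} 𝕜) extends
    SBimodule.Hom P.toSBimodule Q.toSBimodule where
  map_hcomp : ∀ {k l k' l' : ℕ} (p : P.carrier k l) (p' : P.carrier k' l'),
    toFun (P.hcomp p p') = Q.hcomp (toFun p) (toFun p')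
  map_vcomp : ∀ {k l m : ℕ} (p : P.carrier l m) (q : P.carrier k l),
    toFun (P.vcomp p q) = Q.vcomp (toFun p) (toFun q)
  map_unit0 : toFun P.unit0 = Q.unit0
  map_unit1 : toFun P.unit1 = Q.unit1

/-! ## Graphs -/

/-- A graph with `k` inputs and `l` outputs. `V`: vertices, `E`: internal edges, `I`: input edges,
`O`: output edges, `T`: input-output edges, `L`: loops without endpoints; `src` and `tgt` are the
source and target maps, `inIdx` and `outIdx` the indexations of the inputs and of the outputs. -/
structure OGraph (k l : ℕ) where
  V : Type
  E : Type
  I : Type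
  O : Type
  T : Type
  L : Type
  [finite_V : Finite V]
  [finite_E : Finite E]
  [finite_I : Finite I]
  [finite_O : Finite O]
  [finite_T : Finite T]
  [finite_L : Finite L]
  src : E ⊕ O → V
  tgt : E ⊕ I → V
  inIdx : I ⊕ T → Fin k
  outIdx : O ⊕ T → Fin l
  inIdx_bij : Function.Bijective inIdx
  outIdx_bij : Function.Bijective outIdx

namespace OGraph

attribute [instance] finite_V finite_E finite_I finite_O finite_T finite_L

/-- An isomorphism of graphs. -/
structure Iso {k l : ℕ} (G H : OGraph k l) where
  fV : G.V ≃ H.V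
  fE : G.E ≃ H.E
  fI : G.I ≃ H.I
  fO : G.O ≃ H.O
  fT : G.T ≃ H.T
  fL : G.L ≃ H.L
  src_E : ∀ e, H.src (.inl (fE e)) = fV (G.src (.inl e))
  src_O : ∀ e, H.src (.inr (fO e)) = fV (G.src (.inr e))
  tgt_E : ∀ e, H.tgt (.inl (fE e)) = fV (G.tgt (.inl e))
  tgt_I : ∀ e, H.tgt (.inr (fI e)) = fV (G.tgt (.inr e))
  in_I : ∀ e, H.inIdx (.inl (fI e)) = G.inIdx (.inl e)
  in_T : ∀ e, H.inIdx (.inr (fT e)) = G.inIdx (.inr e)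
  out_O : ∀ e, H.outIdx (.inl (fO e)) = G.outIdx (.inl e)
  out_T : ∀ e, H.outIdx (.inr (fT e)) = G.outIdx (.inr e)

/-- The identity isomorphism. -/
def Iso.refl {k l : ℕ} (G : OGraph k l) : Iso G G where
  fV := .refl _
  fE := .refl _
  fI := .refl _
  fO := .refl _
  fT := .refl _
  fL := .refl _
  src_E _ := rfl
  src_O _ := rfl
  tgt_E _ := rfl
  tgt_I _ := rfl
  in_I _ := rfl
  in_T _ := rfl
  out_O _ := rfl
  out_T _ := rfl

/-- The inverse isomorphism. -/
def Iso.symm {k l : ℕ} {G H : OGraph k l} (f : Iso G H) : Iso H G where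
  fV := f.fV.symm
  fE := f.fE.symm
  fI := f.fI.symm
  fO := f.fO.symm
  fT := f.fT.symm
  fL := f.fL.symm
  src_E e := by rw [Equiv.eq_symm_apply, ← f.src_E, Equiv.apply_symm_apply]
  src_O e := by rw [Equiv.eq_symm_apply, ← f.src_O, Equiv.apply_symm_apply]
  tgt_E e := by rw [Equiv.eq_symm_apply, ← f.tgt_E, Equiv.apply_symm_apply]
  tgt_I e := by rw [Equiv.eq_symm_apply, ← f.tgt_I, Equiv.apply_symm_apply]
  in_I e := by rw [← f.in_I, Equiv.apply_symm_apply]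
  in_T e := by rw [← f.in_T, Equiv.apply_symm_apply]
  out_O e := by rw [← f.out_O, Equiv.apply_symm_apply]
  out_T e := by rw [← f.out_T, Equiv.apply_symm_apply]

/-- The composite isomorphism. -/
def Iso.trans {k l : ℕ} {G H K : OGraph k l} (f : Iso G H) (g : Iso H K) : Iso G K where
  fV := f.fV.trans g.fV
  fE := f.fE.trans g.fE
  fI := f.fI.trans g.fI
  fO := f.fO.trans g.fO
  fT := f.fT.trans g.fT
  fL := f.fL.trans g.fL
  src_E e := by simp [g.src_E, f.src_E]
  src_O e := by simp [g.src_O, f.src_O]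
  tgt_E e := by simp [g.tgt_E, f.tgt_E]
  tgt_I e := by simp [g.tgt_I, f.tgt_I]
  in_I e := by simp [g.in_I, f.in_I]
  in_T e := by simp [g.in_T, f.in_T]
  out_O e := by simp [g.out_O, f.out_O]
  out_T e := by simp [g.out_T, f.out_T]

instance setoid (k l : ℕ) : Setoid (OGraph k l) where
  r G H := Nonempty (Iso G H)
  iseqv := ⟨fun G => ⟨.refl G⟩, fun ⟨f⟩ => ⟨f.symm⟩, fun ⟨f⟩ ⟨g⟩ => ⟨f.trans g⟩⟩

/-- Renumbering of the inputs and of the outputs of a graph along bijections. -/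
def relabel {k l k' l' : ℕ} (a : Fin k ≃ Fin k') (b : Fin l ≃ Fin l') (G : OGraph k l) :
    OGraph k' l' where
  V := G.V
  E := G.E
  I := G.I
  O := G.O
  T := G.T
  L := G.L
  src := G.src
  tgt := G.tgt
  inIdx e := a (G.inIdx e)
  outIdx e := b (G.outIdx e)
  inIdx_bij := a.bijective.comp G.inIdx_bij
  outIdx_bij := b.bijective.comp G.outIdx_bij

/-- Horizontal concatenation `G * H`: the disjoint union, the inputs and outputs of `H` being
numbered after those of `G`. -/
def hcomp {k l k' l' : ℕ} (G : OGraph k l) (H : OGraph k' l') : OGraph (k + k') (l + l') where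
  V := G.V ⊕ H.V
  E := G.E ⊕ H.E
  I := G.I ⊕ H.I
  O := G.O ⊕ H.O
  T := G.T ⊕ H.T
  L := G.L ⊕ H.L
  src e := Sum.map G.src H.src (Equiv.sumSumSumComm _ _ _ _ e)
  tgt e := Sum.map G.tgt H.tgt (Equiv.sumSumSumComm _ _ _ _ e)
  inIdx e := finSumFinEquiv (Sum.map G.inIdx H.inIdx (Equiv.sumSumSumComm _ _ _ _ e))
  outIdx e := finSumFinEquiv (Sum.map G.outIdx H.outIdx (Equiv.sumSumSumComm _ _ _ _ e))
  inIdx_bij := finSumFinEquiv.bijective.comp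
    ((Sum.map_bijective.2 ⟨G.inIdx_bij, H.inIdx_bij⟩).comp (Equiv.bijective _))
  outIdx_bij := finSumFinEquiv.bijective.comp
    ((Sum.map_bijective.2 ⟨G.outIdx_bij, H.outIdx_bij⟩).comp (Equiv.bijective _))

/-- Vertical concatenation `H ∘ G`: the `i`-th output of `G` is glued to the `i`-th input of `H`,
for every `i`. -/
def vcomp {k l m : ℕ} (H : OGraph l m) (G : OGraph k l) : OGraph k m where
  V := G.V ⊕ H.V
  E := G.E ⊕ H.E ⊕ {p : G.O × H.I // G.outIdx (.inl p.1) = H.inIdx (.inl p.2)}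
  I := G.I ⊕ {p : G.T × H.I // G.outIdx (.inr p.1) = H.inIdx (.inl p.2)}
  O := H.O ⊕ {p : G.O × H.T // G.outIdx (.inl p.1) = H.inIdx (.inr p.2)}
  T := {p : G.T × H.T // G.outIdx (.inr p.1) = H.inIdx (.inr p.2)}
  L := G.L ⊕ H.L
  src
    | .inl (.inl e) => .inl (G.src (.inl e))
    | .inl (.inr (.inl e)) => .inr (H.src (.inl e))
    | .inl (.inr (.inr p)) => .inl (G.src (.inr p.1.1))
    | .inr (.inl e) => .inr (H.src (.inr e))
    | .inr (.inr p) => .inl (G.src (.inr p.1.1))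
  tgt
    | .inl (.inl e) => .inl (G.tgt (.inl e))
    | .inl (.inr (.inl e)) => .inr (H.tgt (.inl e))
    | .inl (.inr (.inr p)) => .inr (H.tgt (.inr p.1.2))
    | .inr (.inl e) => .inl (G.tgt (.inr e))
    | .inr (.inr p) => .inr (H.tgt (.inr p.1.2))
  inIdx
    | .inl (.inl e) => G.inIdx (.inl e)
    | .inl (.inr p) => G.inIdx (.inr p.1.1)
    | .inr p => G.inIdx (.inr p.1.1)
  outIdx
    | .inl (.inl e) => H.outIdx (.inl e)
    | .inl (.inr p) => H.outIdx (.inr p.1.2)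
    | .inr p => H.outIdx (.inr p.1.2)
  inIdx_bij := by
    constructor
    · rintro ((e | ⟨⟨f, e⟩, h⟩) | ⟨⟨f, e⟩, h⟩) ((e' | ⟨⟨f', e'⟩, h'⟩) | ⟨⟨f', e'⟩, h'⟩) hh <;>
        have := G.inIdx_bij.1 hh <;> simp at this
      · rw [this]
      · subst this
        have := H.inIdx_bij.1 (h.symm.trans h')
        simp at this; simp [this]
      · subst this
        have := H.inIdx_bij.1 (h.symm.trans h')
        simp at this
      · subst this
        have := H.inIdx_bij.1 (h.symm.trans h')
        simp at this
      · subst this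
        have := H.inIdx_bij.1 (h.symm.trans h')
        simp at this; simp [this]
    · intro i
      obtain ⟨e | f, rfl⟩ := G.inIdx_bij.2 i
      · exact ⟨.inl (.inl e), rfl⟩
      · obtain ⟨e | e, he⟩ := H.inIdx_bij.2 (G.outIdx (.inr f))
        · exact ⟨.inl (.inr ⟨(f, e), he.symm⟩), rfl⟩
        · exact ⟨.inr ⟨(f, e), he.symm⟩, rfl⟩
  outIdx_bij := by
    constructor
    · rintro ((e | ⟨⟨f, e⟩, h⟩) | ⟨⟨f, e⟩, h⟩) ((e' | ⟨⟨f', e'⟩, h'⟩) | ⟨⟨f', e'⟩, h'⟩) hh <;>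
        have := H.outIdx_bij.1 hh <;> simp at this
      · rw [this]
      · subst this
        have := G.outIdx_bij.1 (h.trans h'.symm)
        simp at this; simp [this]
      · subst this
        have := G.outIdx_bij.1 (h.trans h'.symm)
        simp at this
      · subst this
        have := G.outIdx_bij.1 (h.trans h'.symm)
        simp at this
      · subst this
        have := G.outIdx_bij.1 (h.trans h'.symm)
        simp at this; simp [this]
    · intro i
      obtain ⟨e | f, rfl⟩ := H.outIdx_bij.2 i
      · exact ⟨.inl (.inl e), rfl⟩
      · obtain ⟨e | e, he⟩ := G.outIdx_bij.2 (H.inIdx (.inr f))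
        · exact ⟨.inl (.inr ⟨(e, f), he⟩), rfl⟩
        · exact ⟨.inr ⟨(e, f), he⟩, rfl⟩

/-- The graph `I_n`, which consists of `n` input-output edges. -/
def idn (n : ℕ) : OGraph n n where
  V := Empty
  E := Empty
  I := Empty
  O := Empty
  T := Fin n
  L := Empty
  src := Sum.elim Empty.elim Empty.elim
  tgt := Sum.elim Empty.elim Empty.elim
  inIdx := Sum.elim Empty.elim id
  outIdx := Sum.elim Empty.elim id
  inIdx_bij := ⟨by rintro (⟨⟨⟩⟩ | i) (⟨⟨⟩⟩ | j) h; exact congrArg _ h, fun i => ⟨.inr i, rfl⟩⟩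
  outIdx_bij := ⟨by rintro (⟨⟨⟩⟩ | i) (⟨⟨⟩⟩ | j) h; exact congrArg _ h, fun i => ⟨.inr i, rfl⟩⟩

/-! ### Compatibility of the operations with isomorphisms, and the ProP identities for graphs -/

/-- Renumbering is compatible with isomorphisms. -/
def Iso.relabel {k l k' l' : ℕ} {G G' : OGraph k l} (a : Fin k ≃ Fin k') (b : Fin l ≃ Fin l')
    (f : Iso G G') : Iso (G.relabel a b) (G'.relabel a b) where
  fV := f.fV
  fE := f.fE
  fI := f.fI
  fO := f.fO
  fT := f.fT
  fL := f.fL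
  src_E := f.src_E
  src_O := f.src_O
  tgt_E := f.tgt_E
  tgt_I := f.tgt_I
  in_I e := congrArg a (f.in_I e)
  in_T e := congrArg a (f.in_T e)
  out_O e := congrArg b (f.out_O e)
  out_T e := congrArg b (f.out_T e)

/-- Horizontal concatenation is compatible with isomorphisms. -/
def Iso.hcomp {k l k' l' : ℕ} {G G' : OGraph k l} {H H' : OGraph k' l'}
    (f : Iso G G') (g : Iso H H') : Iso (G.hcomp H) (G'.hcomp H') where
  fV := Equiv.sumCongr f.fV g.fV
  fE := Equiv.sumCongr f.fE g.fE
  fI := Equiv.sumCongr f.fI g.fI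
  fO := Equiv.sumCongr f.fO g.fO
  fT := Equiv.sumCongr f.fT g.fT
  fL := Equiv.sumCongr f.fL g.fL
  src_E := by
    rintro (e | e)
    exacts [congrArg Sum.inl (f.src_E e), congrArg Sum.inr (g.src_E e)]
  src_O := by
    rintro (e | e)
    exacts [congrArg Sum.inl (f.src_O e), congrArg Sum.inr (g.src_O e)]
  tgt_E := by
    rintro (e | e)
    exacts [congrArg Sum.inl (f.tgt_E e), congrArg Sum.inr (g.tgt_E e)]
  tgt_I := by
    rintro (e | e)
    exacts [congrArg Sum.inl (f.tgt_I e), congrArg Sum.inr (g.tgt_I e)]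
  in_I := by
    rintro (e | e)
    exacts [congrArg (Fin.castAdd k') (f.in_I e), congrArg (Fin.natAdd k) (g.in_I e)]
  in_T := by
    rintro (e | e)
    exacts [congrArg (Fin.castAdd k') (f.in_T e), congrArg (Fin.natAdd k) (g.in_T e)]
  out_O := by
    rintro (e | e)
    exacts [congrArg (Fin.castAdd l') (f.out_O e), congrArg (Fin.natAdd l) (g.out_O e)]
  out_T := by
    rintro (e | e)
    exacts [congrArg (Fin.castAdd l') (f.out_T e), congrArg (Fin.natAdd l) (g.out_T e)]

/-- Vertical concatenation is compatible with isomorphisms. -/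
def Iso.vcomp {k l m : ℕ} {H H' : OGraph l m} {G G' : OGraph k l}
    (g : Iso H H') (f : Iso G G') : Iso (H.vcomp G) (H'.vcomp G') where
  fV := Equiv.sumCongr f.fV g.fV
  fE := Equiv.sumCongr f.fE (Equiv.sumCongr g.fE
    ((Equiv.prodCongr f.fO g.fI).subtypeEquiv (by simp [f.out_O, g.in_I])))
  fI := Equiv.sumCongr f.fI
    ((Equiv.prodCongr f.fT g.fI).subtypeEquiv (by simp [f.out_T, g.in_I]))
  fO := Equiv.sumCongr g.fO
    ((Equiv.prodCongr f.fO g.fT).subtypeEquiv (by simp [f.out_O, g.in_T]))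
  fT := (Equiv.prodCongr f.fT g.fT).subtypeEquiv (by simp [f.out_T, g.in_T])
  fL := Equiv.sumCongr f.fL g.fL
  src_E := by
    rintro (e | e | e)
    exacts [congrArg Sum.inl (f.src_E e), congrArg Sum.inr (g.src_E e),
      congrArg Sum.inl (f.src_O e.1.1)]
  src_O := by
    rintro (e | e)
    exacts [congrArg Sum.inr (g.src_O e), congrArg Sum.inl (f.src_O e.1.1)]
  tgt_E := by
    rintro (e | e | e)
    exacts [congrArg Sum.inl (f.tgt_E e), congrArg Sum.inr (g.tgt_E e),
      congrArg Sum.inr (g.tgt_I e.1.2)]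
  tgt_I := by
    rintro (e | e)
    exacts [congrArg Sum.inl (f.tgt_I e), congrArg Sum.inr (g.tgt_I e.1.2)]
  in_I := by
    rintro (e | e)
    exacts [f.in_I e, f.in_T e.1.1]
  in_T e := f.in_T e.1.1
  out_O := by
    rintro (e | e)
    exacts [g.out_O e, g.out_T e.1.2]
  out_T e := g.out_T e.1.2

/-- Associativity of the vertical concatenation. -/
def isoVcompAssoc {k l m n : ℕ} (K : OGraph m n) (H : OGraph l m) (G : OGraph k l) :
    Iso (K.vcomp (H.vcomp G)) ((K.vcomp H).vcomp G) where
  fV := Equiv.sumAssoc _ _ _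
  fE :=
    { toFun := fun
        | .inl (.inl e) => .inl e
        | .inl (.inr (.inl e)) => .inr (.inl (.inl e))
        | .inl (.inr (.inr ⟨(f, e), h⟩)) => .inr (.inr ⟨(f, .inl e), h⟩)
        | .inr (.inl e) => .inr (.inl (.inr (.inl e)))
        | .inr (.inr ⟨(.inl f, e), h⟩) => .inr (.inl (.inr (.inr ⟨(f, e), h⟩)))
        | .inr (.inr ⟨(.inr ⟨(f, g), h'⟩, e), h⟩) => .inr (.inr ⟨(f, .inr ⟨(g, e), h⟩), h'⟩)
      invFun := fun
        | .inl e => .inl (.inl e)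
        | .inr (.inl (.inl e)) => .inl (.inr (.inl e))
        | .inr (.inr ⟨(f, .inl e), h⟩) => .inl (.inr (.inr ⟨(f, e), h⟩))
        | .inr (.inl (.inr (.inl e))) => .inr (.inl e)
        | .inr (.inl (.inr (.inr ⟨(f, e), h⟩))) => .inr (.inr ⟨(.inl f, e), h⟩)
        | .inr (.inr ⟨(f, .inr ⟨(g, e), h⟩), h'⟩) => .inr (.inr ⟨(.inr ⟨(f, g), h'⟩, e), h⟩)
      left_inv := by
        rintro ((e | e | ⟨⟨f, e⟩, h⟩) | e | ⟨⟨f | ⟨⟨f, g⟩, h'⟩, e⟩, h⟩) <;> rfl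
      right_inv := by
        rintro (e | (e | e | ⟨⟨f, e⟩, h⟩) | ⟨⟨f, e | ⟨⟨g, e⟩, h'⟩⟩, h⟩) <;> rfl }
  fI :=
    { toFun := fun
        | .inl (.inl e) => .inl e
        | .inl (.inr ⟨(f, e), h⟩) => .inr ⟨(f, .inl e), h⟩
        | .inr ⟨(⟨(f, g), h'⟩, e), h⟩ => .inr ⟨(f, .inr ⟨(g, e), h⟩), h'⟩
      invFun := fun
        | .inl e => .inl (.inl e)
        | .inr ⟨(f, .inl e), h⟩ => .inl (.inr ⟨(f, e), h⟩)
        | .inr ⟨(f, .inr ⟨(g, e), h⟩), h'⟩ => .inr ⟨(⟨(f, g), h'⟩, e), h⟩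
      left_inv := by
        rintro ((e | ⟨⟨f, e⟩, h⟩) | ⟨⟨⟨⟨f, g⟩, h'⟩, e⟩, h⟩) <;> rfl
      right_inv := by
        rintro (e | ⟨⟨f, e | ⟨⟨g, e⟩, h'⟩⟩, h⟩) <;> rfl }
  fO :=
    { toFun := fun
        | .inl e => .inl (.inl e)
        | .inr ⟨(.inl f, e), h⟩ => .inl (.inr ⟨(f, e), h⟩)
        | .inr ⟨(.inr ⟨(f, g), h'⟩, e), h⟩ => .inr ⟨(f, ⟨(g, e), h⟩), h'⟩
      invFun := fun
        | .inl (.inl e) => .inl e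
        | .inl (.inr ⟨(f, e), h⟩) => .inr ⟨(.inl f, e), h⟩
        | .inr ⟨(f, ⟨(g, e), h⟩), h'⟩ => .inr ⟨(.inr ⟨(f, g), h'⟩, e), h⟩
      left_inv := by
        rintro (e | ⟨⟨f | ⟨⟨f, g⟩, h'⟩, e⟩, h⟩) <;> rfl
      right_inv := by
        rintro ((e | ⟨⟨f, e⟩, h⟩) | ⟨⟨f, ⟨⟨g, e⟩, h'⟩⟩, h⟩) <;> rfl }
  fT :=
    { toFun := fun ⟨(⟨(f, g), h'⟩, e), h⟩ => ⟨(f, ⟨(g, e), h⟩), h'⟩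
      invFun := fun ⟨(f, ⟨(g, e), h⟩), h'⟩ => ⟨(⟨(f, g), h'⟩, e), h⟩
      left_inv := fun _ => rfl
      right_inv := fun _ => rfl }
  fL := Equiv.sumAssoc _ _ _
  src_E := by rintro ((e | e | ⟨⟨f, e⟩, h⟩) | e | ⟨⟨f | ⟨⟨f, g⟩, h'⟩, e⟩, h⟩) <;> rfl
  src_O := by rintro (e | ⟨⟨f | ⟨⟨f, g⟩, h'⟩, e⟩, h⟩) <;> rfl
  tgt_E := by rintro ((e | e | ⟨⟨f, e⟩, h⟩) | e | ⟨⟨f | ⟨⟨f, g⟩, h'⟩, e⟩, h⟩) <;> rfl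
  tgt_I := by rintro ((e | ⟨⟨f, e⟩, h⟩) | ⟨⟨⟨⟨f, g⟩, h'⟩, e⟩, h⟩) <;> rfl
  in_I := by rintro ((e | ⟨⟨f, e⟩, h⟩) | ⟨⟨⟨⟨f, g⟩, h'⟩, e⟩, h⟩) <;> rfl
  in_T _ := rfl
  out_O := by rintro (e | ⟨⟨f | ⟨⟨f, g⟩, h'⟩, e⟩, h⟩) <;> rfl
  out_T _ := rfl

/-- `I_n` is a right unit of the vertical concatenation. -/
def isoVcompIdn {k l : ℕ} (G : OGraph k l) : Iso (G.vcomp (idn k)) G where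
  fV := Equiv.emptySum Empty G.V
  fE :=
    { toFun := fun
        | .inr (.inl e) => e
      invFun := fun e => .inr (.inl e)
      left_inv := by rintro (⟨⟨⟩⟩ | e | ⟨⟨⟨⟩, e⟩, h⟩); rfl
      right_inv := fun _ => rfl }
  fI :=
    { toFun := fun
        | .inr p => p.1.2
      invFun := fun e => .inr ⟨(G.inIdx (.inl e), e), rfl⟩
      left_inv := by
        rintro (⟨⟨⟩⟩ | ⟨⟨i, e⟩, h⟩)
        obtain rfl : i = G.inIdx (.inl e) := h
        rfl
      right_inv := fun _ => rfl }
  fO :=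
    { toFun := fun
        | .inl e => e
      invFun := fun e => .inl e
      left_inv := by rintro (e | ⟨⟨⟨⟩, e⟩, h⟩); rfl
      right_inv := fun _ => rfl }
  fT :=
    { toFun := fun p => p.1.2
      invFun := fun e => ⟨(G.inIdx (.inr e), e), rfl⟩
      left_inv := by
        rintro ⟨⟨i, e⟩, h⟩
        obtain rfl : i = G.inIdx (.inr e) := h
        rfl
      right_inv := fun _ => rfl }
  fL := Equiv.emptySum Empty G.L
  src_E := by rintro (⟨⟨⟩⟩ | e | ⟨⟨⟨⟩, e⟩, h⟩); rfl
  src_O := by rintro (e | ⟨⟨⟨⟩, e⟩, h⟩); rfl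
  tgt_E := by rintro (⟨⟨⟩⟩ | e | ⟨⟨⟨⟩, e⟩, h⟩); rfl
  tgt_I := by rintro (⟨⟨⟩⟩ | ⟨⟨i, e⟩, h⟩); rfl
  in_I := by rintro (⟨⟨⟩⟩ | ⟨⟨i, e⟩, h⟩); exact h.symm
  in_T := by rintro ⟨⟨i, e⟩, h⟩; exact h.symm
  out_O := by rintro (e | ⟨⟨⟨⟩, e⟩, h⟩); rfl
  out_T _ := rfl

/-- `I_n` is a left unit of the vertical concatenation. -/
def isoIdnVcomp {k l : ℕ} (G : OGraph k l) : Iso ((idn l).vcomp G) G where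
  fV := Equiv.sumEmpty G.V Empty
  fE :=
    { toFun := fun
        | .inl e => e
      invFun := fun e => .inl e
      left_inv := by rintro (e | ⟨⟨⟩⟩ | ⟨⟨e, ⟨⟩⟩, h⟩); rfl
      right_inv := fun _ => rfl }
  fI :=
    { toFun := fun
        | .inl e => e
      invFun := fun e => .inl e
      left_inv := by rintro (e | ⟨⟨e, ⟨⟩⟩, h⟩); rfl
      right_inv := fun _ => rfl }
  fO :=
    { toFun := fun
        | .inr p => p.1.1
      invFun := fun e => .inr ⟨(e, G.outIdx (.inl e)), rfl⟩
      left_inv := by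
        rintro (⟨⟨⟩⟩ | ⟨⟨e, i⟩, h⟩)
        obtain rfl : G.outIdx (.inl e) = i := h
        rfl
      right_inv := fun _ => rfl }
  fT :=
    { toFun := fun p => p.1.1
      invFun := fun e => ⟨(e, G.outIdx (.inr e)), rfl⟩
      left_inv := by
        rintro ⟨⟨e, i⟩, h⟩
        obtain rfl : G.outIdx (.inr e) = i := h
        rfl
      right_inv := fun _ => rfl }
  fL := Equiv.sumEmpty G.L Empty
  src_E := by rintro (e | ⟨⟨⟩⟩ | ⟨⟨e, ⟨⟩⟩, h⟩); rfl
  src_O := by rintro (⟨⟨⟩⟩ | ⟨⟨e, i⟩, h⟩); rfl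
  tgt_E := by rintro (e | ⟨⟨⟩⟩ | ⟨⟨e, ⟨⟩⟩, h⟩); rfl
  tgt_I := by rintro (e | ⟨⟨e, ⟨⟩⟩, h⟩); rfl
  in_I := by rintro (e | ⟨⟨e, ⟨⟩⟩, h⟩); rfl
  in_T _ := rfl
  out_O := by rintro (⟨⟨⟩⟩ | ⟨⟨e, i⟩, h⟩); exact h
  out_T := by rintro ⟨⟨e, i⟩, h⟩; exact h

/-- `I_{n+1} = I_n * I_1`. -/
def isoIdnSucc (n : ℕ) : Iso ((idn n).hcomp (idn 1)) (idn (n + 1)) where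
  fV := Equiv.sumEmpty Empty Empty
  fE := Equiv.sumEmpty Empty Empty
  fI := Equiv.sumEmpty Empty Empty
  fO := Equiv.sumEmpty Empty Empty
  fT := finSumFinEquiv
  fL := Equiv.sumEmpty Empty Empty
  src_E := by rintro (⟨⟨⟩⟩ | ⟨⟨⟩⟩)
  src_O := by rintro (⟨⟨⟩⟩ | ⟨⟨⟩⟩)
  tgt_E := by rintro (⟨⟨⟩⟩ | ⟨⟨⟩⟩)
  tgt_I := by rintro (⟨⟨⟩⟩ | ⟨⟨⟩⟩)
  in_I := by rintro (⟨⟨⟩⟩ | ⟨⟨⟩⟩)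
  in_T := by rintro (i | i) <;> rfl
  out_O := by rintro (⟨⟨⟩⟩ | ⟨⟨⟩⟩)
  out_T := by rintro (i | i) <;> rfl

/-- Associativity of the horizontal concatenation. -/
def isoHcompAssoc {k l k' l' k'' l'' : ℕ} (G : OGraph k l) (H : OGraph k' l')
    (K : OGraph k'' l'') :
    Iso (((G.hcomp H).hcomp K).relabel (finCongr (Nat.add_assoc k k' k''))
      (finCongr (Nat.add_assoc l l' l''))) (G.hcomp (H.hcomp K)) where
  fV := Equiv.sumAssoc _ _ _
  fE := Equiv.sumAssoc _ _ _
  fI := Equiv.sumAssoc _ _ _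
  fO := Equiv.sumAssoc _ _ _
  fT := Equiv.sumAssoc _ _ _
  fL := Equiv.sumAssoc _ _ _
  src_E := by rintro ((e | e) | e) <;> rfl
  src_O := by rintro ((e | e) | e) <;> rfl
  tgt_E := by rintro ((e | e) | e) <;> rfl
  tgt_I := by rintro ((e | e) | e) <;> rfl
  in_I := by
    rintro ((e | e) | e)
    exacts [rfl, rfl, Fin.ext (Nat.add_assoc _ _ _).symm]
  in_T := by
    rintro ((e | e) | e)
    exacts [rfl, rfl, Fin.ext (Nat.add_assoc _ _ _).symm]
  out_O := by
    rintro ((e | e) | e)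
    exacts [rfl, rfl, Fin.ext (Nat.add_assoc _ _ _).symm]
  out_T := by
    rintro ((e | e) | e)
    exacts [rfl, rfl, Fin.ext (Nat.add_assoc _ _ _).symm]

/-- `I_0` is a right unit of the horizontal concatenation. -/
def isoHcompIdn {k l : ℕ} (G : OGraph k l) : Iso (G.hcomp (idn 0)) G where
  fV := Equiv.sumEmpty G.V Empty
  fE := Equiv.sumEmpty G.E Empty
  fI := Equiv.sumEmpty G.I Empty
  fO := Equiv.sumEmpty G.O Empty
  fT := Equiv.sumEmpty G.T (Fin 0)
  fL := Equiv.sumEmpty G.L Empty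
  src_E := by rintro (e | ⟨⟨⟩⟩); rfl
  src_O := by rintro (e | ⟨⟨⟩⟩); rfl
  tgt_E := by rintro (e | ⟨⟨⟩⟩); rfl
  tgt_I := by rintro (e | ⟨⟨⟩⟩); rfl
  in_I := by rintro (e | ⟨⟨⟩⟩); rfl
  in_T := by
    rintro (e | e)
    · rfl
    · exact Fin.elim0 e
  out_O := by rintro (e | ⟨⟨⟩⟩); rfl
  out_T := by
    rintro (e | e)
    · rfl
    · exact Fin.elim0 e

/-- `I_0` is a left unit of the horizontal concatenation. -/
def isoIdnHcomp {k l : ℕ} (G : OGraph k l) :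
    Iso (((idn 0).hcomp G).relabel (finCongr (Nat.zero_add k)) (finCongr (Nat.zero_add l))) G where
  fV := Equiv.emptySum Empty G.V
  fE := Equiv.emptySum Empty G.E
  fI := Equiv.emptySum Empty G.I
  fO := Equiv.emptySum Empty G.O
  fT := Equiv.emptySum (Fin 0) G.T
  fL := Equiv.emptySum Empty G.L
  src_E := by rintro (⟨⟨⟩⟩ | e); rfl
  src_O := by rintro (⟨⟨⟩⟩ | e); rfl
  tgt_E := by rintro (⟨⟨⟩⟩ | e); rfl
  tgt_I := by rintro (⟨⟨⟩⟩ | e); rfl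
  in_I := by rintro (⟨⟨⟩⟩ | e); exact Fin.ext (Nat.zero_add _).symm
  in_T := by
    rintro (e | e)
    · exact Fin.elim0 e
    · exact Fin.ext (Nat.zero_add _).symm
  out_O := by rintro (⟨⟨⟩⟩ | e); exact Fin.ext (Nat.zero_add _).symm
  out_T := by
    rintro (e | e)
    · exact Fin.elim0 e
    · exact Fin.ext (Nat.zero_add _).symm

/-- The edges glued in a vertical concatenation of two horizontal concatenations. -/
def glueEquiv {A A' B B' : Type} {m n : ℕ} (u : A ⊕ A' → Fin (m + n)) (w : B ⊕ B' → Fin (m + n))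
    (a : A → Fin m) (a' : A' → Fin n) (b : B → Fin m) (b' : B' → Fin n)
    (hu : ∀ x, u x = finSumFinEquiv (Sum.map a a' x))
    (hw : ∀ x, w x = finSumFinEquiv (Sum.map b b' x)) :
    {p : (A ⊕ A') × (B ⊕ B') // u p.1 = w p.2} ≃
    {p : A × B // a p.1 = b p.2} ⊕ {p : A' × B' // a' p.1 = b' p.2} where
  toFun
    | ⟨(.inl x, .inl y), h⟩ => .inl ⟨(x, y), Sum.inl_injective
        (finSumFinEquiv.injective ((hu (.inl x)).symm.trans (h.trans (hw (.inl y)))))⟩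
    | ⟨(.inr x, .inr y), h⟩ => .inr ⟨(x, y), Sum.inr_injective
        (finSumFinEquiv.injective ((hu (.inr x)).symm.trans (h.trans (hw (.inr y)))))⟩
    | ⟨(.inl x, .inr y), h⟩ => absurd
        (finSumFinEquiv.injective ((hu (.inl x)).symm.trans (h.trans (hw (.inr y)))))
        Sum.inl_ne_inr
    | ⟨(.inr x, .inl y), h⟩ => absurd
        (finSumFinEquiv.injective ((hu (.inr x)).symm.trans (h.trans (hw (.inl y)))))
        Sum.inr_ne_inl
  invFun
    | .inl ⟨(x, y), h⟩ => ⟨(.inl x, .inl y), (hu (.inl x)).trans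
        ((congrArg (Fin.castAdd n) h).trans (hw (.inl y)).symm)⟩
    | .inr ⟨(x, y), h⟩ => ⟨(.inr x, .inr y), (hu (.inr x)).trans
        ((congrArg (Fin.natAdd m) h).trans (hw (.inr y)).symm)⟩
  left_inv := by
    rintro ⟨⟨x | x, y | y⟩, h⟩
    · rfl
    · exact absurd (finSumFinEquiv.injective ((hu _).symm.trans (h.trans (hw _)))) Sum.inl_ne_inr
    · exact absurd (finSumFinEquiv.injective ((hu _).symm.trans (h.trans (hw _)))) Sum.inr_ne_inl
    · rfl
  right_inv := by rintro (⟨⟨x, y⟩, h⟩ | ⟨⟨x, y⟩, h⟩) <;> rfl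

/-- Compatibility of the two concatenations. -/
def isoInterchange {k l m k' l' m' : ℕ} (H : OGraph l m) (H' : OGraph l' m') (G : OGraph k l)
    (G' : OGraph k' l') :
    Iso ((H.hcomp H').vcomp (G.hcomp G')) ((H.vcomp G).hcomp (H'.vcomp G')) where
  fV := Equiv.sumSumSumComm _ _ _ _
  fE := (Equiv.sumCongr (Equiv.refl _) (Equiv.sumCongr (Equiv.refl _)
      (glueEquiv (fun e => (G.hcomp G').outIdx (.inl e)) (fun e => (H.hcomp H').inIdx (.inl e))
        (fun e => G.outIdx (.inl e)) (fun e => G'.outIdx (.inl e))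
        (fun e => H.inIdx (.inl e)) (fun e => H'.inIdx (.inl e))
        (by rintro (e | e) <;> rfl) (by rintro (e | e) <;> rfl)))).trans
    ((Equiv.sumCongr (Equiv.refl _) (Equiv.sumSumSumComm _ _ _ _)).trans
      (Equiv.sumSumSumComm _ _ _ _))
  fI := (Equiv.sumCongr (Equiv.refl _)
      (glueEquiv (fun e => (G.hcomp G').outIdx (.inr e)) (fun e => (H.hcomp H').inIdx (.inl e))
        (fun e => G.outIdx (.inr e)) (fun e => G'.outIdx (.inr e))
        (fun e => H.inIdx (.inl e)) (fun e => H'.inIdx (.inl e))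
        (by rintro (e | e) <;> rfl) (by rintro (e | e) <;> rfl))).trans
    (Equiv.sumSumSumComm _ _ _ _)
  fO := (Equiv.sumCongr (Equiv.refl _)
      (glueEquiv (fun e => (G.hcomp G').outIdx (.inl e)) (fun e => (H.hcomp H').inIdx (.inr e))
        (fun e => G.outIdx (.inl e)) (fun e => G'.outIdx (.inl e))
        (fun e => H.inIdx (.inr e)) (fun e => H'.inIdx (.inr e))
        (by rintro (e | e) <;> rfl) (by rintro (e | e) <;> rfl))).trans
    (Equiv.sumSumSumComm _ _ _ _)
  fT := glueEquiv (fun e => (G.hcomp G').outIdx (.inr e)) (fun e => (H.hcomp H').inIdx (.inr e))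
        (fun e => G.outIdx (.inr e)) (fun e => G'.outIdx (.inr e))
        (fun e => H.inIdx (.inr e)) (fun e => H'.inIdx (.inr e))
        (by rintro (e | e) <;> rfl) (by rintro (e | e) <;> rfl)
  fL := Equiv.sumSumSumComm _ _ _ _
  src_E := by
    rintro ((e | e) | (e | e) | ⟨⟨e | e, f | f⟩, h⟩)
    all_goals first | rfl | exact absurd (finSumFinEquiv.injective h) (by rintro ⟨⟩)
  src_O := by
    rintro ((e | e) | ⟨⟨e | e, f | f⟩, h⟩)
    all_goals first | rfl | exact absurd (finSumFinEquiv.injective h) (by rintro ⟨⟩)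
  tgt_E := by
    rintro ((e | e) | (e | e) | ⟨⟨e | e, f | f⟩, h⟩)
    all_goals first | rfl | exact absurd (finSumFinEquiv.injective h) (by rintro ⟨⟩)
  tgt_I := by
    rintro ((e | e) | ⟨⟨e | e, f | f⟩, h⟩)
    all_goals first | rfl | exact absurd (finSumFinEquiv.injective h) (by rintro ⟨⟩)
  in_I := by
    rintro ((e | e) | ⟨⟨e | e, f | f⟩, h⟩)
    all_goals first | rfl | exact absurd (finSumFinEquiv.injective h) (by rintro ⟨⟩)
  in_T := by
    rintro ⟨⟨e | e, f | f⟩, h⟩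
    all_goals first | rfl | exact absurd (finSumFinEquiv.injective h) (by rintro ⟨⟩)
  out_O := by
    rintro ((e | e) | ⟨⟨e | e, f | f⟩, h⟩)
    all_goals first | rfl | exact absurd (finSumFinEquiv.injective h) (by rintro ⟨⟩)
  out_T := by
    rintro ⟨⟨e | e, f | f⟩, h⟩
    all_goals first | rfl | exact absurd (finSumFinEquiv.injective h) (by rintro ⟨⟩)

/-- Compatibility of the vertical concatenation with the outer renumberings. -/
def isoRelabelVcomp {k l m : ℕ} (a : Equiv.Perm (Fin k)) (b : Equiv.Perm (Fin m))
    (H : OGraph l m) (G : OGraph k l) :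
    Iso ((H.vcomp G).relabel a b)
      ((H.relabel (Equiv.refl _) b).vcomp (G.relabel a (Equiv.refl _))) where
  fV := Equiv.refl _
  fE := Equiv.refl _
  fI := Equiv.refl _
  fO := Equiv.refl _
  fT := Equiv.refl _
  fL := Equiv.refl _
  src_E := by rintro (e | e | e) <;> rfl
  src_O := by rintro (e | e) <;> rfl
  tgt_E := by rintro (e | e | e) <;> rfl
  tgt_I := by rintro (e | e) <;> rfl
  in_I := by rintro (e | e) <;> rfl
  in_T _ := rfl
  out_O := by rintro (e | e) <;> rfl
  out_T _ := rfl

/-- Compatibility of the vertical concatenation with the inner renumberings. -/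
def isoVcompMiddle {k l m : ℕ} (t : Equiv.Perm (Fin l)) (H : OGraph l m) (G : OGraph k l) :
    Iso ((H.relabel t⁻¹ (Equiv.refl _)).vcomp G) (H.vcomp (G.relabel (Equiv.refl _) t)) where
  fV := Equiv.refl _
  fE := Equiv.sumCongr (Equiv.refl _) (Equiv.sumCongr (Equiv.refl _)
    (Equiv.subtypeEquivRight fun _ => Equiv.Perm.eq_inv_iff_eq))
  fI := Equiv.sumCongr (Equiv.refl _) (Equiv.subtypeEquivRight fun _ => Equiv.Perm.eq_inv_iff_eq)
  fO := Equiv.sumCongr (Equiv.refl _) (Equiv.subtypeEquivRight fun _ => Equiv.Perm.eq_inv_iff_eq)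
  fT := Equiv.subtypeEquivRight fun _ => Equiv.Perm.eq_inv_iff_eq
  fL := Equiv.refl _
  src_E := by rintro (e | e | e) <;> rfl
  src_O := by rintro (e | e) <;> rfl
  tgt_E := by rintro (e | e | e) <;> rfl
  tgt_I := by rintro (e | e) <;> rfl
  in_I := by rintro (e | e) <;> rfl
  in_T _ := rfl
  out_O := by rintro (e | e) <;> rfl
  out_T _ := rfl

/-- Compatibility of the horizontal concatenation with the renumberings. -/
def isoRelabelHcomp {k l k' l' : ℕ} (a : Equiv.Perm (Fin k)) (b : Equiv.Perm (Fin l))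
    (a' : Equiv.Perm (Fin k')) (b' : Equiv.Perm (Fin l')) (G : OGraph k l) (H : OGraph k' l') :
    Iso ((G.relabel a b).hcomp (H.relabel a' b'))
      ((G.hcomp H).relabel (permTensor a a') (permTensor b b')) where
  fV := Equiv.refl _
  fE := Equiv.refl _
  fI := Equiv.refl _
  fO := Equiv.refl _
  fT := Equiv.refl _
  fL := Equiv.refl _
  src_E _ := rfl
  src_O _ := rfl
  tgt_E _ := rfl
  tgt_I _ := rfl
  in_I := by
    rintro (e | e) <;> exact congrArg (fun i => finSumFinEquiv (Sum.map a a' i))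
      (finSumFinEquiv.symm_apply_apply _)
  in_T := by
    rintro (e | e) <;> exact congrArg (fun i => finSumFinEquiv (Sum.map a a' i))
      (finSumFinEquiv.symm_apply_apply _)
  out_O := by
    rintro (e | e) <;> exact congrArg (fun i => finSumFinEquiv (Sum.map b b' i))
      (finSumFinEquiv.symm_apply_apply _)
  out_T := by
    rintro (e | e) <;> exact congrArg (fun i => finSumFinEquiv (Sum.map b b' i))
      (finSumFinEquiv.symm_apply_apply _)

/-- Commutativity of the horizontal concatenation up to block permutations. -/
def isoHcompComm {k l k' l' : ℕ} (G : OGraph k l) (H : OGraph k' l') :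
    Iso ((G.hcomp H).relabel (blockSwap k k') (blockSwap l l'))
      ((H.hcomp G).relabel (finCongr (Nat.add_comm k' k)) (finCongr (Nat.add_comm l' l))) where
  fV := Equiv.sumComm _ _
  fE := Equiv.sumComm _ _
  fI := Equiv.sumComm _ _
  fO := Equiv.sumComm _ _
  fT := Equiv.sumComm _ _
  fL := Equiv.sumComm _ _
  src_E := by rintro (e | e) <;> rfl
  src_O := by rintro (e | e) <;> rfl
  tgt_E := by rintro (e | e) <;> rfl
  tgt_I := by rintro (e | e) <;> rfl
  in_I := by
    rintro (e | e)
    exacts [congrArg (finCongr (Nat.add_comm k' k))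
        (finAddFlip_apply_castAdd (G.inIdx (.inl e)) k').symm,
      congrArg (finCongr (Nat.add_comm k' k)) (finAddFlip_apply_natAdd (H.inIdx (.inl e)) k).symm]
  in_T := by
    rintro (e | e)
    exacts [congrArg (finCongr (Nat.add_comm k' k))
        (finAddFlip_apply_castAdd (G.inIdx (.inr e)) k').symm,
      congrArg (finCongr (Nat.add_comm k' k)) (finAddFlip_apply_natAdd (H.inIdx (.inr e)) k).symm]
  out_O := by
    rintro (e | e)
    exacts [congrArg (finCongr (Nat.add_comm l' l))
        (finAddFlip_apply_castAdd (G.outIdx (.inl e)) l').symm,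
      congrArg (finCongr (Nat.add_comm l' l)) (finAddFlip_apply_natAdd (H.outIdx (.inl e)) l).symm]
  out_T := by
    rintro (e | e)
    exacts [congrArg (finCongr (Nat.add_comm l' l))
        (finAddFlip_apply_castAdd (G.outIdx (.inr e)) l').symm,
      congrArg (finCongr (Nat.add_comm l' l)) (finAddFlip_apply_natAdd (H.outIdx (.inr e)) l).symm]

/-- The graph which consists of a single loop. -/
def IsSingleLoop {k l : ℕ} (G : OGraph k l) : Prop :=
  IsEmpty G.V ∧ IsEmpty G.E ∧ IsEmpty G.I ∧ IsEmpty G.O ∧ IsEmpty G.T ∧ Nat.card G.L = 1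

/-- Indecomposable graphs: the single loop, and the graphs with at least one vertex, without
input-output edges and without loops, which are neither a vertical concatenation nor, up to a
renumbering of the inputs and of the outputs, a horizontal concatenation of two graphs that both
have vertices. The bijections `a` and `b` combine the equalities `k = k₁ + k₂`, `l = l₁ + l₂` with
the permutations `τ⁻¹` and `σ` of `σ · (H * K) · τ`. -/
def IsIndecomposable {k l : ℕ} (G : OGraph k l) : Prop :=
  G.IsSingleLoop ∨
  (Nonempty G.V ∧ IsEmpty G.T ∧ IsEmpty G.L ∧
    (∀ (m : ℕ) (H : OGraph m l) (K : OGraph k m),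
      Nonempty (Iso G (H.vcomp K)) → IsEmpty H.V ∨ IsEmpty K.V) ∧
    (∀ (k₁ l₁ k₂ l₂ : ℕ) (H : OGraph k₁ l₁) (K : OGraph k₂ l₂)
      (a : Fin (k₁ + k₂) ≃ Fin k) (b : Fin (l₁ + l₂) ≃ Fin l),
      Nonempty (Iso G ((H.hcomp K).relabel a b)) → IsEmpty H.V ∨ IsEmpty K.V))

/-- Indecomposability does not depend on the numbering of the inputs and of the outputs. -/
theorem IsIndecomposable.relabel {k l : ℕ} {G : OGraph k l} (hG : G.IsIndecomposable)
    (a : Equiv.Perm (Fin k)) (b : Equiv.Perm (Fin l)) : (G.relabel a b).IsIndecomposable := by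
  have key : (G.relabel a b).relabel a.symm b.symm = G := by simp [OGraph.relabel]
  rcases hG with hG | ⟨h1, h2, h3, h4, h5⟩
  · exact .inl hG
  · refine .inr ⟨h1, h2, h3, fun m H K ⟨f⟩ => ?_, fun k₁ l₁ k₂ l₂ H K a' b' ⟨f⟩ => ?_⟩
    · have f' := f.relabel a.symm b.symm
      rw [key] at f'
      exact h4 m (H.relabel (Equiv.refl _) b.symm) (K.relabel a.symm (Equiv.refl _))
        ⟨f'.trans (isoRelabelVcomp a.symm b.symm H K)⟩
    · have f' := f.relabel a.symm b.symm
      rw [key] at f'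
      exact h5 k₁ l₁ k₂ l₂ H K (a'.trans a.symm) (b'.trans b.symm) ⟨f'⟩

end OGraph

/-! ## Isomorphism classes of graphs -/

/-- Isomorphism classes of graphs with `k` inputs and `l` outputs. -/
def GraphClass (k l : ℕ) : Type 1 := Quotient (OGraph.setoid k l)

namespace GraphClass

/-- The isomorphism class of a graph. -/
def mk {k l : ℕ} (G : OGraph k l) : GraphClass k l := Quotient.mk _ G

/-- Renumbering of the inputs and of the outputs. -/
def relabel {k l k' l' : ℕ} (a : Fin k ≃ Fin k') (b : Fin l ≃ Fin l') :
    GraphClass k l → GraphClass k' l' :=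
  Quotient.map (OGraph.relabel a b) fun _ _ ⟨f⟩ => ⟨f.relabel a b⟩

/-- Horizontal concatenation. -/
def hcomp {k l k' l' : ℕ} : GraphClass k l → GraphClass k' l' → GraphClass (k + k') (l + l') :=
  Quotient.map₂ OGraph.hcomp fun _ _ ⟨f⟩ _ _ ⟨g⟩ => ⟨f.hcomp g⟩

/-- Vertical concatenation. -/
def vcomp {k l m : ℕ} : GraphClass l m → GraphClass k l → GraphClass k m :=
  Quotient.map₂ OGraph.vcomp fun _ _ ⟨f⟩ _ _ ⟨g⟩ => ⟨f.vcomp g⟩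

theorem mk_eq {k l : ℕ} {G H : OGraph k l} (f : OGraph.Iso G H) : mk G = mk H :=
  Quotient.sound ⟨f⟩

theorem relabel_refl {k l : ℕ} (x : GraphClass k l) :
    x.relabel (Equiv.refl _) (Equiv.refl _) = x := by
  induction x using Quotient.inductionOn; rfl

theorem relabel_relabel {k l k' l' k'' l'' : ℕ} (a : Fin k ≃ Fin k') (b : Fin l ≃ Fin l')
    (a' : Fin k' ≃ Fin k'') (b' : Fin l' ≃ Fin l'') (x : GraphClass k l) :
    (x.relabel a b).relabel a' b' = x.relabel (a.trans a') (b.trans b') := by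
  induction x using Quotient.inductionOn; rfl

theorem hcomp_assoc {k l k' l' k'' l'' : ℕ} (x : GraphClass k l) (y : GraphClass k' l')
    (z : GraphClass k'' l'') :
    x.hcomp (y.hcomp z) = ((x.hcomp y).hcomp z).relabel (finCongr (Nat.add_assoc k k' k''))
      (finCongr (Nat.add_assoc l l' l'')) := by
  induction x using Quotient.inductionOn
  induction y using Quotient.inductionOn
  induction z using Quotient.inductionOn
  exact (mk_eq (OGraph.isoHcompAssoc _ _ _)).symm

theorem hcomp_idn {k l : ℕ} (x : GraphClass k l) : x.hcomp (mk (OGraph.idn 0)) = x := by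
  induction x using Quotient.inductionOn
  exact mk_eq (OGraph.isoHcompIdn _)

theorem idn_hcomp {k l : ℕ} (x : GraphClass k l) :
    ((mk (OGraph.idn 0)).hcomp x).relabel (finCongr (Nat.zero_add k)) (finCongr (Nat.zero_add l))
      = x := by
  induction x using Quotient.inductionOn
  exact mk_eq (OGraph.isoIdnHcomp _)

theorem vcomp_assoc {k l m n : ℕ} (x : GraphClass m n) (y : GraphClass l m)
    (z : GraphClass k l) : x.vcomp (y.vcomp z) = (x.vcomp y).vcomp z := by
  induction x using Quotient.inductionOn
  induction y using Quotient.inductionOn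
  induction z using Quotient.inductionOn
  exact mk_eq (OGraph.isoVcompAssoc _ _ _)

theorem vcomp_idn {k l : ℕ} (x : GraphClass k l) : x.vcomp (mk (OGraph.idn k)) = x := by
  induction x using Quotient.inductionOn
  exact mk_eq (OGraph.isoVcompIdn _)

theorem idn_vcomp {k l : ℕ} (x : GraphClass k l) : (mk (OGraph.idn l)).vcomp x = x := by
  induction x using Quotient.inductionOn
  exact mk_eq (OGraph.isoIdnVcomp _)

theorem interchange {k l m k' l' m' : ℕ} (x : GraphClass l m) (x' : GraphClass l' m')
    (y : GraphClass k l) (y' : GraphClass k' l') :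
    (x.hcomp x').vcomp (y.hcomp y') = (x.vcomp y).hcomp (x'.vcomp y') := by
  induction x using Quotient.inductionOn
  induction y using Quotient.inductionOn
  induction x' using Quotient.inductionOn
  induction y' using Quotient.inductionOn
  exact mk_eq (OGraph.isoInterchange _ _ _ _)

theorem relabel_vcomp {k l m : ℕ} (a : Equiv.Perm (Fin k)) (b : Equiv.Perm (Fin m))
    (x : GraphClass l m) (y : GraphClass k l) :
    (x.vcomp y).relabel a b = (x.relabel (Equiv.refl _) b).vcomp (y.relabel a (Equiv.refl _)) := by
  induction x using Quotient.inductionOn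
  induction y using Quotient.inductionOn
  exact mk_eq (OGraph.isoRelabelVcomp _ _ _ _)

theorem vcomp_middle {k l m : ℕ} (t : Equiv.Perm (Fin l)) (x : GraphClass l m)
    (y : GraphClass k l) :
    (x.relabel t⁻¹ (Equiv.refl _)).vcomp y = x.vcomp (y.relabel (Equiv.refl _) t) := by
  induction x using Quotient.inductionOn
  induction y using Quotient.inductionOn
  exact mk_eq (OGraph.isoVcompMiddle _ _ _)

theorem relabel_hcomp {k l k' l' : ℕ} (a : Equiv.Perm (Fin k)) (b : Equiv.Perm (Fin l))
    (a' : Equiv.Perm (Fin k')) (b' : Equiv.Perm (Fin l')) (x : GraphClass k l)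
    (y : GraphClass k' l') :
    (x.relabel a b).hcomp (y.relabel a' b') =
      (x.hcomp y).relabel (permTensor a a') (permTensor b b') := by
  induction x using Quotient.inductionOn
  induction y using Quotient.inductionOn
  exact mk_eq (OGraph.isoRelabelHcomp _ _ _ _ _ _)

theorem hcomp_comm {k l k' l' : ℕ} (x : GraphClass k l) (y : GraphClass k' l') :
    (x.hcomp y).relabel (blockSwap k k') (blockSwap l l') =
      (y.hcomp x).relabel (finCongr (Nat.add_comm k' k)) (finCongr (Nat.add_comm l' l)) := by
  induction x using Quotient.inductionOn
  induction y using Quotient.inductionOn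
  exact mk_eq (OGraph.isoHcompComm _ _)

end GraphClass

theorem permTensor_refl (m n : ℕ) :
    permTensor (Equiv.refl (Fin m)) (Equiv.refl (Fin n)) = Equiv.refl _ := by
  ext i; simp [permTensor]

theorem permTensor_inv {m n : ℕ} (a : Equiv.Perm (Fin m)) (b : Equiv.Perm (Fin n)) :
    permTensor a⁻¹ b⁻¹ = (permTensor a b)⁻¹ := rfl

/-! ## The ProP of graphs, and its submodule of indecomposable graphs -/

/-- The bilinear extension to spaces of formal linear combinations of a map of two variables. -/
noncomputable def bilinExt (𝕜 : Type u) [Field 𝕜] {A B C : Type 1} (f : A → B → C) :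
    (A →₀ 𝕜) →ₗ[𝕜] (B →₀ 𝕜) →ₗ[𝕜] (C →₀ 𝕜) :=
  Finsupp.linearCombination 𝕜 fun a => Finsupp.lmapDomain 𝕜 𝕜 (f a)

theorem bilinExt_single (𝕜 : Type u) [Field 𝕜] {A B C : Type 1} (f : A → B → C) (a : A) (b : B)
    (r s : 𝕜) : bilinExt 𝕜 f (Finsupp.single a r) (Finsupp.single b s) =
      Finsupp.single (f a b) (r * s) := by
  simp [bilinExt]

/-- The `𝔖 × 𝔖ᵒᵖ`-module of graphs: `Gr(k, l)` is the vector space with basis the isomorphism classes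
of graphs with `k` inputs and `l` outputs; `σ · G` has output indexation `σ ∘ β`, and `G · τ` has
input indexation `τ⁻¹ ∘ α`. -/
noncomputable def grBimodule (𝕜 : Type u) [Field 𝕜] : SBimodule.{u, max 1 u} 𝕜 where
  carrier k l := GraphClass k l →₀ 𝕜
  lact σ := Finsupp.lmapDomain 𝕜 𝕜 (GraphClass.relabel (Equiv.refl _) σ)
  ract τ := Finsupp.lmapDomain 𝕜 𝕜 (GraphClass.relabel τ⁻¹ (Equiv.refl _))
  one_lact p := by
    induction p using Finsupp.induction_linear with
    | zero => simp only [map_zero]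
    | add p q hp hq => simp only [map_add, hp, hq]
    | single a r =>
      simp only [Finsupp.lmapDomain_apply, Finsupp.mapDomain_single]
      exact congrArg (Finsupp.single · r) (GraphClass.relabel_refl a)
  one_ract p := by
    induction p using Finsupp.induction_linear with
    | zero => simp only [map_zero]
    | add p q hp hq => simp only [map_add, hp, hq]
    | single a r =>
      simp only [Finsupp.lmapDomain_apply, Finsupp.mapDomain_single]
      exact congrArg (Finsupp.single · r) (GraphClass.relabel_refl a)
  lact_lact σ σ' p := by
    simp only [Finsupp.lmapDomain_apply, ← Finsupp.mapDomain_comp]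
    congr 1; ext x; exact GraphClass.relabel_relabel _ _ _ _ x
  lact_ract σ τ p := by
    simp only [Finsupp.lmapDomain_apply, ← Finsupp.mapDomain_comp]
    congr 1; ext x
    exact (GraphClass.relabel_relabel _ _ _ _ x).trans
      (GraphClass.relabel_relabel (Equiv.refl _) σ τ⁻¹ (Equiv.refl _) x).symm
  ract_ract τ τ' p := by
    simp only [Finsupp.lmapDomain_apply, ← Finsupp.mapDomain_comp]
    congr 1; ext x
    exact (GraphClass.relabel_relabel _ _ _ _ x).trans (by rw [mul_inv_rev]; rfl)

/-- The horizontal and vertical concatenations of graphs, extended bilinearly, and the unit graphs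
`I₀` (the empty graph) and `I₁` (a single input-output edge). -/
noncomputable def grData (𝕜 : Type u) [Field 𝕜] : ProPData.{u, max 1 u} 𝕜 where
  toSBimodule := grBimodule 𝕜
  hcomp := bilinExt 𝕜 GraphClass.hcomp
  vcomp := bilinExt 𝕜 GraphClass.vcomp
  unit0 := Finsupp.single (GraphClass.mk (OGraph.idn 0)) (1 : 𝕜)
  unit1 := Finsupp.single (GraphClass.mk (OGraph.idn 1)) (1 : 𝕜)

theorem grData_idn (𝕜 : Type u) [Field 𝕜] (n : ℕ) :
    (grData 𝕜).idn n = Finsupp.single (GraphClass.mk (OGraph.idn n)) (1 : 𝕜) := by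
  induction n with
  | zero => rfl
  | succ n ih =>
    have : (grData 𝕜).idn (n + 1) =
      bilinExt 𝕜 GraphClass.hcomp ((grData 𝕜).idn n)
        (Finsupp.single (GraphClass.mk (OGraph.idn 1)) (1 : 𝕜)) := rfl
    rw [this, ih, bilinExt_single, mul_one]
    exact congrArg (Finsupp.single · (1 : 𝕜)) (GraphClass.mk_eq (OGraph.isoIdnSucc n))

theorem grBimodule_castTo (𝕜 : Type u) [Field 𝕜] {k l k' l' : ℕ} (hk : k = k') (hl : l = l')
    (p : GraphClass k l →₀ 𝕜) :
    (grBimodule 𝕜).castTo hk hl p =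
      Finsupp.lmapDomain 𝕜 𝕜 (GraphClass.relabel (finCongr hk) (finCongr hl)) p := by
  subst hk hl
  exact ((grBimodule 𝕜).one_lact p).symm

theorem bilinExt_hcomp_assoc (𝕜 : Type u) [Field 𝕜] {k l k' l' k'' l'' : ℕ} 
    (p : GraphClass k l →₀ 𝕜) (p' : GraphClass k' l' →₀ 𝕜) (p'' : GraphClass k'' l'' →₀ 𝕜) :
    bilinExt 𝕜 GraphClass.hcomp p (bilinExt 𝕜 GraphClass.hcomp p' p'') =
      Finsupp.lmapDomain 𝕜 𝕜 (GraphClass.relabel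
        (finCongr (Nat.add_assoc k k' k'')) (finCongr (Nat.add_assoc l l' l''))) (bilinExt 𝕜 GraphClass.hcomp
        (bilinExt 𝕜 GraphClass.hcomp p p') p'') := by
  induction p using Finsupp.induction_linear with
  | zero => simp only [map_zero, LinearMap.zero_apply]
  | add p q hp hq => simp only [map_add, LinearMap.add_apply, hp, hq]
  | single a r =>
  induction p' using Finsupp.induction_linear with
  | zero => simp only [map_zero, LinearMap.zero_apply]
  | add p q hp hq => simp only [map_add, LinearMap.add_apply, hp, hq]
  | single b s =>
  induction p'' using Finsupp.induction_linear with
  | zero => simp only [map_zero]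
  | add p q hp hq => simp only [map_add, hp, hq]
  | single c t =>
    simp only [bilinExt_single, Finsupp.lmapDomain_apply, Finsupp.mapDomain_single,
      GraphClass.hcomp_assoc, mul_assoc]

theorem bilinExt_hcomp_unit0 (𝕜 : Type u) [Field 𝕜] {k l : ℕ} 
    (p : GraphClass k l →₀ 𝕜) :
    bilinExt 𝕜 GraphClass.hcomp p (Finsupp.single (GraphClass.mk (OGraph.idn 0)) 1) = p := by
  induction p using Finsupp.induction_linear with
  | zero => simp only [map_zero, LinearMap.zero_apply]
  | add p q hp hq => rw [map_add, LinearMap.add_apply]; exact congrArg₂ (· + ·) hp hq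
  | single a r =>
    rw [bilinExt_single, mul_one]
    exact congrArg (Finsupp.single · r) (GraphClass.hcomp_idn a)

theorem bilinExt_unit0_hcomp (𝕜 : Type u) [Field 𝕜] {k l : ℕ} 
    (p : GraphClass k l →₀ 𝕜) :
    Finsupp.lmapDomain 𝕜 𝕜 (GraphClass.relabel (finCongr (Nat.zero_add k)) (finCongr (Nat.zero_add l))) (bilinExt 𝕜 GraphClass.hcomp (Finsupp.single (GraphClass.mk (OGraph.idn 0)) 1) p) = p := by
  induction p using Finsupp.induction_linear with
  | zero => simp only [map_zero]
  | add p q hp hq => simp only [map_add, hp, hq]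
  | single a r =>
    simp only [bilinExt_single, Finsupp.lmapDomain_apply, Finsupp.mapDomain_single,
      GraphClass.idn_hcomp, one_mul]

theorem bilinExt_vcomp_assoc (𝕜 : Type u) [Field 𝕜] {k l m n : ℕ} 
    (p : GraphClass m n →₀ 𝕜) (q : GraphClass l m →₀ 𝕜) (r : GraphClass k l →₀ 𝕜) :
    bilinExt 𝕜 GraphClass.vcomp p (bilinExt 𝕜 GraphClass.vcomp q r) =
      bilinExt 𝕜 GraphClass.vcomp (bilinExt 𝕜 GraphClass.vcomp p q) r := by
  induction p using Finsupp.induction_linear with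
  | zero => simp only [map_zero, LinearMap.zero_apply]
  | add p q hp hq => simp only [map_add, LinearMap.add_apply, hp, hq]
  | single a r' =>
  induction q using Finsupp.induction_linear with
  | zero => simp only [map_zero, LinearMap.zero_apply]
  | add p q hp hq => simp only [map_add, LinearMap.add_apply, hp, hq]
  | single b s =>
  induction r using Finsupp.induction_linear with
  | zero => simp only [map_zero]
  | add p q hp hq => simp only [map_add, hp, hq]
  | single c t => simp only [bilinExt_single, GraphClass.vcomp_assoc, mul_assoc]

theorem bilinExt_vcomp_idn (𝕜 : Type u) [Field 𝕜] {k l : ℕ} 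
    (p : GraphClass k l →₀ 𝕜) :
    bilinExt 𝕜 GraphClass.vcomp p (Finsupp.single (GraphClass.mk (OGraph.idn k)) 1) = p := by
  induction p using Finsupp.induction_linear with
  | zero => simp only [map_zero, LinearMap.zero_apply]
  | add p q hp hq => simp only [map_add, LinearMap.add_apply, hp, hq]
  | single a r => simp only [bilinExt_single, GraphClass.vcomp_idn, mul_one]

theorem bilinExt_idn_vcomp (𝕜 : Type u) [Field 𝕜] {k l : ℕ} 
    (p : GraphClass k l →₀ 𝕜) :
    bilinExt 𝕜 GraphClass.vcomp (Finsupp.single (GraphClass.mk (OGraph.idn l)) 1) p = p := by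
  induction p using Finsupp.induction_linear with
  | zero => simp only [map_zero]
  | add p q hp hq => simp only [map_add, hp, hq]
  | single a r => simp only [bilinExt_single, GraphClass.idn_vcomp, one_mul]

theorem bilinExt_interchange (𝕜 : Type u) [Field 𝕜] {k l m k' l' m' : ℕ} 
    (p : GraphClass l m →₀ 𝕜) (p' : GraphClass l' m' →₀ 𝕜) (q : GraphClass k l →₀ 𝕜) (q' : GraphClass k' l' →₀ 𝕜) :
    bilinExt 𝕜 GraphClass.vcomp (bilinExt 𝕜 GraphClass.hcomp p p')
        (bilinExt 𝕜 GraphClass.hcomp q q') =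
      bilinExt 𝕜 GraphClass.hcomp (bilinExt 𝕜 GraphClass.vcomp p q)
        (bilinExt 𝕜 GraphClass.vcomp p' q') := by
  induction p using Finsupp.induction_linear with
  | zero => simp only [map_zero, LinearMap.zero_apply]
  | add p q hp hq => simp only [map_add, LinearMap.add_apply, hp, hq]
  | single a r =>
  induction p' using Finsupp.induction_linear with
  | zero => simp only [map_zero, LinearMap.zero_apply]
  | add p q hp hq => simp only [map_add, LinearMap.add_apply, hp, hq]
  | single b s =>
  induction q using Finsupp.induction_linear with
  | zero => simp only [map_zero, LinearMap.zero_apply]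
  | add p q hp hq => simp only [map_add, LinearMap.add_apply, hp, hq]
  | single c t =>
  induction q' using Finsupp.induction_linear with
  | zero => simp only [map_zero]
  | add p q hp hq => simp only [map_add, hp, hq]
  | single d z =>
    simp only [bilinExt_single, GraphClass.interchange, mul_mul_mul_comm]

theorem bilinExt_lact_vcomp (𝕜 : Type u) [Field 𝕜] {k l m : ℕ} (σ : Equiv.Perm (Fin m)) 
    (p : GraphClass l m →₀ 𝕜) (q : GraphClass k l →₀ 𝕜) :
    Finsupp.lmapDomain 𝕜 𝕜 (GraphClass.relabel (Equiv.refl _) σ)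
        (bilinExt 𝕜 GraphClass.vcomp p q) =
      bilinExt 𝕜 GraphClass.vcomp
        (Finsupp.lmapDomain 𝕜 𝕜 (GraphClass.relabel (Equiv.refl _) σ) p) q := by
  induction p using Finsupp.induction_linear with
  | zero => simp only [map_zero, LinearMap.zero_apply]
  | add p q hp hq => simp only [map_add, LinearMap.add_apply, hp, hq]
  | single a r =>
  induction q using Finsupp.induction_linear with
  | zero => simp only [map_zero]
  | add p q hp hq => simp only [map_add, hp, hq]
  | single b s =>
    simp only [bilinExt_single, Finsupp.lmapDomain_apply, Finsupp.mapDomain_single,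
      GraphClass.relabel_vcomp, GraphClass.relabel_refl]

theorem bilinExt_ract_vcomp (𝕜 : Type u) [Field 𝕜] {k l m : ℕ} (ν : Equiv.Perm (Fin k)) 
    (p : GraphClass l m →₀ 𝕜) (q : GraphClass k l →₀ 𝕜) :
    Finsupp.lmapDomain 𝕜 𝕜 (GraphClass.relabel ν⁻¹ (Equiv.refl _))
        (bilinExt 𝕜 GraphClass.vcomp p q) =
      bilinExt 𝕜 GraphClass.vcomp p
        (Finsupp.lmapDomain 𝕜 𝕜 (GraphClass.relabel ν⁻¹ (Equiv.refl _)) q) := by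
  induction p using Finsupp.induction_linear with
  | zero => simp only [map_zero, LinearMap.zero_apply]
  | add p q hp hq => simp only [map_add, LinearMap.add_apply, hp, hq]
  | single a r =>
  induction q using Finsupp.induction_linear with
  | zero => simp only [map_zero]
  | add p q hp hq => simp only [map_add, hp, hq]
  | single b s =>
    simp only [bilinExt_single, Finsupp.lmapDomain_apply, Finsupp.mapDomain_single,
      GraphClass.relabel_vcomp, GraphClass.relabel_refl]

theorem bilinExt_vcomp_middle (𝕜 : Type u) [Field 𝕜] {k l m : ℕ} (τ : Equiv.Perm (Fin l)) 
    (p : GraphClass l m →₀ 𝕜) (q : GraphClass k l →₀ 𝕜) :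
    bilinExt 𝕜 GraphClass.vcomp
        (Finsupp.lmapDomain 𝕜 𝕜 (GraphClass.relabel τ⁻¹ (Equiv.refl _)) p) q =
      bilinExt 𝕜 GraphClass.vcomp p
        (Finsupp.lmapDomain 𝕜 𝕜 (GraphClass.relabel (Equiv.refl _) τ) q) := by
  induction p using Finsupp.induction_linear with
  | zero => simp only [map_zero, LinearMap.zero_apply]
  | add p q hp hq => simp only [map_add, LinearMap.add_apply, hp, hq]
  | single a r =>
  induction q using Finsupp.induction_linear with
  | zero => simp only [map_zero]
  | add p q hp hq => simp only [map_add, hp, hq]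
  | single b s =>
    simp only [bilinExt_single, Finsupp.lmapDomain_apply, Finsupp.mapDomain_single,
      GraphClass.vcomp_middle]

theorem bilinExt_lact_hcomp (𝕜 : Type u) [Field 𝕜] {k l k' l' : ℕ} (σ : Equiv.Perm (Fin l)) (σ' : Equiv.Perm (Fin l')) 
    (p : GraphClass k l →₀ 𝕜) (p' : GraphClass k' l' →₀ 𝕜) :
    bilinExt 𝕜 GraphClass.hcomp
        (Finsupp.lmapDomain 𝕜 𝕜 (GraphClass.relabel (Equiv.refl _) σ) p)
        (Finsupp.lmapDomain 𝕜 𝕜 (GraphClass.relabel (Equiv.refl _) σ') p') =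
      Finsupp.lmapDomain 𝕜 𝕜 (GraphClass.relabel (Equiv.refl _) (permTensor σ σ'))
        (bilinExt 𝕜 GraphClass.hcomp p p') := by
  induction p using Finsupp.induction_linear with
  | zero => simp only [map_zero, LinearMap.zero_apply]
  | add p q hp hq => simp only [map_add, LinearMap.add_apply, hp, hq]
  | single a r =>
  induction p' using Finsupp.induction_linear with
  | zero => simp only [map_zero]
  | add p q hp hq => simp only [map_add, hp, hq]
  | single b s =>
    simp only [bilinExt_single, Finsupp.lmapDomain_apply, Finsupp.mapDomain_single,
      GraphClass.relabel_hcomp, permTensor_refl]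

theorem bilinExt_ract_hcomp (𝕜 : Type u) [Field 𝕜] {k l k' l' : ℕ} (τ : Equiv.Perm (Fin k)) (τ' : Equiv.Perm (Fin k')) 
    (p : GraphClass k l →₀ 𝕜) (p' : GraphClass k' l' →₀ 𝕜) :
    bilinExt 𝕜 GraphClass.hcomp
        (Finsupp.lmapDomain 𝕜 𝕜 (GraphClass.relabel τ⁻¹ (Equiv.refl _)) p)
        (Finsupp.lmapDomain 𝕜 𝕜 (GraphClass.relabel τ'⁻¹ (Equiv.refl _)) p') =
      Finsupp.lmapDomain 𝕜 𝕜 (GraphClass.relabel (permTensor τ τ')⁻¹ (Equiv.refl _))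
        (bilinExt 𝕜 GraphClass.hcomp p p') := by
  induction p using Finsupp.induction_linear with
  | zero => simp only [map_zero, LinearMap.zero_apply]
  | add p q hp hq => simp only [map_add, LinearMap.add_apply, hp, hq]
  | single a r =>
  induction p' using Finsupp.induction_linear with
  | zero => simp only [map_zero]
  | add p q hp hq => simp only [map_add, hp, hq]
  | single b s =>
    simp only [bilinExt_single, Finsupp.lmapDomain_apply, Finsupp.mapDomain_single,
      GraphClass.relabel_hcomp, permTensor_refl, permTensor_inv]

theorem bilinExt_hcomp_comm (𝕜 : Type u) [Field 𝕜] {k l k' l' : ℕ} 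
    (p : GraphClass k l →₀ 𝕜) (p' : GraphClass k' l' →₀ 𝕜) :
    Finsupp.lmapDomain 𝕜 𝕜 (GraphClass.relabel (Equiv.refl _) (blockSwap l l'))
        (bilinExt 𝕜 GraphClass.hcomp p p') =
      Finsupp.lmapDomain 𝕜 𝕜 (GraphClass.relabel (blockSwap k k')⁻¹ (Equiv.refl _))
        (Finsupp.lmapDomain 𝕜 𝕜 (GraphClass.relabel
          (finCongr (Nat.add_comm k' k)) (finCongr (Nat.add_comm l' l))) (bilinExt 𝕜 GraphClass.hcomp p' p)) := by
  induction p using Finsupp.induction_linear with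
  | zero => simp only [map_zero, LinearMap.zero_apply]
  | add p q hp hq => simp only [map_add, LinearMap.add_apply, hp, hq]
  | single a r =>
  induction p' using Finsupp.induction_linear with
  | zero => simp only [map_zero, LinearMap.zero_apply]
  | add p q hp hq => simp only [map_add, LinearMap.add_apply, hp, hq]
  | single b s =>
    simp only [bilinExt_single, Finsupp.lmapDomain_apply, Finsupp.mapDomain_single,
      ← GraphClass.hcomp_comm, GraphClass.relabel_relabel, mul_comm r s]
    congr 2
    ext; simp

/-- The ProP of graphs. -/
noncomputable def gr (𝕜 : Type u) [Field 𝕜] : ProP.{u, max 1 u} 𝕜 where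
  toProPData := grData 𝕜
  hcomp_assoc p p' p'' := (bilinExt_hcomp_assoc 𝕜 p p' p'').trans (grBimodule_castTo 𝕜 _ _ _).symm
  hcomp_unit0 p := bilinExt_hcomp_unit0 𝕜 p
  unit0_hcomp p := (grBimodule_castTo 𝕜 _ _ _).trans (bilinExt_unit0_hcomp 𝕜 p)
  vcomp_assoc p q r := bilinExt_vcomp_assoc 𝕜 p q r
  vcomp_idn p := by
    rw [grData_idn]
    exact bilinExt_vcomp_idn 𝕜 p
  idn_vcomp p := by
    rw [grData_idn]
    exact bilinExt_idn_vcomp 𝕜 p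
  interchange p p' q q' := bilinExt_interchange 𝕜 p p' q q'
  lact_vcomp σ p q := bilinExt_lact_vcomp 𝕜 σ p q
  ract_vcomp ν p q := bilinExt_ract_vcomp 𝕜 ν p q
  vcomp_middle τ p q := bilinExt_vcomp_middle 𝕜 τ p q
  lact_hcomp σ σ' p p' := bilinExt_lact_hcomp 𝕜 σ σ' p p'
  ract_hcomp τ τ' p p' := bilinExt_ract_hcomp 𝕜 τ τ' p p'
  hcomp_comm p p' := (bilinExt_hcomp_comm 𝕜 p p').trans (congrArg _ (grBimodule_castTo 𝕜 _ _ _).symm)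

/-- The subspace of `Gr(k, l)` spanned by the isomorphism classes of indecomposable graphs. -/
noncomputable def grIndSubmodule (𝕜 : Type u) [Field 𝕜] (k l : ℕ) :
    Submodule 𝕜 ((gr 𝕜).carrier k l) :=
  Submodule.span 𝕜
    {x | ∃ G : OGraph k l, G.IsIndecomposable ∧ x = Finsupp.single (GraphClass.mk G) (1 : 𝕜)}

theorem grIndSubmodule_le_comap_lact (𝕜 : Type u) [Field 𝕜] {k l : ℕ} (σ : Equiv.Perm (Fin l)) :
    grIndSubmodule 𝕜 k l ≤ (grIndSubmodule 𝕜 k l).comap ((gr 𝕜).lact σ) := by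
  refine Submodule.span_le.2 ?_
  rintro _ ⟨G, hG, rfl⟩
  exact Submodule.subset_span ⟨_, hG.relabel (Equiv.refl _) σ, Finsupp.mapDomain_single⟩

theorem grIndSubmodule_le_comap_ract (𝕜 : Type u) [Field 𝕜] {k l : ℕ} (τ : Equiv.Perm (Fin k)) :
    grIndSubmodule 𝕜 k l ≤ (grIndSubmodule 𝕜 k l).comap ((gr 𝕜).ract τ) := by
  refine Submodule.span_le.2 ?_
  rintro _ ⟨G, hG, rfl⟩
  exact Submodule.subset_span ⟨_, hG.relabel τ⁻¹ (Equiv.refl _), Finsupp.mapDomain_single⟩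

/-- The `𝔖 × 𝔖ᵒᵖ`-module of indecomposable graphs. -/
noncomputable def grInd (𝕜 : Type u) [Field 𝕜] : SBimodule.{u, max 1 u} 𝕜 where
  carrier k l := grIndSubmodule 𝕜 k l
  lact σ := ((gr 𝕜).lact σ).restrict (grIndSubmodule_le_comap_lact 𝕜 σ)
  ract τ := ((gr 𝕜).ract τ).restrict (grIndSubmodule_le_comap_ract 𝕜 τ)
  one_lact p := Subtype.ext ((gr 𝕜).one_lact p.1)
  one_ract p := Subtype.ext ((gr 𝕜).one_ract p.1)
  lact_lact σ σ' p := Subtype.ext ((gr 𝕜).lact_lact σ σ' p.1)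
  lact_ract σ τ p := Subtype.ext ((gr 𝕜).lact_ract σ τ p.1)
  ract_ract τ τ' p := Subtype.ext ((gr 𝕜).ract_ract τ τ' p.1)

/-- The inclusion of the module of indecomposable graphs into the module of graphs. -/
noncomputable def grIndIncl (𝕜 : Type u) [Field 𝕜] :
    SBimodule.Hom (grInd 𝕜) (gr 𝕜).toSBimodule where
  toFun {k l} := (grIndSubmodule 𝕜 k l).subtype
  map_lact _ _ := rfl
  map_ract _ _ := rfl

/-! ## ProPs with inputs and outputs indexed by finite types -/

/-! Cut a graph into its strongly connected components, each loop without endpoints counting as a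
component of its own. Edges between different components form no cycle, so some component has no
predecessor, and it can be detached at the inputs: up to renumbering, `G = H ∘ (C * I_r)`, where the
identity edges carry the inputs that bypass `C`. The indecomposable graphs are precisely the single
loop and the strongly connected graphs with a vertex and with neither input-output edges nor loops.
Indeed, a proper nonempty set of vertices closed under predecessors gives a vertical factorisation
with vertices on both sides. Conversely, the vertices of the inner factor of a vertical composite,
or of one factor of a horizontal one, form such a set (`isIndecomposable_of_indec`,
`IsIndecomposable.indec`).

Uniqueness of `Φ`: peeling off components, by induction on the number of vertices and loops,
expresses every graph through indecomposable ones, identities and renumberings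
(`ProP.Hom.basis_eq_of_indecomposable`).

Existence: the value of a graph in `P` is obtained by peeling in the same way and composing the
images of the components. The point is independence of the order. Two initial components coincide or
are disjoint. If disjoint, each can still be peeled after the other, with the same remainder
(`Wiring.Iso.exists_exchange`), and in `P` the two orders agree by the interchange law
(`ProP.At.st_swap`). By induction the value is well defined (`Wiring.Val.unique`). It respects
vertical composition and padding by identities (`Val.vcomp`, `Val.addId`), hence horizontal
composition, since `G * H = (G * I) ∘ (I * H)` (`value_hcomp`). On an indecomposable graph the
peeling takes one step and returns `φ` (`value_weight`).

Two changes of language keep the bookkeeping manageable. Inputs and outputs are indexed by arbitrary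
finite types (`ProP.At`), so that cutting a graph needs no renumbering. Graphs become wirings: every
input or half-edge has a single target, an output or a vertex, so that the different kinds of edges
need not be distinguished, and loops become isolated vertices of a second colour. -/

/-- The sum of two bijections between initial segments. -/
def finSumCongr {m n m' n' : ℕ} (a : Fin m ≃ Fin m') (b : Fin n ≃ Fin n') :
    Fin (m + n) ≃ Fin (m' + n') :=
  finSumFinEquiv.symm.trans ((Equiv.sumCongr a b).trans finSumFinEquiv)

namespace ProP

variable {𝕜 : Type u} [Field 𝕜] (P : ProP.{u, v} 𝕜)

theorem eq_of_finEquiv {m n : ℕ} (a : Fin m ≃ Fin n) : m = n := by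
  simpa using Fintype.card_congr a

/-- Renumbering of the inputs and of the outputs along bijections. -/
def tr {k l k' l' : ℕ} (a : Fin k ≃ Fin k') (b : Fin l ≃ Fin l') (p : P.carrier k l) :
    P.carrier k' l' :=
  P.lact ((finCongr (eq_of_finEquiv b)).symm.trans b)
    -- The inverse makes the renumbering of inputs covariant, in agreement with `OGraph.relabel`.
    (P.ract ((finCongr (eq_of_finEquiv a)).symm.trans a)⁻¹
      (P.castTo (eq_of_finEquiv a) (eq_of_finEquiv b) p))

theorem tr_perm {k l : ℕ} (a : Equiv.Perm (Fin k)) (b : Equiv.Perm (Fin l)) (p : P.carrier k l) :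
    P.tr a b p = P.lact b (P.ract a⁻¹ p) := rfl

theorem tr_refl {k l : ℕ} (p : P.carrier k l) : P.tr (Equiv.refl _) (Equiv.refl _) p = p := by
  rw [tr_perm]
  exact (P.one_lact _).trans (P.one_ract p)

theorem castTo_eq_tr {k l k' l' : ℕ} (hk : k = k') (hl : l = l') (p : P.carrier k l) :
    P.castTo hk hl p = P.tr (finCongr hk) (finCongr hl) p := by
  subst hk hl
  exact (P.tr_refl p).symm

/-- A bijection between `Fin k` and `Fin k'` forces `k = k'`. After substitution it is a
permutation, the cast disappears and the claim becomes a law of the two actions. The other `tr`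
lemmas use the same reduction. -/
theorem tr_tr {k l k' l' k'' l'' : ℕ} (a : Fin k ≃ Fin k') (b : Fin l ≃ Fin l')
    (a' : Fin k' ≃ Fin k'') (b' : Fin l' ≃ Fin l'') (p : P.carrier k l) :
    P.tr a' b' (P.tr a b p) = P.tr (a.trans a') (b.trans b') p := by
  obtain rfl := eq_of_finEquiv a
  obtain rfl := eq_of_finEquiv a'
  obtain rfl := eq_of_finEquiv b
  obtain rfl := eq_of_finEquiv b'
  simp only [tr_perm]
  rw [← P.lact_ract, P.lact_lact, P.ract_ract]
  rfl

theorem tr_hcomp {k l k' l' m n m' n' : ℕ} (a : Fin k ≃ Fin k') (b : Fin l ≃ Fin l')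
    (a' : Fin m ≃ Fin m') (b' : Fin n ≃ Fin n') (p : P.carrier k l) (p' : P.carrier m n) :
    P.hcomp (P.tr a b p) (P.tr a' b' p') =
      P.tr (finSumCongr a a') (finSumCongr b b') (P.hcomp p p') := by
  obtain rfl := eq_of_finEquiv a
  obtain rfl := eq_of_finEquiv a'
  obtain rfl := eq_of_finEquiv b
  obtain rfl := eq_of_finEquiv b'
  simp only [tr_perm]
  rw [P.lact_hcomp, P.ract_hcomp]
  rfl

/-- The middle renumbering acts on the inputs of `p` by the inverse of its action on the outputs of
`q`, so the two cancel through `vcomp_middle`. -/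
theorem tr_vcomp {k l m k' l' m' : ℕ} (a : Fin k ≃ Fin k') (b : Fin l ≃ Fin l')
    (c : Fin m ≃ Fin m') (p : P.carrier l m) (q : P.carrier k l) :
    P.vcomp (P.tr b c p) (P.tr a b q) = P.tr a c (P.vcomp p q) := by
  obtain rfl := eq_of_finEquiv a
  obtain rfl := eq_of_finEquiv b
  obtain rfl := eq_of_finEquiv c
  simp only [tr_perm]
  rw [← P.lact_vcomp, P.vcomp_middle, P.lact_lact, inv_mul_cancel, P.one_lact, P.ract_vcomp]

theorem hcomp_assoc_tr {k l k' l' k'' l'' : ℕ}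
    (p : P.carrier k l) (p' : P.carrier k' l') (p'' : P.carrier k'' l'') :
    P.tr (finCongr (Nat.add_assoc k k' k'')) (finCongr (Nat.add_assoc l l' l''))
      (P.hcomp (P.hcomp p p') p'') = P.hcomp p (P.hcomp p' p'') := by
  rw [P.hcomp_assoc, castTo_eq_tr]

theorem hcomp_comm_tr {k l k' l' : ℕ} (p : P.carrier k l) (p' : P.carrier k' l') :
    P.tr finAddFlip finAddFlip (P.hcomp p p') = P.hcomp p' p := by
  have h := congrArg (P.ract (blockSwap k k')⁻¹) (P.hcomp_comm p p')
  rw [P.ract_ract, mul_inv_cancel, P.one_ract, ← P.lact_ract, ← tr_perm, castTo_eq_tr] at h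
  have h' := congrArg (P.tr (finCongr (Nat.add_comm k k')) (finCongr (Nat.add_comm l l'))) h
  rw [tr_tr, tr_tr] at h'
  refine .trans ?_ (h'.trans (P.tr_refl _))
  rfl

/-- Taking both factors of `vcomp_middle` to be the identity shows that a permutation acts in the
same way on either side of `I_k`. Conjugation is therefore trivial. -/
theorem tr_idn {k k' : ℕ} (a : Fin k ≃ Fin k') : P.tr a a (P.idn k) = P.idn k' := by
  obtain rfl := eq_of_finEquiv a
  have h := P.tr_vcomp (Equiv.refl _) (Equiv.refl _) a (P.idn k) (P.idn k)
  have h1 : P.tr (Equiv.refl _) a (P.idn k) = P.tr a.symm (Equiv.refl _) (P.idn k) := by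
    have h2 := P.vcomp_middle a (P.idn k) (P.idn k)
    rw [P.vcomp_idn, P.idn_vcomp] at h2
    rw [tr_perm, tr_perm]
    refine (congrArg _ (P.one_ract _)).trans (h2.symm.trans (P.one_lact _).symm)
  have h3 := congrArg (P.tr a (Equiv.refl _)) h1
  rw [tr_tr, tr_tr] at h3
  refine .trans ?_ (h3.trans ?_)
  · rfl
  · rw [Equiv.symm_trans_self]
    exact P.tr_refl _

theorem idn_hcomp_idn (m n : ℕ) : P.hcomp (P.idn m) (P.idn n) = P.idn (m + n) := by
  induction n with
  | zero => exact P.hcomp_unit0 _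
  | succ n ih => exact (P.hcomp_assoc _ _ _).trans (by rw [ih]; rfl)

/-- The component of a ProP with inputs and outputs indexed by finite types. -/
abbrev At (X Y : Type) : Type v := P.carrier (Nat.card X) (Nat.card Y)

variable {P}
variable {X Y Z X' Y' Z' X'' Y'' A B R A' B' R' : Type} [Finite X] [Finite Y] [Finite Z]
  [Finite X'] [Finite Y'] [Finite Z'] [Finite X''] [Finite Y''] [Finite A] [Finite B] [Finite R]
  [Finite A'] [Finite B'] [Finite R']

/-- The bijection of initial segments induced by a bijection of finite types. -/
noncomputable def enum (a : X ≃ X') : Fin (Nat.card X) ≃ Fin (Nat.card X') :=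
  (Finite.equivFin X).symm.trans (a.trans (Finite.equivFin X'))

/-- The enumeration of a sum of finite types. -/
noncomputable def enumSum (X X' : Type) [Finite X] [Finite X'] :
    Fin (Nat.card X + Nat.card X') ≃ Fin (Nat.card (X ⊕ X')) :=
  finSumFinEquiv.symm.trans
    ((Equiv.sumCongr (Finite.equivFin X).symm (Finite.equivFin X').symm).trans
      (Finite.equivFin (X ⊕ X')))

namespace At

/-- Relabelling of the inputs and of the outputs. -/
noncomputable def rl (a : X ≃ X') (b : Y ≃ Y') (p : P.At X Y) : P.At X' Y' :=
  P.tr (enum a) (enum b) p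

/-- Horizontal composition. -/
noncomputable def hc (p : P.At X Y) (p' : P.At X' Y') : P.At (X ⊕ X') (Y ⊕ Y') :=
  P.tr (enumSum X X') (enumSum Y Y') (P.hcomp p p')

/-- Vertical composition. -/
noncomputable def vc (p : P.At Y Z) (q : P.At X Y) : P.At X Z := P.vcomp p q

/-- The identity. -/
noncomputable def one (P : ProP.{u, v} 𝕜) (X : Type) : P.At X X := P.idn (Nat.card X)

theorem rl_refl (p : P.At X Y) : rl (.refl _) (.refl _) p = p := by
  refine .trans ?_ (P.tr_refl p)
  rw [rl]
  congr 1 <;> exact Equiv.ext fun i => by simp [enum]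

theorem rl_rl (a : X ≃ X') (b : Y ≃ Y') (a' : X' ≃ X'') (b' : Y' ≃ Y'') (p : P.At X Y) :
    rl a' b' (rl a b p) = rl (a.trans a') (b.trans b') p := by
  rw [rl, rl, tr_tr, rl]
  congr 1 <;> ext <;> simp [enum]

theorem rl_injective (a : X ≃ X') (b : Y ≃ Y') :
    Function.Injective (rl a b : P.At X Y → P.At X' Y') := by
  intro p q h
  have := congrArg (rl a.symm b.symm) h
  simpa [rl_rl, rl_refl] using this

theorem rl_symm_apply (a : X ≃ X') (b : Y ≃ Y') (p : P.At X Y) :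
    rl a.symm b.symm (rl a b p) = p := by
  simp [rl_rl, rl_refl]

theorem vc_rl (a : X ≃ X') (b : Y ≃ Y') (c : Z ≃ Z') (p : P.At Y Z) (q : P.At X Y) :
    vc (rl b c p) (rl a b q) = rl a c (vc p q) :=
  P.tr_vcomp _ _ _ _ _

omit [Finite X] [Finite Y] [Finite Z] in
theorem vc_assoc {W : Type} (p : P.At Z W) (q : P.At Y Z) (r : P.At X Y) :
    vc p (vc q r) = vc (vc p q) r :=
  P.vcomp_assoc _ _ _

omit [Finite X] [Finite Y] in
theorem vc_one (p : P.At X Y) : vc p (one P X) = p := P.vcomp_idn _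

omit [Finite X] [Finite Y] in
theorem one_vc (p : P.At X Y) : vc (one P Y) p = p := P.idn_vcomp _

theorem rl_one (a : X ≃ X') : rl a a (one P X) = one P X' := P.tr_idn _

theorem hc_rl (a : X ≃ A) (b : Y ≃ B) (a' : X' ≃ A') (b' : Y' ≃ B') (p : P.At X Y)
    (p' : P.At X' Y') :
    hc (rl a b p) (rl a' b' p') = rl (.sumCongr a a') (.sumCongr b b') (hc p p') := by
  rw [rl, rl, hc, tr_hcomp, tr_tr, rl, hc, tr_tr]
  congr 1 <;> ext i <;> obtain ⟨i | i, rfl⟩ := finSumFinEquiv.surjective i <;>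
    simp [enum, enumSum, finSumCongr, -finSumFinEquiv_apply_left, -finSumFinEquiv_apply_right]

theorem hc_one : hc (one P X) (one P Y) = one P (X ⊕ Y) := by
  rw [hc, one, one, idn_hcomp_idn, tr_idn, one]

/-- The enumeration of `Y ⊕ Y'` is used by both vertical factors and cancels, which leaves the
interchange law of `P`. -/
theorem hc_vc (p : P.At Y Z) (q : P.At X Y) (p' : P.At Y' Z') (q' : P.At X' Y') :
    vc (hc p p') (hc q q') = hc (vc p q) (vc p' q') := by
  rw [hc, hc, vc, tr_vcomp, P.interchange]
  rfl

theorem hc_comm (p : P.At X Y) (p' : P.At X' Y') :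
    rl (.sumComm _ _) (.sumComm _ _) (hc p p') = hc p' p := by
  rw [rl, hc, hc, ← P.hcomp_comm_tr p p', tr_tr, tr_tr]
  congr 1 <;> ext i <;> obtain ⟨i | i, rfl⟩ := finSumFinEquiv.surjective i <;>
    simp [enum, enumSum, finAddFlip, -finSumFinEquiv_apply_left, -finSumFinEquiv_apply_right]

theorem hc_assoc (p : P.At X Y) (p' : P.At X' Y') (p'' : P.At A B) :
    rl (.sumAssoc _ _ _) (.sumAssoc _ _ _) (hc (hc p p') p'') = hc p (hc p' p'') := by
  -- The two bracketings enumerate a triple sum in the same way up to reassociation. It suffices to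
  -- compare them on each of the three summands.
  have h1 : ∀ X X' A : Type, ∀ [Finite X] [Finite X'] [Finite A],
      ((finSumCongr (enumSum X X') (.refl _)).trans (enumSum (X ⊕ X') A)).trans
        (enum (Equiv.sumAssoc X X' A)) =
      (finCongr (Nat.add_assoc _ _ _)).trans
        ((finSumCongr (.refl _) (enumSum X' A)).trans (enumSum X (X' ⊕ A))) := by
    intro X X' A _ _ _
    ext i
    obtain ⟨i | i, rfl⟩ := finSumFinEquiv.surjective i
    · obtain ⟨i | i, rfl⟩ := finSumFinEquiv.surjective i
      · have : (finCongr (Nat.add_assoc _ _ _)) (finSumFinEquiv (.inl (finSumFinEquiv (.inl i)))) =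
          finSumFinEquiv (m := Nat.card X) (n := Nat.card X' + Nat.card A) (.inl i) := by
          ext; simp
        simp only [Equiv.trans_apply, this]
        simp [enum, enumSum, finSumCongr, -finSumFinEquiv_apply_left, -finSumFinEquiv_apply_right]
      · have : (finCongr (Nat.add_assoc _ _ _)) (finSumFinEquiv (.inl (finSumFinEquiv (.inr i)))) =
          finSumFinEquiv (m := Nat.card X) (n := Nat.card X' + Nat.card A)
            (.inr (finSumFinEquiv (.inl i))) := by
          ext; simp
        simp only [Equiv.trans_apply, this]
        simp [enum, enumSum, finSumCongr, -finSumFinEquiv_apply_left, -finSumFinEquiv_apply_right]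
    · have : (finCongr (Nat.add_assoc _ _ _)) (finSumFinEquiv (.inr i)) =
          finSumFinEquiv (m := Nat.card X) (n := Nat.card X' + Nat.card A)
            (.inr (finSumFinEquiv (.inr i))) := by
        ext; simp [Nat.add_assoc]
      simp only [Equiv.trans_apply, this]
      simp [enum, enumSum, finSumCongr, -finSumFinEquiv_apply_left, -finSumFinEquiv_apply_right]
  have e1 : hc (hc p p') p'' = P.tr ((finSumCongr (enumSum X X') (.refl _)).trans (enumSum _ _))
      ((finSumCongr (enumSum Y Y') (.refl _)).trans (enumSum _ _))
      (P.hcomp (P.hcomp p p') p'') := by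
    have := P.tr_hcomp (enumSum X X') (enumSum Y Y') (.refl _) (.refl _) (P.hcomp p p') p''
    rw [tr_refl] at this
    rw [hc, hc, this, tr_tr]
  have e2 : hc p (hc p' p'') = P.tr ((finSumCongr (.refl _) (enumSum X' A)).trans (enumSum _ _))
      ((finSumCongr (.refl _) (enumSum Y' B)).trans (enumSum _ _))
      (P.hcomp p (P.hcomp p' p'')) := by
    have := P.tr_hcomp (.refl _) (.refl _) (enumSum X' A) (enumSum Y' B) p (P.hcomp p' p'')
    rw [tr_refl] at this
    rw [hc, hc, this, tr_tr]
  rw [e1, e2, rl, tr_tr, ← hcomp_assoc_tr, tr_tr, h1, h1]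

/-! ### Composition along a part of the inputs. -/

/-- Composition of `q` with `p` along a part of the inputs of `q`. -/
noncomputable def st (q : P.At (B ⊕ R) Y) (p : P.At A B) : P.At (A ⊕ R) Y :=
  vc q (hc p (one P R))

theorem st_rl (a : A ≃ A') (b : B ≃ B') (r : R ≃ R') (y : Y ≃ Y') (q : P.At (B ⊕ R) Y)
    (p : P.At A B) :
    st (rl (.sumCongr b r) y q) (rl a b p) = rl (.sumCongr a r) y (st q p) := by
  rw [st, st, ← rl_one r, hc_rl, vc_rl]

omit [Finite Y] [Finite Z] in
theorem vc_st (q' : P.At Y Z) (q : P.At (B ⊕ R) Y) (p : P.At A B) :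
    vc q' (st q p) = st (vc q' q) p :=
  vc_assoc _ _ _

/-- Interchange moves the extra identity inside as `(q * 1) ∘ ((p * 1) * 1)`, where the two
identities merge into one. This is the counterpart in `P` of `Wiring.isoAddIdComp`. -/
theorem st_hc_one (q : P.At (B ⊕ R) Y) (p : P.At A B) :
    hc (st q p) (one P Z) = rl (Equiv.sumAssoc _ _ _).symm (.refl _)
      (st (rl (.sumAssoc _ _ _) (.refl _) (hc q (one P Z))) p) := by
  have h : hc (st q p) (one P Z) = vc (hc q (one P Z)) (hc (hc p (one P R)) (one P Z)) := by
    rw [hc_vc, vc_one, st]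
  rw [h, st, ← hc_one, ← hc_assoc, vc_rl, rl_rl]
  simp [rl_refl]

/-- The bijection which exchanges the first two summands. -/
def _root_.sumLeftComm (A B R : Type) : A ⊕ (B ⊕ R) ≃ B ⊕ (A ⊕ R) :=
  (Equiv.sumAssoc A B R).symm.trans
    ((Equiv.sumCongr (.sumComm A B) (.refl R)).trans (Equiv.sumAssoc B A R))

theorem hc_left_comm (p : P.At A B) (p' : P.At A' B') (r : P.At X Y) :
    rl (sumLeftComm _ _ _) (sumLeftComm _ _ _) (hc p (hc p' r)) = hc p' (hc p r) := by
  rw [← hc_assoc, rl_rl, ← hc_assoc, ← hc_comm p p']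
  have h := hc_rl (.sumComm A A') (.sumComm B B') (.refl _) (.refl _) (hc p p') r
  rw [rl_refl] at h
  rw [h, rl_rl]
  congr 1 <;> ext ((x | x) | x) <;> rfl

/-- Since `p` and `p'` act on disjoint blocks, interchange and commutativity bring both orders to `q
∘ (p * (p' * 1))`. This is the identity in `P` that makes the value of a graph independent of the
order of peeling. -/
theorem st_swap (q : P.At (B ⊕ (B' ⊕ R)) Y) (p : P.At A B) (p' : P.At A' B') :
    rl (sumLeftComm _ _ _) (.refl _)
      (st (rl (sumLeftComm _ _ _) (.refl _) (st q p)) p') =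
    st (rl (sumLeftComm _ _ _) (.refl _)
      (st (rl (sumLeftComm _ _ _) (.refl _) q) p')) p := by
  have key : ∀ {A B A' B' : Type} [Finite A] [Finite B] [Finite A'] [Finite B']
      (q : P.At (B ⊕ (B' ⊕ R)) Y) (p : P.At A B) (p' : P.At A' B'),
      st (rl (sumLeftComm _ _ _) (.refl _) (st q p)) p' =
        rl (sumLeftComm _ _ _) (.refl _) (vc q (hc p (hc p' (one P R)))) := by
    intro A B A' B' _ _ _ _ q p p'
    rw [st, st, ← hc_one, ← vc_rl _ (sumLeftComm _ _ _), hc_left_comm, ← vc_rl _ (sumLeftComm _ _ _),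
      hc_left_comm, ← vc_assoc, hc_vc, one_vc, vc_one]
  have e : ∀ A B : Type, (sumLeftComm A B R).trans (sumLeftComm B A R) = .refl _ := by
    intro A B
    ext (x | x | x) <;> rfl
  have h := key (rl (sumLeftComm _ _ _) (.refl _) q) p' p
  rw [← vc_rl _ (sumLeftComm _ _ _), hc_left_comm, rl_rl, e] at h
  rw [key, rl_rl, e, h]
  simp [rl_refl]

end At
end ProP

/-! ## Wirings -/

/-- A wiring with inputs `X` and outputs `Y`: coloured vertices `V`, half-edges `H` leaving the
vertices, and a target map from inputs and half-edges to outputs and vertices such that every output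
is reached exactly once. -/
structure Wiring (X Y : Type) where
  V : Type
  H : Type
  [finite_V : Finite V]
  [finite_H : Finite H]
  col : V → Bool
  src : H → V
  tgt : X ⊕ H → Y ⊕ V
  existsUnique_tgt : ∀ y, ∃! s, tgt s = .inl y

namespace Wiring

attribute [instance] finite_V finite_H

variable {X Y Z X' Y' Z' X'' Y'' A B R A' B' R' : Type}

/-- Isomorphisms of wirings over bijections of the inputs and of the outputs. -/
structure Iso (a : X ≃ X') (b : Y ≃ Y') (G : Wiring X Y) (G' : Wiring X' Y') where
  fV : G.V ≃ G'.V
  fH : G.H ≃ G'.H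
  col_eq : ∀ v, G'.col (fV v) = G.col v
  src_eq : ∀ o, G'.src (fH o) = fV (G.src o)
  tgt_inl : ∀ x, G'.tgt (.inl (a x)) = Sum.map b fV (G.tgt (.inl x))
  tgt_inr : ∀ o, G'.tgt (.inr (fH o)) = Sum.map b fV (G.tgt (.inr o))

namespace Iso

variable {a : X ≃ X'} {b : Y ≃ Y'} {a' : X' ≃ X''} {b' : Y' ≃ Y''}
  {G : Wiring X Y} {G' : Wiring X' Y'} {G'' : Wiring X'' Y''}

/-- An isomorphism given by bijections together with formulas for the underlying maps. -/
def ofFun (fV : G.V ≃ G'.V) (fH : G.H ≃ G'.H) (gV : G.V → G'.V) (gH : G.H → G'.H)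
    (hV : ∀ v, fV v = gV v) (hH : ∀ o, fH o = gH o)
    (hcol : ∀ v, G'.col (gV v) = G.col v) (hsrc : ∀ o, G'.src (gH o) = gV (G.src o))
    (hinl : ∀ x, G'.tgt (.inl (a x)) = Sum.map b gV (G.tgt (.inl x)))
    (hinr : ∀ o, G'.tgt (.inr (gH o)) = Sum.map b gV (G.tgt (.inr o))) : Iso a b G G' where
  fV := fV
  fH := fH
  col_eq v := by rw [hV, hcol]
  src_eq o := by rw [hV, hH, hsrc]
  tgt_inl x := by rw [hinl, funext hV]
  tgt_inr o := by rw [hH, hinr, funext hV]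

/-- The identity isomorphism. -/
def refl (G : Wiring X Y) : Iso (.refl _) (.refl _) G G where
  fV := .refl _
  fH := .refl _
  col_eq _ := rfl
  src_eq _ := rfl
  tgt_inl x := by simp
  tgt_inr x := by simp

/-- An isomorphism regarded over equal bijections of the inputs and of the outputs. -/
def cast {a₁ : X ≃ X'} {b₁ : Y ≃ Y'} (f : Iso a b G G') (ha : a = a₁) (hb : b = b₁) :
    Iso a₁ b₁ G G' where
  fV := f.fV
  fH := f.fH
  col_eq := f.col_eq
  src_eq := f.src_eq
  tgt_inl := by subst ha hb; exact f.tgt_inl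
  tgt_inr := by subst ha hb; exact f.tgt_inr

/-- The inverse isomorphism. -/
def symm (f : Iso a b G G') : Iso a.symm b.symm G' G where
  fV := f.fV.symm
  fH := f.fH.symm
  col_eq v := by simp [← f.col_eq]
  src_eq o := by simp [Equiv.eq_symm_apply, ← f.src_eq]
  tgt_inl x := by
    obtain ⟨x, rfl⟩ := a.surjective x
    rw [f.tgt_inl]
    simp [Sum.map_map]
  tgt_inr x := by
    obtain ⟨x, rfl⟩ := f.fH.surjective x
    rw [f.tgt_inr]
    simp [Sum.map_map]

/-- The composite isomorphism. -/
def trans (f : Iso a b G G') (g : Iso a' b' G' G'') : Iso (a.trans a') (b.trans b') G G'' where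
  fV := f.fV.trans g.fV
  fH := f.fH.trans g.fH
  col_eq v := by simp [g.col_eq, f.col_eq]
  src_eq o := by simp [g.src_eq, f.src_eq]
  tgt_inl x := by simp [g.tgt_inl, f.tgt_inl, Sum.map_map]
  tgt_inr x := by simp [g.tgt_inr, f.tgt_inr, Sum.map_map]

end Iso

/-- Relabelling of the inputs and of the outputs. -/
abbrev relabel (a : X ≃ X') (b : Y ≃ Y') (G : Wiring X Y) : Wiring X' Y' where
  V := G.V
  H := G.H
  col := G.col
  src := G.src
  tgt s := Sum.map b id (G.tgt (Sum.map a.symm id s))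
  existsUnique_tgt y := by
    obtain ⟨s, hs, hs'⟩ := G.existsUnique_tgt (b.symm y)
    refine ⟨Sum.map a id s, by simp [Sum.map_map, hs], fun s' h => ?_⟩
    rw [← hs' (Sum.map a.symm id s')]
    · simp [Sum.map_map]
    · rcases h' : G.tgt (Sum.map a.symm id s') with y' | v <;> simp [h'] at h ⊢
      simp [← h]

/-- The canonical isomorphism to a relabelling. -/
def isoRelabel (a : X ≃ X') (b : Y ≃ Y') (G : Wiring X Y) : Iso a b G (G.relabel a b) where
  fV := .refl _
  fH := .refl _
  col_eq _ := rfl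
  src_eq _ := rfl
  tgt_inl x := by simp [relabel]
  tgt_inr x := by simp [relabel]

/-- Vertical composition. -/
abbrev vcomp (H : Wiring Y Z) (K : Wiring X Y) : Wiring X Z where
  V := K.V ⊕ H.V
  H := K.H ⊕ H.H
  col := Sum.elim K.col H.col
  src := Sum.map K.src H.src
  tgt
    | .inl x => Sum.elim (fun y => Sum.map id .inr (H.tgt (.inl y))) (fun v => .inr (.inl v))
        (K.tgt (.inl x))
    | .inr (.inl o) => Sum.elim (fun y => Sum.map id .inr (H.tgt (.inl y)))
        (fun v => .inr (.inl v)) (K.tgt (.inr o))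
    | .inr (.inr o) => Sum.map id .inr (H.tgt (.inr o))
  existsUnique_tgt z := by
    have hH : ∀ s, Sum.map id (Sum.inr : H.V → K.V ⊕ H.V) (H.tgt s) = .inl z ↔ H.tgt s = .inl z := by
      intro s; rcases H.tgt s with y | v <;> simp
    -- The strand of `H` that ends at `z` starts either at an input `y`, which is traced back
    -- through `K`, or at a half-edge of `H`, in which case nothing coming from `K` ends at `z`.
    obtain ⟨y | o, h, hu⟩ := H.existsUnique_tgt z
    · obtain ⟨s, h', hu'⟩ := K.existsUnique_tgt y
      have key : ∀ s', Sum.elim (fun y => Sum.map id .inr (H.tgt (.inl y)))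
          (fun v => .inr (.inl v)) (K.tgt s') = (.inl z : Z ⊕ (K.V ⊕ H.V)) → s' = s := by
        intro s' hs'
        apply hu'
        rcases e : K.tgt s' with y' | v <;> simp only [e, Sum.elim_inl, Sum.elim_inr, hH] at hs'
        · have := hu _ hs'
          simpa using this
        · cases hs'
      rcases s with x | o
      · refine ⟨.inl x, by simp [h', h], ?_⟩
        rintro (x' | o' | o') hs
        · simpa using key _ hs
        · simpa using key _ hs
        · have := hu _ ((hH _).1 hs)
          cases this
      · refine ⟨.inr (.inl o), by simp [h', h], ?_⟩
        rintro (x' | o' | o') hs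
        · simpa using key _ hs
        · simpa using key _ hs
        · have := hu _ ((hH _).1 hs)
          cases this
    · have key : ∀ s', Sum.elim (fun y => Sum.map id .inr (H.tgt (.inl y)))
          (fun v => .inr (.inl v)) (K.tgt s') ≠ (.inl z : Z ⊕ (K.V ⊕ H.V)) := by
        intro s' hs'
        rcases e : K.tgt s' with y' | v <;> simp only [e, Sum.elim_inl, Sum.elim_inr, hH] at hs'
        · cases hu _ hs'
        · cases hs'
      refine ⟨.inr (.inr o), by simp [h], ?_⟩
      rintro (x' | o' | o') hs
      · exact (key _ hs).elim
      · exact (key _ hs).elim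
      · simpa using hu _ ((hH _).1 hs)

/-- Horizontal composition with an identity. -/
abbrev addId (R : Type) (G : Wiring X Y) : Wiring (X ⊕ R) (Y ⊕ R) where
  V := G.V
  H := G.H
  col := G.col
  src := G.src
  tgt
    | .inl (.inl x) => Sum.map .inl id (G.tgt (.inl x))
    | .inl (.inr r) => .inl (.inr r)
    | .inr o => Sum.map .inl id (G.tgt (.inr o))
  existsUnique_tgt := by
    have hG : ∀ s y, Sum.map (Sum.inl : Y → Y ⊕ R) id (G.tgt s) = .inl (.inl y) ↔
        G.tgt s = .inl y := by
      intro s y; rcases G.tgt s with y | v <;> simp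
    have hG' : ∀ s r, Sum.map (Sum.inl : Y → Y ⊕ R) id (G.tgt s) ≠ .inl (.inr r) := by
      intro s y; rcases G.tgt s with y | v <;> simp
    rintro (y | r)
    · obtain ⟨x | o, h, hu⟩ := G.existsUnique_tgt y
      · refine ⟨.inl (.inl x), by simp [h], ?_⟩
        rintro ((x' | r') | o') hs
        · simpa using hu _ ((hG _ _).1 hs)
        · simp at hs
        · simpa using hu _ ((hG _ _).1 hs)
      · refine ⟨.inr o, by simp [h], ?_⟩
        rintro ((x' | r') | o') hs
        · simpa using hu _ ((hG _ _).1 hs)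
        · simp at hs
        · simpa using hu _ ((hG _ _).1 hs)
    · refine ⟨.inl (.inr r), rfl, ?_⟩
      rintro ((x' | r') | o') hs
      · exact (hG' _ _ hs).elim
      · simpa using hs
      · exact (hG' _ _ hs).elim

/-- The composite of `G` with `C` along a part of the inputs of `G`. -/
abbrev comp (G : Wiring (B ⊕ R) Y) (C : Wiring A B) : Wiring (A ⊕ R) Y := G.vcomp (C.addId R)

end Wiring

/-! ### Coherence isomorphisms and indecomposability of wirings. -/

namespace Wiring
variable {X Y Z X' Y' Z' X'' Y'' A B R A' B' R' : Type}

/-- Vertical composition is compatible with isomorphisms. -/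
def Iso.vcomp {a : X ≃ X'} {b : Y ≃ Y'} {c : Z ≃ Z'} {H : Wiring Y Z} {H' : Wiring Y' Z'}
    {K : Wiring X Y} {K' : Wiring X' Y'} (f : Iso b c H H') (g : Iso a b K K') :
    Iso a c (H.vcomp K) (H'.vcomp K') := by
  refine .ofFun (.sumCongr g.fV f.fV) (.sumCongr g.fH f.fH) (Sum.map g.fV f.fV)
    (Sum.map g.fH f.fH) (fun _ => rfl) (fun _ => rfl) ?_ ?_ (fun x => ?_) ?_
  · rintro (v | v) <;> simp [f.col_eq, g.col_eq]
  · rintro (v | v) <;> simp [Wiring.vcomp, f.src_eq, g.src_eq]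
  · rcases h : K.tgt (.inl x) with y | v <;>
      simp [Wiring.vcomp, g.tgt_inl, h, f.tgt_inl, Sum.map_map, Function.comp_def]
  · rintro (o | o)
    · rcases h : K.tgt (.inr o) with y | v <;>
        simp [Wiring.vcomp, g.tgt_inr, h, f.tgt_inl, Sum.map_map, Function.comp_def]
    · simp [Wiring.vcomp, f.tgt_inr, Sum.map_map, Function.comp_def]

/-- Horizontal composition with an identity is compatible with isomorphisms. -/
def Iso.addId {a : X ≃ X'} {b : Y ≃ Y'} {G : Wiring X Y} {G' : Wiring X' Y'} (f : Iso a b G G')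
    (r : R ≃ R') : Iso (.sumCongr a r) (.sumCongr b r) (G.addId R) (G'.addId R') := by
  refine .ofFun f.fV f.fH f.fV f.fH (fun _ => rfl) (fun _ => rfl) f.col_eq f.src_eq ?_ (fun o => ?_)
  · rintro (x | x)
    · rcases h : G.tgt (.inl x) with y | v <;> simp [Wiring.addId, f.tgt_inl, h]
    · simp [Wiring.addId]
  · rcases h : G.tgt (.inr o) with y | v <;> simp [Wiring.addId, f.tgt_inr, h]

/-- Associativity of the vertical composition. -/
def isoVcompAssoc {W : Type} (K : Wiring Z W) (H : Wiring Y Z) (G : Wiring X Y) :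
    Iso (.refl _) (.refl _) (K.vcomp (H.vcomp G)) ((K.vcomp H).vcomp G) := by
  refine .ofFun (.sumAssoc _ _ _) (.sumAssoc _ _ _)
    (Sum.elim (Sum.elim .inl (.inr ∘ .inl)) (.inr ∘ .inr))
    (Sum.elim (Sum.elim .inl (.inr ∘ .inl)) (.inr ∘ .inr)) ?_ ?_ ?_ ?_ (fun x => ?_) ?_
  · rintro ((v | v) | v) <;> rfl
  · rintro ((v | v) | v) <;> rfl
  · rintro ((v | v) | v) <;> rfl
  · rintro ((v | v) | v) <;> rfl
  · rcases h : G.tgt (.inl x) with y | v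
    · rcases h' : H.tgt (.inl y) with z | v
      · rcases h'' : K.tgt (.inl z) with w | v <;> simp [vcomp, h, h', h'']
      · simp [vcomp, h, h']
    · simp [vcomp, h]
  · rintro ((o | o) | o)
    · rcases h : G.tgt (.inr o) with y | v
      · rcases h' : H.tgt (.inl y) with z | v
        · rcases h'' : K.tgt (.inl z) with w | v <;> simp [vcomp, h, h', h'']
        · simp [vcomp, h, h']
      · simp [vcomp, h]
    · rcases h' : H.tgt (.inr o) with z | v
      · rcases h'' : K.tgt (.inl z) with w | v <;> simp [vcomp, h', h'']
      · simp [vcomp, h']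
    · rcases h'' : K.tgt (.inr o) with w | v <;> simp [vcomp, h'']

/-- Horizontal composition of a vertical composition with an identity. -/
def isoAddIdVcomp (R : Type) (H : Wiring Y Z) (G : Wiring X Y) :
    Iso (.refl _) (.refl _) ((H.vcomp G).addId R) ((H.addId R).vcomp (G.addId R)) := by
  refine .ofFun (.refl _) (.refl _) id id (fun _ => rfl) (fun _ => rfl) (fun _ => rfl)
    (fun _ => rfl) ?_ ?_
  · rintro (x | r)
    · rcases h : G.tgt (.inl x) with y | v
      · rcases h' : H.tgt (.inl y) with z | v <;> simp [addId, vcomp, h, h']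
      · simp [addId, vcomp, h]
    · simp [addId, vcomp]
  · rintro (o | o)
    · rcases h : G.tgt (.inr o) with y | v
      · rcases h' : H.tgt (.inl y) with z | v <;> simp [addId, vcomp, h, h']
      · simp [addId, vcomp, h]
    · rcases h : H.tgt (.inr o) with y | v <;> simp [addId, vcomp, h]

/-- Horizontal composition with two identities. -/
def isoAddIdAddId (R R' : Type) (G : Wiring X Y) :
    Iso (.sumAssoc _ _ _) (.sumAssoc _ _ _) ((G.addId R).addId R') (G.addId (R ⊕ R')) := by
  refine .ofFun (.refl _) (.refl _) id id (fun _ => rfl) (fun _ => rfl) (fun _ => rfl)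
    (fun _ => rfl) ?_ (fun o => ?_)
  · rintro ((x | r) | r)
    · rcases h : G.tgt (.inl x) with y | v <;> simp [addId, h]
    · simp [addId]
    · simp [addId]
  · rcases h : G.tgt (.inr o) with y | v <;> simp [addId, h]

/-- Composition along a part of the inputs is compatible with isomorphisms. -/
def Iso.comp {a : A ≃ A'} {b : B ≃ B'} {r : R ≃ R'} {y : Y ≃ Y'} {G : Wiring (B ⊕ R) Y}
    {G' : Wiring (B' ⊕ R') Y'} {C : Wiring A B} {C' : Wiring A' B'}
    (f : Iso (.sumCongr b r) y G G') (g : Iso a b C C') :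
    Iso (.sumCongr a r) y (G.comp C) (G'.comp C') :=
  f.vcomp (g.addId r)

/-- Horizontal composition of a composition along a part of the inputs with an identity. -/
def isoAddIdComp (R' : Type) (G : Wiring (B ⊕ R) Y) (C : Wiring A B) :
    Iso (.sumAssoc _ _ _) (.refl _) ((G.comp C).addId R')
      (((G.addId R').relabel (.sumAssoc _ _ _) (.refl _)).comp C) :=
  (isoAddIdVcomp R' G (C.addId R)).trans
    ((isoRelabel (.sumAssoc _ _ _) (.refl _) (G.addId R')).vcomp (isoAddIdAddId R R' C))

/-- Two compositions along disjoint parts of the inputs commute. -/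
def isoCompSwap (G : Wiring (B ⊕ (B' ⊕ R)) Y) (C : Wiring A B) (C' : Wiring A' B') :
    Iso (sumLeftComm _ _ _) (.refl _)
      (((G.comp C).relabel (sumLeftComm _ _ _) (.refl _)).comp C')
      ((((G.relabel (sumLeftComm _ _ _) (.refl _)).comp C').relabel
        (sumLeftComm _ _ _) (.refl _)).comp C) := by
  refine .ofFun (sumLeftComm _ _ _) (sumLeftComm _ _ _)
    (Sum.elim (.inr ∘ .inl) (Sum.elim .inl (.inr ∘ .inr)))
    (Sum.elim (.inr ∘ .inl) (Sum.elim .inl (.inr ∘ .inr))) ?_ ?_ ?_ ?_ ?_ ?_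
  · rintro (v | v | v) <;> rfl
  · rintro (v | v | v) <;> rfl
  · rintro (v | v | v) <;> rfl
  · rintro (v | v | v) <;> rfl
  · rintro (x | x | x)
    · rcases h : C'.tgt (.inl x) with y | v
      · rcases h' : G.tgt (.inl (.inr (.inl y))) with z | v <;>
          simp [comp, relabel, addId, vcomp, h, h', sumLeftComm]
      · simp [comp, relabel, addId, vcomp, h, sumLeftComm]
    · rcases h : C.tgt (.inl x) with y | v
      · rcases h' : G.tgt (.inl (.inl y)) with z | v <;>
          simp [comp, relabel, addId, vcomp, h, h', sumLeftComm]
      · simp [comp, relabel, addId, vcomp, h, sumLeftComm]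
    · rcases h' : G.tgt (.inl (.inr (.inr x))) with z | v <;>
          simp [comp, relabel, addId, vcomp, h', sumLeftComm]
  · rintro (x | x | x)
    · rcases h : C'.tgt (.inr x) with y | v
      · rcases h' : G.tgt (.inl (.inr (.inl y))) with z | v <;>
          simp [comp, relabel, addId, vcomp, h, h', sumLeftComm]
      · simp [comp, relabel, addId, vcomp, h, sumLeftComm]
    · rcases h : C.tgt (.inr x) with y | v
      · rcases h' : G.tgt (.inl (.inl y)) with z | v <;>
          simp [comp, relabel, addId, vcomp, h, h', sumLeftComm]
      · simp [comp, relabel, addId, vcomp, h, sumLeftComm]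
    · rcases h' : G.tgt (.inr x) with z | v <;>
          simp [comp, relabel, addId, vcomp, h', sumLeftComm]

/-- No input is connected directly to an output. -/
def NoThrough (G : Wiring X Y) : Prop := ∀ x, ∃ v, G.tgt (.inl x) = .inr v

/-- A set of vertices closed under predecessors. -/
def IsLower (G : Wiring X Y) (S : Set G.V) : Prop :=
  ∀ o, ∀ v ∈ S, G.tgt (.inr o) = .inr v → G.src o ∈ S

/-- Indecomposable wirings. -/
structure Indec (G : Wiring X Y) : Prop where
  nonempty : Nonempty G.V
  noThrough : G.NoThrough
  eq_univ : ∀ S : Set G.V, G.IsLower S → S.Nonempty → S = Set.univ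

theorem Iso.noThrough {a : X ≃ X'} {b : Y ≃ Y'} {G : Wiring X Y} {G' : Wiring X' Y'}
    (f : Iso a b G G') (h : G.NoThrough) : G'.NoThrough := by
  intro x
  obtain ⟨x, rfl⟩ := a.surjective x
  obtain ⟨v, hv⟩ := h x
  exact ⟨f.fV v, by simp [f.tgt_inl, hv]⟩

theorem Iso.isLower {a : X ≃ X'} {b : Y ≃ Y'} {G : Wiring X Y} {G' : Wiring X' Y'}
    (f : Iso a b G G') {S : Set G'.V} (h : G'.IsLower S) : G.IsLower (f.fV ⁻¹' S) := by
  intro o v hv ho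
  have := h (f.fH o) (f.fV v) hv (by simp [f.tgt_inr, ho])
  rwa [f.src_eq] at this

theorem Iso.indec {a : X ≃ X'} {b : Y ≃ Y'} {G : Wiring X Y} {G' : Wiring X' Y'}
    (f : Iso a b G G') (h : G.Indec) : G'.Indec where
  nonempty := h.nonempty.map f.fV
  noThrough := f.noThrough h.noThrough
  eq_univ S hS hne := by
    have := h.eq_univ _ (f.isLower hS) (hne.preimage f.fV.surjective)
    rwa [Set.preimage_eq_univ_iff, f.fV.surjective.range_eq, Set.univ_subset_iff] at this

end Wiring

/-! ### Bijections between sums. -/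

theorem Equiv.exists_eq_sumCongr {A R A' R' : Type} (e : A ⊕ R ≃ A' ⊕ R')
    (h : ∀ x, (e x).isLeft = x.isLeft) :
    ∃ (a : A ≃ A') (r : R ≃ R'), e = Equiv.sumCongr a r := by
  have h' : ∀ x, (e.symm x).isLeft = x.isLeft := fun x => by simpa using (h (e.symm x)).symm
  have h1 : ∀ a, ∃ a', e (.inl a) = .inl a' := fun a => Sum.isLeft_iff.1 (h _)
  have h2 : ∀ a, ∃ a', e.symm (.inl a) = .inl a' := fun a => Sum.isLeft_iff.1 (h' _)
  have h3 : ∀ a, ∃ a', e (.inr a) = .inr a' := fun a =>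
    Sum.isRight_iff.1 (by simp [h, ← Sum.not_isLeft])
  have h4 : ∀ a, ∃ a', e.symm (.inr a) = .inr a' := fun a =>
    Sum.isRight_iff.1 (by simp [h', ← Sum.not_isLeft])
  choose f1 h1 using h1
  choose f2 h2 using h2
  choose f3 h3 using h3
  choose f4 h4 using h4
  refine ⟨⟨f1, f2, fun x => ?_, fun x => ?_⟩, ⟨f3, f4, fun x => ?_, fun x => ?_⟩, ?_⟩
  · exact Sum.inl_injective (by rw [← h2, ← h1, e.symm_apply_apply])
  · exact Sum.inl_injective (by rw [← h1, ← h2, e.apply_symm_apply])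
  · exact Sum.inr_injective (by rw [← h4, ← h3, e.symm_apply_apply])
  · exact Sum.inr_injective (by rw [← h3, ← h4, e.apply_symm_apply])
  · ext (x | x)
    · simp [h1]
    · simp [h3]

/-- As `B` lands in `S`, the part matched with `A` comes entirely from `R`. Removing it leaves a
remainder `R₀` common to both sides. For two disjoint initial parts of a wiring with inputs `B` and
`A` to the rest, `R₀` indexes the strands that bypass both. -/
theorem Equiv.exists_sum_refinement {A B R S : Type} (e : B ⊕ R ≃ A ⊕ S)
    (h : ∀ b, (e (.inl b)).isRight) :
    ∃ (R₀ : Type) (r : R ≃ A ⊕ R₀) (s : S ≃ B ⊕ R₀),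
      e.trans (Equiv.sumCongr (.refl _) s) =
        (Equiv.sumCongr (.refl _) r).trans (sumLeftComm B A R₀) := by
  classical
  have h1 : ∀ b, ∃ a', e (.inl b) = .inr a' := fun a => Sum.isRight_iff.1 (h _)
  choose f h1 using h1
  have h2 : ∀ a, ∃ r, e.symm (.inl a) = .inr r := by
    intro a
    rcases h : e.symm (.inl a) with b | r
    · rw [Equiv.symm_apply_eq, h1] at h
      cases h
    · exact ⟨r, rfl⟩
  choose g h2 using h2
  have hf : Function.Injective f := fun x y hxy => by
    simpa using e.injective ((h1 x).trans ((congrArg _ hxy).trans (h1 y).symm))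
  have hg : Function.Injective g := fun x y hxy => by
    simpa using e.symm.injective ((h2 x).trans ((congrArg _ hxy).trans (h2 y).symm))
  have h2' : ∀ a, e (.inr (g a)) = .inl a := fun a => by rw [← h2, e.apply_symm_apply]
  have key : ∀ r : R, r ∉ Set.range g → ∃ s, e (.inr r) = .inr s := by
    intro r hr
    rcases h : e (.inr r) with a | s
    · exact (hr ⟨a, Sum.inr_injective (e.injective ((h2' a).trans h.symm))⟩).elim
    · exact ⟨s, rfl⟩
  choose k hk using key
  let r : A ⊕ {r // r ∉ Set.range g} ≃ R :=
    (Equiv.sumCongr (Equiv.ofInjective g hg) (.refl _)).trans (Equiv.sumCompl (· ∈ Set.range g))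
  let F : B ⊕ {r // r ∉ Set.range g} → S := Sum.elim f (fun r => k r.1 r.2)
  have hF : Function.Bijective F := by
    constructor
    · rintro (b | ⟨r, hr⟩) (b' | ⟨r', hr'⟩) hh <;> simp only [F, Sum.elim_inl, Sum.elim_inr] at hh
      · rw [hf hh]
      · have := e.injective ((h1 b).trans ((congrArg _ hh).trans (hk r' hr').symm))
        cases this
      · have := e.injective ((h1 b').trans ((congrArg _ hh.symm).trans (hk r hr).symm))
        cases this
      · have := e.injective ((hk r hr).trans ((congrArg _ hh).trans (hk r' hr').symm))
        cases this
        rfl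
    · intro s
      rcases h : e.symm (.inr s) with b | r
      · rw [Equiv.symm_apply_eq, h1] at h
        exact ⟨.inl b, (Sum.inr_injective h).symm⟩
      · rw [Equiv.symm_apply_eq] at h
        have hr : r ∉ Set.range g := by
          rintro ⟨a, rfl⟩
          rw [h2'] at h
          cases h
        rw [hk r hr] at h
        exact ⟨.inr ⟨r, hr⟩, (Sum.inr_injective h).symm⟩
  refine ⟨_, r.symm, (Equiv.ofBijective F hF).symm, ?_⟩
  ext (b | x)
  · simp only [Equiv.trans_apply, h1]
    simp only [sumCongr_apply, Sum.map_inr, Sum.map_inl, coe_refl, id, sumLeftComm]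
    simp [Equiv.symm_apply_eq, F]
  · obtain ⟨x | x, rfl⟩ := r.surjective x
    · simp [r, h2', sumLeftComm]
    · simp only [Equiv.trans_apply, sumCongr_apply, Sum.map_inr, Equiv.symm_apply_apply]
      simp [r, hk x.1 x.2, sumLeftComm, Equiv.symm_apply_eq, F]

namespace Wiring
variable {X Y Z X' Y' Z' X'' Y'' A B R A' B' R' : Type}

/-! ### Splitting a wiring along a lower set of vertices -/

/-- The target is a vertex of `S`. -/
def Hits {V : Type} (S : Set V) : Y ⊕ V → Prop := Sum.elim (fun _ => False) (· ∈ S)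

/-- The vertex of `S` which is hit. -/
def Hits.vertex {V : Type} {S : Set V} : (z : Y ⊕ V) → Hits S z → S
  | .inr v, h => ⟨v, h⟩
  | .inl _, h => h.elim

/-- The target outside of `S`. -/
def Hits.off {V : Type} {S : Set V} : (z : Y ⊕ V) → ¬ Hits S z → Y ⊕ {v // v ∉ S}
  | .inr v, h => .inr ⟨v, h⟩
  | .inl y, _ => .inl y

theorem Hits.inr_vertex {V : Type} {S : Set V} (z : Y ⊕ V) (h : Hits S z) :
    z = .inr (Hits.vertex z h).1 := by
  rcases z with y | v
  · exact h.elim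
  · rfl

theorem Hits.map_off {V : Type} {S : Set V} (z : Y ⊕ V) (h : ¬ Hits S z) :
    Sum.map id Subtype.val (Hits.off z h) = z := by
  rcases z with y | v <;> rfl

variable (G : Wiring X Y) (S : Set G.V)

open Classical in
/-- The part of a wiring spanned by a set of vertices. -/
noncomputable abbrev low : Wiring {x : X // Hits S (G.tgt (.inl x))}
    {o : {o // G.src o ∈ S} // ¬ Hits S (G.tgt (.inr o.1))} where
  V := S
  H := {o // G.src o ∈ S}
  col v := G.col v
  src o := ⟨G.src o.1, o.2⟩
  tgt
    | .inl x => .inr (Hits.vertex _ x.2)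
    | .inr o => if h : Hits S (G.tgt (.inr o.1)) then .inr (Hits.vertex _ h) else .inl ⟨o, h⟩
  existsUnique_tgt y := by
    refine ⟨.inr y.1, by simp [y.2], ?_⟩
    rintro (x | o) h
    · cases h
    · by_cases h' : Hits S (G.tgt (.inr o.1))
      · simp [h'] at h
      · simp only [h', dif_neg, not_false_eq_true, Sum.inl.injEq] at h
        rw [← h]

variable {G S}

/-- The part of a wiring spanned by the vertices outside of a lower set. -/
abbrev high (hS : G.IsLower S) : Wiring
    ({o : {o // G.src o ∈ S} // ¬ Hits S (G.tgt (.inr o.1))} ⊕ {x : X // ¬ Hits S (G.tgt (.inl x))})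
    Y where
  V := {v // v ∉ S}
  H := {o // G.src o ∉ S}
  col v := G.col v
  src o := ⟨G.src o.1, o.2⟩
  tgt
    | .inl (.inl o) => Hits.off _ o.2
    | .inl (.inr x) => Hits.off _ x.2
    -- A half-edge whose source is outside `S` cannot end in `S`, because `S` contains the
    -- predecessors of its elements.
    | .inr o => Hits.off (G.tgt (.inr o.1)) fun h => o.2 (hS _ _ (Hits.vertex _ h).2
        (Hits.inr_vertex _ h))
  existsUnique_tgt y := by
    have key : ∀ z h, Hits.off (S := S) z h = .inl y → z = .inl y := by
      intro z h h'
      rw [← Hits.map_off z h, h']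
      rfl
    have key' : ∀ z (h : ¬ Hits S z), z = .inl y → Hits.off z h = .inl y := by
      rintro z h rfl
      rfl
    obtain ⟨s, hs, hu⟩ := G.existsUnique_tgt y
    have hn : ¬ Hits S (G.tgt s) := by rw [hs]; exact id
    rcases s with x | o
    · refine ⟨.inl (.inr ⟨x, hn⟩), key' _ _ hs, ?_⟩
      rintro ((o | x') | o) h
      · cases hu _ (key _ _ h)
      · cases hu _ (key _ _ h)
        rfl
      · cases hu _ (key _ _ h)
    · by_cases ho : G.src o ∈ S
      · refine ⟨.inl (.inl ⟨⟨o, ho⟩, hn⟩), key' _ _ hs, ?_⟩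
        rintro ((⟨⟨o', h1⟩, h2⟩ | x') | o') h
        · cases hu _ (key _ _ h)
          rfl
        · cases hu _ (key _ _ h)
        · cases hu _ (key _ _ h)
          exact (o'.2 ho).elim
      · refine ⟨.inr ⟨o, ho⟩, key' _ _ hs, ?_⟩
        rintro ((⟨⟨o', h1⟩, h2⟩ | x') | o') h
        · cases hu _ (key _ _ h)
          exact (ho h1).elim
        · cases hu _ (key _ _ h)
        · cases hu _ (key _ _ h)
          rfl

theorem low_noThrough : (G.low S).NoThrough := fun _ => ⟨_, rfl⟩

open Classical in
/-- A wiring is the composite of its two parts with respect to a lower set. -/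
noncomputable def isoSplit (hS : G.IsLower S) :
    Iso (Equiv.sumCompl fun x => Hits S (G.tgt (.inl x))).symm (.refl _) G
      ((high hS).comp (G.low S)) := by
  have hV : ∀ v (h : v ∈ S), (Equiv.sumCompl (· ∈ S)).symm v = .inl ⟨v, h⟩ := fun v h =>
    Equiv.sumCompl_symm_apply_of_pos h
  have hV' : ∀ v (h : v ∉ S), (Equiv.sumCompl (· ∈ S)).symm v = .inr ⟨v, h⟩ := fun v h =>
    Equiv.sumCompl_symm_apply_of_neg h
  have hvert : ∀ z (h : Hits S z), (.inr (.inl (Hits.vertex z h)) : Y ⊕ (S ⊕ {v // v ∉ S})) =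
      Sum.map id (Equiv.sumCompl (· ∈ S)).symm z := by
    rintro (y | v) h
    · exact h.elim
    · exact congrArg Sum.inr (hV v h).symm
  have hoff : ∀ z (h : ¬ Hits S z), Sum.map id Sum.inr (Hits.off z h) =
      (Sum.map id (Equiv.sumCompl (· ∈ S)).symm z : Y ⊕ (S ⊕ {v // v ∉ S})) := by
    rintro (y | v) h
    · rfl
    · exact congrArg Sum.inr (hV' v h).symm
  refine .ofFun (Equiv.sumCompl (· ∈ S)).symm (Equiv.sumCompl fun o => G.src o ∈ S).symm
    (Equiv.sumCompl (· ∈ S)).symm (Equiv.sumCompl fun o => G.src o ∈ S).symm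
    (fun _ => rfl) (fun _ => rfl) ?_ ?_ ?_ ?_
  · intro v
    by_cases h : v ∈ S
    · rw [hV v h]; rfl
    · rw [hV' v h]; rfl
  · intro o
    by_cases h : G.src o ∈ S
    · rw [hV _ h, Equiv.sumCompl_symm_apply_of_pos (p := fun o => G.src o ∈ S) h]; rfl
    · rw [hV' _ h, Equiv.sumCompl_symm_apply_of_neg (p := fun o => G.src o ∈ S) h]; rfl
  · intro x
    by_cases h : Hits S (G.tgt (.inl x))
    · rw [Equiv.sumCompl_symm_apply_of_pos (p := fun x => Hits S (G.tgt (.inl x))) h]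
      exact hvert _ h
    · rw [Equiv.sumCompl_symm_apply_of_neg (p := fun x => Hits S (G.tgt (.inl x))) h]
      exact hoff _ h
  · intro o
    by_cases h : G.src o ∈ S
    · rw [Equiv.sumCompl_symm_apply_of_pos (p := fun o => G.src o ∈ S) h]
      by_cases h' : Hits S (G.tgt (.inr o))
      · simp only [comp, vcomp, addId, h', dif_pos, Sum.map_inr, Sum.elim_inr, id]
        exact hvert _ h'
      · simp only [comp, vcomp, addId, h', dif_neg, Sum.map_inl, Sum.elim_inl, not_false_eq_true]
        exact hoff _ h'
    · rw [Equiv.sumCompl_symm_apply_of_neg (p := fun o => G.src o ∈ S) h]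
      exact hoff _ _

/-- Records which vertices go to the lower factor, so that later arguments need not unfold the
isomorphism. -/
theorem isoSplit_isLeft (hS : G.IsLower S) (v : G.V) :
    ((isoSplit hS).fV v).isLeft ↔ v ∈ S := by
  classical
  by_cases h : v ∈ S
  · have : (isoSplit hS).fV v = .inl ⟨v, h⟩ := Equiv.sumCompl_symm_apply_of_pos h
    simp [this, h]
  · have : (isoSplit hS).fV v = .inr ⟨v, h⟩ := Equiv.sumCompl_symm_apply_of_neg h
    simp [this, h]

/-- Every wiring with a vertex contains a minimal nonempty lower set. -/
theorem exists_isLower_minimal (G : Wiring X Y) [Nonempty G.V] :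
    ∃ S, G.IsLower S ∧ (G.low S).Indec := by
  -- The whole vertex set is a nonempty lower set and there are finitely many, so a minimal one
  -- exists. It is an initial strongly connected component.
  obtain ⟨S, hS⟩ := Set.Finite.exists_minimal (s := {S : Set G.V | G.IsLower S ∧ S.Nonempty})
    (Set.toFinite _) ⟨Set.univ, fun _ _ _ _ => trivial, Set.univ_nonempty⟩
  refine ⟨S, hS.prop.1, hS.prop.2.to_subtype, low_noThrough, fun T hT hne => ?_⟩
  -- A lower set of the part on `S` is lower in `G`, because predecessors of vertices of `S` stay in
  -- `S`. Minimality of `S` then applies to it.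
  have : G.IsLower (Subtype.val '' T) := by
    rintro o _ ⟨v, hv, rfl⟩ ho
    have h1 := hS.prop.1 o v v.2 ho
    refine ⟨⟨_, h1⟩, hT ⟨o, h1⟩ v hv ?_, rfl⟩
    have h2 : Hits S (G.tgt (.inr o)) := by rw [ho]; exact v.2
    have h3 := ho.symm.trans (Hits.inr_vertex _ h2)
    simp only [h2, dif_pos, Sum.inr.injEq]
    exact Subtype.ext (Sum.inr_injective h3).symm
  have := hS.le_of_le ⟨this, hne.image _⟩ (by rintro _ ⟨v, -, rfl⟩; exact v.2)
  ext v
  obtain ⟨w, hw, h⟩ := this v.2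
  simpa [← Subtype.ext h] using hw

/-! ### Uniqueness of splittings -/

/-- Something ends at every output, and it cannot be an input. -/
theorem NoThrough.exists_src {C : Wiring A B} (h : C.NoThrough) (b : B) :
    ∃ o, C.tgt (.inr o) = .inl b := by
  obtain ⟨x | o, hs, -⟩ := C.existsUnique_tgt b
  · obtain ⟨v, hv⟩ := h x
    simp [hv] at hs
  · exact ⟨o, hs⟩

/-- In the absence of through strands, outputs correspond to the half-edges that end at an output. A
matching of half-edges that respects this property therefore determines a matching of outputs. It
recovers the hidden boundary of a composite in `comp_split`. -/
theorem exists_outEquiv {C : Wiring A B} {C' : Wiring A' B'} (hC : C.NoThrough)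
    (hC' : C'.NoThrough) (e : C.H ≃ C'.H)
    (he : ∀ o, (C'.tgt (.inr (e o))).isLeft = (C.tgt (.inr o)).isLeft) :
    ∃ b : B ≃ B', ∀ o y, C.tgt (.inr o) = .inl y → C'.tgt (.inr (e o)) = .inl (b y) := by
  choose f hf using hC.exists_src
  choose f' hf' using hC'.exists_src
  have h1 : ∀ y, ∃ y', C'.tgt (.inr (e (f y))) = .inl y' := fun y =>
    Sum.isLeft_iff.1 (by simp [he, hf])
  have h2 : ∀ y, ∃ y', C.tgt (.inr (e.symm (f' y))) = .inl y' := fun y =>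
    Sum.isLeft_iff.1 (by simp [← he, hf'])
  choose g hg using h1
  choose g' hg' using h2
  have hu : ∀ o y, C.tgt (.inr o) = .inl y → o = f y := fun o y h =>
    Sum.inr_injective ((C.existsUnique_tgt y).unique h (hf y))
  have hu' : ∀ o y, C'.tgt (.inr o) = .inl y → o = f' y := fun o y h =>
    Sum.inr_injective ((C'.existsUnique_tgt y).unique h (hf' y))
  refine ⟨⟨g, g', fun y => ?_, fun y => ?_⟩, fun o y h => ?_⟩
  · have := hg' (g y)
    rw [← hu' _ _ (hg y), e.symm_apply_apply, hf] at this
    exact (Sum.inl_injective this).symm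
  · have := hg (g' y)
    rw [← hu _ _ (hg' y), e.apply_symm_apply, hf'] at this
    exact (Sum.inl_injective this).symm
  · rw [hu _ _ h]
    exact hg y

/-- The boundary `B` is not visible in the composite, but it is determined by it: without through
strands in `C`, its points are the half-edges with source in `C` and target outside. Once the
vertices are known to respect the two levels, so do the half-edges (by their sources) and the inputs
(by their targets), and the isomorphism restricts to both factors. -/
theorem comp_split {a : A ⊕ R ≃ A' ⊕ R'} {b : Y ≃ Y'} {G : Wiring (B ⊕ R) Y} {C : Wiring A B}
    {G' : Wiring (B' ⊕ R') Y'} {C' : Wiring A' B'} (f : Iso a b (G.comp C) (G'.comp C'))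
    (hC : C.NoThrough) (hC' : C'.NoThrough)
    (hf : ∀ v : C.V ⊕ G.V, Sum.isLeft (f.fV v : C'.V ⊕ G'.V) = v.isLeft) :
    ∃ (α : A ≃ A') (β : B ≃ B') (ρ : R ≃ R'), a = .sumCongr α ρ ∧ Nonempty (Iso α β C C') ∧
      Nonempty (Iso (.sumCongr β ρ) b G G') := by
  obtain ⟨fV, fH, hcol, hsrc, hinl, hinr⟩ := f
  have hlift : ∀ (C : Wiring A B) (G : Wiring (B ⊕ R) Y) (z : Y ⊕ G.V) (v : C.V),
    (Sum.map id .inr z : Y ⊕ (C.V ⊕ G.V)) ≠ .inr (.inl v) := by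
      rintro C G (y | v) w h <;> simp at h
  have hlift' : ∀ (z : Y' ⊕ G'.V) (v : C'.V),
    (Sum.map id .inr z : Y' ⊕ (C'.V ⊕ G'.V)) ≠ .inr (.inl v) := by
      rintro (y | v) w h <;> simp at h
  obtain ⟨v, v', hv⟩ := Equiv.exists_eq_sumCongr (A := C.V) (R := G.V) (A' := C'.V) (R' := G'.V) fV hf
  subst hv
  obtain ⟨h, h', hh⟩ := Equiv.exists_eq_sumCongr (A := C.H) (R := G.H) (A' := C'.H) (R' := G'.H)
    fH (by
    rintro (o | o)
    · have := hsrc (.inl o)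
      rcases e : (fH (.inl o) : C'.H ⊕ G'.H) with o' | o'
      · rfl
      · rw [e] at this; cases this
    · have := hsrc (.inr o)
      rcases e : (fH (.inr o) : C'.H ⊕ G'.H) with o' | o'
      · rw [e] at this; cases this
      · rfl)
  subst hh
  -- Inputs in `A` end at a vertex of `C`, whereas inputs in `R` bypass `C` altogether.
  obtain ⟨α, ρ, rfl⟩ := Equiv.exists_eq_sumCongr a (by
    rintro (x | x)
    · have := hinl (.inl x)
      rcases e : a (.inl x) with x' | x'
      · rfl
      · rw [e] at this
        obtain ⟨w, hw⟩ := hC x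
        simp only [comp, vcomp, addId, hw, Sum.map_inr, Sum.elim_inr, Sum.elim_inl] at this
        exact (hlift' _ _ this).elim
    · have := hinl (.inr x)
      rcases e : a (.inr x) with x' | x'
      · rw [e] at this
        obtain ⟨w, hw⟩ := hC' x'
        simp only [comp, vcomp, addId, hw, Sum.map_inr, Sum.elim_inr, Sum.elim_inl] at this
        rcases e' : G.tgt (.inl (.inr x)) with z | z <;> rw [e'] at this <;> cases this
      · rfl)
  have hcol : ∀ w : C.V ⊕ G.V, Sum.elim C'.col G'.col (Sum.map v v' w) = Sum.elim C.col G.col w :=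
    hcol
  have hsrc : ∀ w : C.H ⊕ G.H, Sum.map C'.src G'.src (Sum.map h h' w) =
    Sum.map v v' (Sum.map C.src G.src w) := hsrc
  have hinr : ∀ w : C.H ⊕ G.H, (G'.comp C').tgt (.inr (Sum.map h h' w)) =
    Sum.map b (Sum.map v v') ((G.comp C).tgt (.inr w)) := hinr
  have hinl : ∀ w : A ⊕ R, (G'.comp C').tgt (.inl (Sum.map α ρ w)) =
    Sum.map b (Sum.map v v') ((G.comp C).tgt (.inl w)) := hinl
  have hinj : Function.Injective
      (Sum.map id .inr : Y' ⊕ G'.V → Y' ⊕ (C'.V ⊕ G'.V)) :=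
    Sum.map_injective.2 ⟨Function.injective_id, Sum.inr_injective⟩
  have hswap : ∀ z : Y ⊕ G.V, Sum.map b (Sum.map v v') (Sum.map id .inr z : Y ⊕ (C.V ⊕ G.V)) =
    Sum.map id .inr (Sum.map b v' z) := by
      rintro (z | z) <;> rfl
  -- A half-edge of `C` crosses the boundary exactly when its target in the composite is not a
  -- vertex of `C`, and this is preserved by the isomorphism.
  obtain ⟨β, hβ⟩ := exists_outEquiv hC hC' h (fun o => by
    have := hinr (.inl o)
    rcases e : C.tgt (.inr o) with y | w <;> rcases e' : C'.tgt (.inr (h o)) with y' | w'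
    · rfl
    · simp only [comp, vcomp, addId, Sum.map_inl, Sum.map_inr, e, e', Sum.elim_inl, Sum.elim_inr,
        hswap] at this
      exact (hlift' _ _ this.symm).elim
    · simp only [comp, vcomp, addId, Sum.map_inl, Sum.map_inr, e, e', Sum.elim_inl,
        Sum.elim_inr] at this
      exact (hlift' _ _ this).elim
    · rfl)
  refine ⟨α, β, ρ, rfl, ⟨v, h, fun w => hcol (.inl w), fun o => Sum.inl_injective (hsrc (.inl o)),
    fun x => ?_, fun o => ?_⟩, ⟨v', h', fun w => hcol (.inr w),
    fun o => Sum.inr_injective (hsrc (.inr o)), ?_, fun o => ?_⟩⟩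
  · have := hinl (.inl x)
    obtain ⟨w, hw⟩ := hC x
    obtain ⟨w', hw'⟩ := hC' (α x)
    simp only [comp, vcomp, addId, Sum.map_inl, Sum.map_inr, hw, hw', Sum.elim_inr] at this
    rw [hw, hw']
    simpa using this
  · have := hinr (.inl o)
    rcases e : C.tgt (.inr o) with y | w
    · exact hβ _ _ e
    · rcases e' : C'.tgt (.inr (h o)) with y' | w'
      · simp only [comp, vcomp, addId, Sum.map_inl, Sum.map_inr, e, e', Sum.elim_inl,
        Sum.elim_inr] at this
        exact (hlift' _ _ this).elim
      · simp only [comp, vcomp, addId, Sum.map_inl, Sum.map_inr, e, e', Sum.elim_inr] at this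
        simpa using this
  · rintro (y | r)
    -- The target of a boundary input of `G` is read off from the half-edge of `C` that arrives
    -- there.
    · obtain ⟨o, ho⟩ := hC.exists_src y
      have := hinr (.inl o)
      simp only [comp, vcomp, addId, Sum.map_inl, ho, hβ _ _ ho, Sum.elim_inl, hswap] at this
      exact hinj this
    · have := hinl (.inr r)
      simp only [comp, vcomp, addId, Sum.map_inr, Sum.elim_inl, hswap] at this
      exact hinj this
  · have := hinr (.inr o)
    simp only [comp, vcomp, addId, Sum.map_inr, hswap] at this
    exact hinj this

theorem isLower_comp_isLeft (G : Wiring (B ⊕ R) Y) (C : Wiring A B) :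
    (G.comp C).IsLower {v : C.V ⊕ G.V | v.isLeft} := by
  rintro (o | o) (v | v) hv ho
  · rfl
  · cases hv
  · rcases e : G.tgt (.inr o) with z | z <;> simp [e] at ho
  · cases hv

theorem IsLower.left {G : Wiring (B ⊕ R) Y} {C : Wiring A B} {S : Set (C.V ⊕ G.V)}
    (h : (G.comp C).IsLower S) : C.IsLower (Sum.inl ⁻¹' S) := fun o v hv ho =>
  h (.inl o) (.inl v) hv (by simp [ho])

theorem IsLower.right {G : Wiring (B ⊕ R) Y} {C : Wiring A B} {S : Set (C.V ⊕ G.V)}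
    (h : (G.comp C).IsLower S) : G.IsLower (Sum.inr ⁻¹' S) := fun o v hv ho =>
  h (.inr o) (.inr v) hv (by simp [ho])

/-- Two indecomposable lower parts of a wiring are equal or disjoint. -/
theorem Iso.isLeft_or_isRight {a : A ⊕ R ≃ A' ⊕ R'} {b : Y ≃ Y'} {G : Wiring (B ⊕ R) Y}
    {C : Wiring A B} {G' : Wiring (B' ⊕ R') Y'} {C' : Wiring A' B'}
    (f : Iso a b (G.comp C) (G'.comp C')) (hC : C.Indec) (hC' : C'.Indec) :
    (∀ v : C.V ⊕ G.V, Sum.isLeft (f.fV v : C'.V ⊕ G'.V) = v.isLeft) ∨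
      ∀ v : C.V, Sum.isLeft (f.fV (.inl v) : C'.V ⊕ G'.V) = false := by
  -- The vertices of `C` sent into `C'` form a lower set of `C`. By indecomposability it is empty or
  -- everything; in the latter case the same argument for the inverse shows that `C'` is sent back
  -- into `C`.
  rcases (Sum.inl ⁻¹' (f.fV ⁻¹' {v : C'.V ⊕ G'.V | v.isLeft}) : Set C.V).eq_empty_or_nonempty with
    h | h
  · exact .inr fun v => by simpa using Set.eq_empty_iff_forall_notMem.1 h v
  · left
    have h1 := hC.eq_univ _ (IsLower.left (f.isLower (isLower_comp_isLeft G' C'))) h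
    have h2 := hC'.eq_univ _ (IsLower.left (f.symm.isLower (isLower_comp_isLeft G C))) (by
      obtain ⟨v, hv⟩ := h
      obtain ⟨w, hw⟩ := Sum.isLeft_iff.1 hv
      refine ⟨w, ?_⟩
      change Sum.isLeft (f.fV.symm (.inl w) : C.V ⊕ G.V) = true
      rw [← hw]
      simp)
    rintro (v | v)
    · exact Set.eq_univ_iff_forall.1 h1 v
    · rcases e : (f.fV (.inr v) : C'.V ⊕ G'.V) with w | w
      · have := Set.eq_univ_iff_forall.1 h2 w
        change Sum.isLeft (f.fV.symm (.inl w) : C.V ⊕ G.V) = true at this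
        rw [← e] at this
        simp at this
      · rfl

/-- Two splittings along disjoint indecomposable lower parts have a common refinement. -/
theorem Iso.exists_exchange {a : A ⊕ R ≃ A' ⊕ R'} {b : Y ≃ Y'} {G : Wiring (B ⊕ R) Y}
    {C : Wiring A B} {G' : Wiring (B' ⊕ R') Y'} {C' : Wiring A' B'} [Finite B] [Finite R]
    (f : Iso a b (G.comp C) (G'.comp C')) (hC : C.NoThrough) (hC' : C'.NoThrough)
    (hf : ∀ v : C.V, Sum.isLeft (f.fV (.inl v) : C'.V ⊕ G'.V) = false) :
    ∃ (A₂ B₂ R₀ : Type) (_ : Finite A₂) (_ : Finite B₂) (_ : Finite R₀)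
      (H : Wiring (B₂ ⊕ (B ⊕ R₀)) Y) (D : Wiring A₂ B₂) (r : R ≃ A₂ ⊕ R₀) (α : A₂ ≃ A')
      (β : B₂ ≃ B') (ρ : A ⊕ R₀ ≃ R'),
      a = (Equiv.sumCongr (.refl _) r).trans ((sumLeftComm _ _ _).trans (.sumCongr α ρ)) ∧
      Nonempty (Iso ((Equiv.sumCongr (.refl _) r).trans (sumLeftComm _ _ _)) (.refl _) G
        (H.comp D)) ∧
      Nonempty (Iso α β D C') ∧
      Nonempty (Iso (.sumCongr β ρ) b
        (((H.relabel (sumLeftComm _ _ _) (.refl _)).comp C).relabel (sumLeftComm _ _ _) (.refl _))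
        G') := by
  classical
  have hT := f.isLower (isLower_comp_isLeft G' C')
  -- `S` is the copy of `C'` inside `G`: disjointness puts every vertex of `C'` in the upper part of
  -- the first splitting.
  obtain ⟨S, hSv⟩ : ∃ S : Set G.V, ∀ v, v ∈ S ↔ (f.fV (.inr v) : C'.V ⊕ G'.V).isLeft :=
    ⟨{v | (f.fV (.inr v) : C'.V ⊕ G'.V).isLeft}, fun _ => Iff.rfl⟩
  have hS : G.IsLower S := fun o v hv ho => (hSv _).2 (hT.right o v ((hSv _).1 hv) ho)
  -- A strand from `C` into `S` would make a vertex of `C` a predecessor of a vertex of `C'`. Since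
  -- `C'` is lower, that vertex would belong to `C'`, against disjointness.
  have hb : ∀ y, ((Equiv.sumCompl fun x => Hits S (G.tgt (.inl x))).symm (.inl y)).isRight := by
    intro y
    by_cases h : Hits S (G.tgt (.inl (.inl y)))
    · obtain ⟨o, ho⟩ := hC.exists_src y
      have h1 := hT (.inl o) (.inr (Hits.vertex _ h).1) ((hSv _).1 (Hits.vertex _ h).2) (by
        simp only [ho, Sum.map_inl, Sum.elim_inl]
        exact congrArg (Sum.map id Sum.inr) (Hits.inr_vertex _ h))
      exact absurd h1 (by simpa using hf (C.src o))
    · exact congrArg Sum.isRight (Equiv.sumCompl_symm_apply_of_neg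
        (p := fun x => Hits S (G.tgt (.inl x))) h)
  obtain ⟨R₀, r, s, hrs⟩ := Equiv.exists_sum_refinement _ hb
  obtain ⟨k, hk⟩ : ∃ k : Iso ((Equiv.sumCongr (.refl _) r).trans (sumLeftComm _ _ _)) (.refl _) G
      (((high hS).relabel (.sumCongr (.refl _) s) (.refl _)).comp (G.low S)),
      ∀ v, Sum.isLeft (k.fV v : S ⊕ {v // v ∉ S}) ↔ v ∈ S := by
    refine ⟨((isoSplit hS).trans ((isoRelabel (.sumCongr (.refl _) s) (.refl _) (high hS)).comp
      (Iso.refl (G.low S)))).cast hrs rfl, fun v => ?_⟩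
    rw [← isoSplit_isLeft hS]
    change Sum.isLeft (Sum.map id id ((isoSplit hS).fV v)) = true ↔ _
    rw [Sum.map_id_id]
    rfl
  generalize hH : (high hS).relabel (.sumCongr (.refl _) s) (.refl _) = H at k hk
  have : Finite R₀ := Finite.of_injective (fun x => r.symm (.inr x))
    (r.symm.injective.comp Sum.inr_injective)
  -- `G` is replaced by its splitting along `S`, and `m` then swaps the two lower parts. The result
  -- has `S` at the bottom, as does the second splitting, so `comp_split` compares the two.
  let l := ((k.trans (isoRelabel (sumLeftComm _ _ _) (.refl _) _)).cast
    (a₁ := .sumCongr (.refl B) r) (by ext (x | x) <;> simp [sumLeftComm]) rfl).comp (Iso.refl C)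
  let m := l.trans (isoCompSwap H (G.low S) C)
  have hm : ∀ v : C.V ⊕ G.V, Sum.isLeft (m.fV v : S ⊕ (C.V ⊕ H.V)) =
      (f.fV v : C'.V ⊕ G'.V).isLeft := by
    rintro (v | v)
    · exact (hf v).symm
    · rw [Bool.eq_iff_iff, ← hSv, ← hk]
      change Sum.isLeft (sumLeftComm C.V S H.V (.inr (k.fV v))) = true ↔ _
      rcases (k.fV v : S ⊕ H.V) with w | w <;> simp [sumLeftComm]
  obtain ⟨α, β, ρ, ha, h₁, h₂⟩ := comp_split (m.symm.trans f) low_noThrough hC' (by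
    intro v
    obtain ⟨v, rfl⟩ := m.fV.surjective v
    rw [hm]
    change Sum.isLeft (f.fV (m.fV.symm (m.fV v))) = _
    rw [m.fV.symm_apply_apply])
  refine ⟨_, _, R₀, inferInstance, inferInstance, inferInstance, H, G.low S, r, α, β, ρ, ?_,
    ⟨k⟩, h₁, ?_⟩
  · rw [← ha]
    ext x
    simp
  · exact h₂

end Wiring

namespace Wiring
variable {X Y Z X' Y' Z' X'' Y'' A B R A' B' R' : Type}

/-! ### Evaluation of wirings in a ProP -/

open ProP ProP.At

/-- Elements of a ProP attached to the indecomposable wirings, compatible with isomorphisms. -/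
structure Weight {𝕜 : Type u} [Field 𝕜] (P : ProP.{u, v} 𝕜) where
  toFun : ∀ {A B : Type} [Finite A] [Finite B], Wiring A B → P.At A B
  map_iso : ∀ {A B A' B' : Type} [Finite A] [Finite B] [Finite A'] [Finite B'] {a : A ≃ A'}
    {b : B ≃ B'} {C : Wiring A B} {C' : Wiring A' B'}, Iso a b C C' → toFun C' = rl a b (toFun C)

variable {𝕜 : Type u} [Field 𝕜] {P : ProP.{u, v} 𝕜}

/-- `Val φ G p`: the element `p` is a composite of the weights of indecomposable wirings according
to a decomposition of `G`. -/
inductive Val (φ : Weight P) : ∀ {X Y : Type} [Finite X] [Finite Y],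
    Wiring X Y → P.At X Y → Prop
  | perm {X Y : Type} [Finite X] [Finite Y] {G : Wiring X Y} {p : P.At X Y} (hV : IsEmpty G.V)
      (e : X ≃ Y) (he : ∀ x, G.tgt (.inl x) = .inl (e x)) (hp : p = rl (.refl X) e (one P X)) :
      Val φ G p
  | step {X Y A B R Y' : Type} [Finite X] [Finite Y] [Finite A] [Finite B] [Finite R] [Finite Y']
      {G : Wiring X Y} {p : P.At X Y} {G' : Wiring (B ⊕ R) Y'} {C : Wiring A B} {a : X ≃ A ⊕ R}
      {b : Y ≃ Y'} (f : Iso a b G (G'.comp C)) (hC : C.Indec) {q : P.At (B ⊕ R) Y'}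
      (hq : Val φ G' q) (hp : rl a b p = st q (φ.toFun C)) : Val φ G p

variable [Finite X] [Finite Y] [Finite Z] [Finite X'] [Finite Y'] [Finite A] [Finite B] [Finite R]
  {φ : Weight P}

/-- Both constructors allow an arbitrary isomorphism or relabelling, so a case distinction suffices:
the last step is transported and the decomposition beneath it is kept. -/
theorem Val.iso {a : X ≃ X'} {b : Y ≃ Y'} {G : Wiring X Y} {G' : Wiring X' Y'} {p : P.At X Y}
    (h : Val φ G p) (f : Iso a b G G') : Val φ G' (rl a b p) := by
  cases h with
  | perm hV e he hp =>
    refine .perm f.fV.symm.isEmpty (a.symm.trans (e.trans b)) (fun x => ?_) ?_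
    · obtain ⟨x, rfl⟩ := a.surjective x
      simp [f.tgt_inl, he]
    · rw [hp, rl_rl, ← rl_one a.symm, rl_rl]
      congr 1
      ext; simp
  | step g hC hq hp =>
    refine .step (f.symm.trans g) hC hq ?_
    rw [← hp, rl_rl]
    congr 1 <;> ext <;> simp

theorem Val.of_iso_comp {Y' : Type} [Finite Y'] {G : Wiring X Y} {G' : Wiring (B ⊕ R) Y'}
    {C : Wiring A B} {a : X ≃ A ⊕ R} {b : Y ≃ Y'} (f : Iso a b G (G'.comp C)) (hC : C.Indec)
    {q : P.At (B ⊕ R) Y'} (hq : Val φ G' q) :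
    Val φ G (rl a.symm b.symm (st q (φ.toFun C))) :=
  .step f hC hq (by simp [rl_rl, rl_refl])

omit [Finite X] [Finite Y] [Finite A] [Finite B] [Finite R] [Finite Y'] in
theorem Iso.card_lt {G : Wiring X Y} {C : Wiring A B} {G' : Wiring (B ⊕ R) Y'} {a : X ≃ A ⊕ R}
    {b : Y ≃ Y'} (f : Iso a b G (G'.comp C)) (hC : Nonempty C.V) :
    Nat.card G'.V < Nat.card G.V := by
  have h : Nat.card G.V = Nat.card (C.V ⊕ G'.V) := Nat.card_congr f.fV
  rw [h, Nat.card_sum]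
  have : 0 < Nat.card C.V := Nat.card_pos
  omega

-- Every half-edge has a source, so a wiring without vertices has none, and its target map matches
-- inputs with outputs.
omit [Finite X] [Finite Y] in
theorem exists_equiv_of_isEmpty (G : Wiring X Y) [IsEmpty G.V] :
    ∃ e : X ≃ Y, ∀ x, G.tgt (.inl x) = .inl (e x) := by
  have h : ∀ x, ∃ y, G.tgt (.inl x) = .inl y := by
    intro x
    rcases G.tgt (.inl x) with y | v
    · exact ⟨y, rfl⟩
    · exact isEmptyElim v
  choose e he using h
  refine ⟨.ofBijective e ⟨fun x x' hx => ?_, fun y => ?_⟩, he⟩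
  · exact Sum.inl_injective ((G.existsUnique_tgt (e x)).unique (he x) ((he x').trans (by rw [hx])))
  · obtain ⟨x | o, hs, -⟩ := G.existsUnique_tgt y
    · exact ⟨x, Sum.inl_injective ((he x).symm.trans hs)⟩
    · exact isEmptyElim (G.src o)

/-- Peel off a minimal nonempty lower set and recurse on what remains, which has fewer vertices. -/
theorem Val.exists (φ : Weight P) (G : Wiring X Y) : ∃ p, Val φ G p := by
  induction h : Nat.card G.V using Nat.strong_induction_on generalizing X Y with
  | _ n ih =>
  rcases isEmpty_or_nonempty G.V with hV | hV
  · obtain ⟨e, he⟩ := G.exists_equiv_of_isEmpty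
    exact ⟨_, .perm hV e he rfl⟩
  · obtain ⟨S, hS, hI⟩ := G.exists_isLower_minimal
    obtain ⟨q, hq⟩ := ih _ (h ▸ (isoSplit hS).card_lt hI.nonempty) (high hS) rfl
    exact ⟨_, .of_iso_comp (isoSplit hS) hI hq⟩

/-- Components are detached at the inputs, that is, from `K`: by associativity, peeling `C` off `K`
also peels it off `H ∘ K`. When `K` has no vertices left, the composite is `H` with renamed inputs.
-/
theorem Val.vcomp {K : Wiring X Y} {p : P.At X Y} (hK : Val φ K p) {H : Wiring Y Z} {q : P.At Y Z}
    (hH : Val φ H q) : Val φ (H.vcomp K) (vc q p) := by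
  induction hK with
  | @perm X Y _ _ K p hV e he hp =>
    have f : Iso e.symm (.refl _) H (H.vcomp K) := by
      have hH' : IsEmpty K.H := ⟨fun o => isEmptyElim (K.src o)⟩
      refine .ofFun (Equiv.emptySum _ _).symm (Equiv.emptySum _ _).symm .inr .inr
        (fun _ => rfl) (fun _ => rfl) (fun _ => rfl) (fun _ => rfl) (fun x => ?_) (fun o => ?_)
      · simp [he]
      · simp
    have h1 : vc q (rl (.refl _) e (one P X)) = rl e.symm (.refl _) q := by
      have h2 := vc_rl e.symm (.refl _) (.refl _) q (one P Y)
      rw [rl_refl, vc_one, ← rl_one e, rl_rl] at h2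
      simpa using h2
    rw [hp, h1]
    exact hH.iso f
  | @step X Y A B R Y' _ _ _ _ _ _ K p G' C a b f hC q' hq hp ih =>
    refine .step (((isoRelabel b (.refl _) H).vcomp f).trans (isoVcompAssoc _ _ _)) hC
      (ih (hH.iso (isoRelabel b (.refl _) H))) ?_
    rw [← vc_st, ← hp, vc_rl]
    rfl

/-- Padding commutes with each peeling step, by `isoAddIdComp` for wirings and `st_hc_one` in `P`.
Padding by identities is all that the general horizontal product will need. -/
theorem Val.addId {G : Wiring X Y} {p : P.At X Y} (hG : Val φ G p) (R : Type) [Finite R] :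
    Val φ (G.addId R) (hc p (one P R)) := by
  induction hG with
  | @perm X Y _ _ G p hV e he hp =>
    refine .perm hV (.sumCongr e (.refl _)) ?_ ?_
    · rintro (x | x)
      · simp [he]
      · simp
    · have := hc_rl (.refl X) e (.refl R) (.refl R) (one P X) (one P R)
      rw [rl_refl] at this
      rw [hp, this, hc_one]
      simp
  | @step X Y A B R' Y' _ _ _ _ _ _ G p G' C a b f hC q hq hp ih =>
    refine .step ((f.addId (.refl R)).trans (isoAddIdComp R G' C)) hC
      (ih.iso (isoRelabel (.sumAssoc _ _ _) (.refl _) _)) ?_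
    have h1 := hc_rl a b (.refl R) (.refl R) p (one P R)
    rw [rl_refl, hp, st_hc_one] at h1
    rw [← rl_rl, ← h1, rl_rl]
    simp [rl_refl]

/-- A confluence argument by induction on the number of vertices. Two decompositions whose first
components `C` and `C'` agree differ only in the remainder, where induction applies. If the
components are disjoint, both decompositions are compared with ones that peel the two components in
either order down to a common remainder. -/
theorem Val.unique {G : Wiring X Y} {p p' : P.At X Y} (h : Val φ G p) (h' : Val φ G p') :
    p = p' := by
  induction hn : Nat.card G.V using Nat.strong_induction_on generalizing X Y with
  | _ n ih =>
  cases h with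
  | perm hV e he hp =>
    cases h' with
    | perm hV' e' he' hp' =>
      have : e = e' := Equiv.ext fun x => Sum.inl_injective ((he x).symm.trans (he' x))
      rw [hp, hp', this]
    | step f hC hq hp =>
      exact hV.elim (f.fV.symm (.inl hC.nonempty.some))
  | @step _ _ A B R Y₁ _ _ _ _ _ _ _ _ K C a b f hC q hq hp =>
    cases h' with
    | perm hV' e' he' hp' =>
      exact hV'.elim (f.fV.symm (.inl hC.nonempty.some))
    | @step _ _ A' B' R' Y₁' _ _ _ _ _ _ _ _ K' C' a' b' f' hC' q' hq' hp' =>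
      have g := f.symm.trans f'
      have hlt := f.card_lt hC.nonempty
      have hlt' := f'.card_lt hC'.nonempty
      rw [hn] at hlt hlt'
      apply rl_injective a' b'
      have hg : rl a' b' p = rl (a.symm.trans a') (b.symm.trans b') (st q (φ.toFun C)) := by
        rw [← hp, rl_rl]
        congr 1 <;> ext <;> simp
      rw [hg, hp']
      generalize a.symm.trans a' = c at g
      generalize b.symm.trans b' = d at g
      rcases g.isLeft_or_isRight hC hC' with h | h
      · obtain ⟨α, β, ρ, rfl, ⟨f₁⟩, ⟨f₂⟩⟩ := comp_split g hC.noThrough hC'.noThrough h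
        rw [← ih _ hlt' (hq.iso f₂) hq' rfl, φ.map_iso f₁, st_rl]
      · obtain ⟨A₂, B₂, R₀, _, _, _, H, D, r, α, β, ρ, rfl, ⟨f₁⟩, ⟨f₂⟩, ⟨f₃⟩⟩ :=
          g.exists_exchange hC.noThrough hC'.noThrough h
        -- A value `t` of the common remainder `H` is fixed. By induction `q` is `t` composed with
        -- the weight of `D`, the copy of `C'`, while `q'` is `t` composed with the weight of `C`.
        -- The identity `st_swap` then makes the two totals agree.
        obtain ⟨t, ht⟩ := Val.exists φ H
        have h1 := ih _ hlt hq (.of_iso_comp f₁ (f₂.symm.indec hC') ht) rfl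
        have h2 := Val.of_iso_comp (φ := φ) (Iso.refl _) hC
          (ht.iso (isoRelabel (sumLeftComm _ _ _) (.refl _) H))
        have h3 := ih _ hlt' hq' ((h2.iso (isoRelabel (sumLeftComm _ _ _) (.refl _) _)).iso f₃) rfl
        have h4 := st_swap (rl (sumLeftComm _ _ _) (.refl _) t) (φ.toFun C) (φ.toFun D)
        rw [rl_rl] at h4
        have h5 := st_rl (.refl _) (.refl _) r.symm (.refl _)
          (rl (sumLeftComm _ _ _) (.refl _) (st t (φ.toFun D))) (φ.toFun C)
        have h6 : ∀ A B : Type, (sumLeftComm A B R₀).trans (sumLeftComm B A R₀) = .refl _ := by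
          intro A B
          ext (x | x | x) <;> rfl
        rw [h6, Equiv.refl_trans, rl_refl] at h4
        rw [rl_refl, ← h4, rl_rl, rl_rl] at h5
        have h7 : q = rl (Equiv.sumCongr (.refl _) r.symm) (.refl _)
            (rl (sumLeftComm _ _ _) (.refl _) (st t (φ.toFun D))) := by
          rw [h1, rl_rl]
          rfl
        rw [rl_rl] at h7
        rw [h7, h5, h3, φ.map_iso f₂, st_rl, rl_rl]
        simp only [Equiv.refl_symm, rl_refl, Equiv.refl_trans]
        congr 1
        ext (x | x | x) <;> simp [sumLeftComm]

end Wiring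

namespace OGraph

variable {k l m k' l' : ℕ}

/-! ## Graphs as wirings -/

/-- The target of an input of a graph. -/
def inTgt (G : OGraph k l) : G.I ⊕ G.T → Fin l ⊕ (G.V ⊕ G.L)
  | .inl e => .inr (.inl (G.tgt (.inr e)))
  | .inr e => .inl (G.outIdx (.inr e))

/-- The wiring of a graph. Its vertices are the vertices and the loops of the graph. -/
noncomputable abbrev toWiring (G : OGraph k l) : Wiring (Fin k) (Fin l) where
  V := G.V ⊕ G.L
  H := G.E ⊕ G.O
  col := Sum.elim (fun _ => false) (fun _ => true)
  src o := .inl (G.src o)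
  tgt
    | .inl i => G.inTgt ((Equiv.ofBijective _ G.inIdx_bij).symm i)
    | .inr (.inl e) => .inr (.inl (G.tgt (.inl e)))
    | .inr (.inr o) => .inl (G.outIdx (.inl o))
  existsUnique_tgt j := by
    obtain ⟨o | t, rfl⟩ := G.outIdx_bij.2 j
    · refine ⟨.inr (.inr o), rfl, ?_⟩
      rintro (i | e | o') h
      · rcases e : (Equiv.ofBijective _ G.inIdx_bij).symm i with e' | t <;>
          simp only [e, inTgt, Sum.inl.injEq, reduceCtorEq] at h
        cases G.outIdx_bij.1 h
      · cases h
      · cases G.outIdx_bij.1 (Sum.inl_injective h)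
        rfl
    · refine ⟨.inl (G.inIdx (.inr t)), ?_, ?_⟩
      · simp only [Equiv.ofBijective_symm_apply_apply, inTgt]
      · rintro (i | e | o') h
        · rcases e : (Equiv.ofBijective _ G.inIdx_bij).symm i with e' | t' <;>
            simp only [e, inTgt, Sum.inl.injEq, reduceCtorEq] at h
          cases G.outIdx_bij.1 h
          rw [Equiv.symm_apply_eq] at e
          rw [e]
          rfl
        · cases h
        · cases G.outIdx_bij.1 (Sum.inl_injective h)

theorem toWiring_tgt_I (G : OGraph k l) (e : G.I) :
    G.toWiring.tgt (.inl (G.inIdx (.inl e))) = .inr (.inl (G.tgt (.inr e))) := by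
  simp only [Equiv.ofBijective_symm_apply_apply, inTgt]

theorem toWiring_tgt_T (G : OGraph k l) (e : G.T) :
    G.toWiring.tgt (.inl (G.inIdx (.inr e))) = .inl (G.outIdx (.inr e)) := by
  simp only [Equiv.ofBijective_symm_apply_apply, inTgt]

/-- An isomorphism between a wiring and the wiring of a graph. -/
noncomputable def wiringIsoOf {X Y : Type} {a : Fin k ≃ X} {b : Fin l ≃ Y} (G : OGraph k l)
    (W : Wiring X Y) (fV : G.V ⊕ G.L ≃ W.V) (fH : G.E ⊕ G.O ≃ W.H)
    (gV : G.V → W.V) (gL : G.L → W.V) (gE : G.E → W.H) (gO : G.O → W.H)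
    (hV : ∀ v, fV (.inl v) = gV v) (hL : ∀ v, fV (.inr v) = gL v)
    (hE : ∀ v, fH (.inl v) = gE v) (hO : ∀ v, fH (.inr v) = gO v)
    (hcV : ∀ v, W.col (gV v) = false) (hcL : ∀ v, W.col (gL v) = true)
    (hsE : ∀ e, W.src (gE e) = gV (G.src (.inl e)))
    (hsO : ∀ e, W.src (gO e) = gV (G.src (.inr e)))
    (htE : ∀ e, W.tgt (.inr (gE e)) = .inr (gV (G.tgt (.inl e))))
    (htO : ∀ e, W.tgt (.inr (gO e)) = .inl (b (G.outIdx (.inl e))))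
    (htI : ∀ e, W.tgt (.inl (a (G.inIdx (.inl e)))) = .inr (gV (G.tgt (.inr e))))
    (htT : ∀ e, W.tgt (.inl (a (G.inIdx (.inr e)))) = .inl (b (G.outIdx (.inr e)))) :
    Wiring.Iso a b G.toWiring W := by
  refine .ofFun fV fH (Sum.elim gV gL) (Sum.elim gE gO) ?_ ?_ ?_ ?_ (fun x => ?_) ?_
  · rintro (v | v)
    exacts [hV v, hL v]
  · rintro (v | v)
    exacts [hE v, hO v]
  · rintro (v | v)
    exacts [hcV v, hcL v]
  · rintro (v | v)
    exacts [hsE v, hsO v]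
  · obtain ⟨e | e, rfl⟩ := G.inIdx_bij.2 x
    · rw [htI, toWiring_tgt_I]
      rfl
    · rw [htT, toWiring_tgt_T]
      rfl
  · rintro (e | e)
    exacts [htE e, htO e]

/-- Isomorphic graphs have isomorphic wirings. -/
noncomputable def Iso.toWiring {G G' : OGraph k l} (f : Iso G G') :
    Wiring.Iso (.refl _) (.refl _) G.toWiring G'.toWiring := by
  refine wiringIsoOf G G'.toWiring (.sumCongr f.fV f.fL) (.sumCongr f.fE f.fO) (.inl ∘ f.fV)
    (.inr ∘ f.fL) (.inl ∘ f.fE) (.inr ∘ f.fO) (fun _ => rfl) (fun _ => rfl) (fun _ => rfl)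
    (fun _ => rfl) (fun _ => rfl) (fun _ => rfl) (fun e => congrArg Sum.inl (f.src_E e))
    (fun e => congrArg Sum.inl (f.src_O e)) (fun e => congrArg (Sum.inr ∘ Sum.inl) (f.tgt_E e))
    (fun e => congrArg Sum.inl (f.out_O e)) (fun e => ?_) (fun e => ?_)
  · have := G'.toWiring_tgt_I (f.fI e)
    rw [f.in_I, f.tgt_I] at this
    exact this
  · have := G'.toWiring_tgt_T (f.fT e)
    rw [f.in_T, f.out_T] at this
    exact this

/-- The wiring of a relabelled graph. -/
noncomputable def isoToWiringRelabel (a : Fin k ≃ Fin k') (b : Fin l ≃ Fin l') (G : OGraph k l) :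
    Wiring.Iso a b G.toWiring (G.relabel a b).toWiring := by
  refine wiringIsoOf G _ (.refl _) (.refl _) .inl .inr .inl .inr (fun _ => rfl) (fun _ => rfl)
    (fun _ => rfl) (fun _ => rfl) (fun _ => rfl) (fun _ => rfl) (fun _ => rfl) (fun _ => rfl)
    (fun _ => rfl) (fun _ => rfl) (fun e => ?_) (fun e => ?_)
  · exact (G.relabel a b).toWiring_tgt_I e
  · exact (G.relabel a b).toWiring_tgt_T e

/-- The wiring of a horizontal composition with an identity. -/
noncomputable def isoToWiringHcompIdn (G : OGraph k l) (n : ℕ) :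
    Wiring.Iso finSumFinEquiv.symm finSumFinEquiv.symm (G.hcomp (idn n)).toWiring
      (G.toWiring.addId (Fin n)) := by
  refine wiringIsoOf _ _ (.sumCongr (.sumEmpty G.V Empty) (.sumEmpty G.L Empty))
    (.sumCongr (.sumEmpty G.E Empty) (.sumEmpty G.O Empty))
    (Sum.elim .inl Empty.elim) (Sum.elim .inr Empty.elim) (Sum.elim .inl Empty.elim)
    (Sum.elim .inr Empty.elim) ?_ ?_ ?_ ?_ ?_ ?_ ?_ ?_ ?_ ?_ ?_ ?_
  · rintro (v | ⟨⟨⟩⟩); rfl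
  · rintro (v | ⟨⟨⟩⟩); rfl
  · rintro (v | ⟨⟨⟩⟩); rfl
  · rintro (v | ⟨⟨⟩⟩); rfl
  · rintro (v | ⟨⟨⟩⟩); rfl
  · rintro (v | ⟨⟨⟩⟩); rfl
  · rintro (v | ⟨⟨⟩⟩); rfl
  · rintro (v | ⟨⟨⟩⟩); rfl
  · rintro (v | ⟨⟨⟩⟩); rfl
  · rintro (v | ⟨⟨⟩⟩)
    exact congrArg Sum.inl (finSumFinEquiv.symm_apply_apply _).symm
  · rintro (v | ⟨⟨⟩⟩)
    have h : finSumFinEquiv.symm ((G.hcomp (idn n)).inIdx (.inl (.inl v))) =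
      .inl (G.inIdx (.inl v)) := finSumFinEquiv.symm_apply_apply _
    rw [h]
    exact congrArg (Sum.map Sum.inl id) (G.toWiring_tgt_I v)
  · rintro (v | v)
    · have h : finSumFinEquiv.symm ((G.hcomp (idn n)).inIdx (.inr (.inl v))) =
        .inl (G.inIdx (.inr v)) := finSumFinEquiv.symm_apply_apply _
      have h' : finSumFinEquiv.symm ((G.hcomp (idn n)).outIdx (.inr (.inl v))) =
        .inl (G.outIdx (.inr v)) := finSumFinEquiv.symm_apply_apply _
      rw [h, h']
      exact congrArg (Sum.map Sum.inl id) (G.toWiring_tgt_T v)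
    · have h : finSumFinEquiv.symm ((G.hcomp (idn n)).inIdx (.inr (.inr v))) =
        .inr v := finSumFinEquiv.symm_apply_apply _
      have h' : finSumFinEquiv.symm ((G.hcomp (idn n)).outIdx (.inr (.inr v))) =
        .inr v := finSumFinEquiv.symm_apply_apply _
      rw [h, h']

/-- The half-edges of a vertical composition. -/
noncomputable def vcompHalfEdges (H : OGraph l m) (K : OGraph k l) :
    (H.vcomp K).E ⊕ (H.vcomp K).O ≃ (K.E ⊕ K.O) ⊕ (H.E ⊕ H.O) := by
  refine .ofBijective (Sum.elim
    (Sum.elim (fun e => .inl (.inl e)) (Sum.elim (fun e => .inr (.inl e))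
      (fun p => .inl (.inr p.1.1))))
    (Sum.elim (fun e => .inr (.inr e)) (fun p => .inl (.inr p.1.1)))) ⟨?_, ?_⟩
  · rintro ((e | e | ⟨⟨f, e⟩, h⟩) | e | ⟨⟨f, e⟩, h⟩) ((e' | e' | ⟨⟨f', e'⟩, h'⟩) | e' | ⟨⟨f', e'⟩, h'⟩)
      hh
    all_goals first
      | cases hh; rfl
      | (cases hh; done)
      | (obtain rfl : f = f' := Sum.inr_injective (Sum.inl_injective hh)
         cases H.inIdx_bij.1 (h.symm.trans h')
         try rfl)
  · rintro ((e | o) | (e | o))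
    · exact ⟨.inl (.inl e), rfl⟩
    · obtain ⟨e | e, he⟩ := H.inIdx_bij.2 (K.outIdx (.inl o))
      · exact ⟨.inl (.inr (.inr ⟨(o, e), he.symm⟩)), rfl⟩
      · exact ⟨.inr (.inr ⟨(o, e), he.symm⟩), rfl⟩
    · exact ⟨.inl (.inr (.inl e)), rfl⟩
    · exact ⟨.inr (.inl o), rfl⟩

/-- The wiring of a vertical composition. -/
noncomputable def isoToWiringVcomp (H : OGraph l m) (K : OGraph k l) :
    Wiring.Iso (.refl _) (.refl _) (H.vcomp K).toWiring (H.toWiring.vcomp K.toWiring) := by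
  have hI := H.toWiring_tgt_I
  have hT := H.toWiring_tgt_T
  have kI := K.toWiring_tgt_I
  have kT := K.toWiring_tgt_T
  refine wiringIsoOf _ _ (.sumSumSumComm _ _ _ _) (vcompHalfEdges H K)
    (Sum.map .inl .inl) (Sum.map .inr .inr)
    (Sum.elim (fun e => .inl (.inl e)) (Sum.elim (fun e => .inr (.inl e))
      (fun p => .inl (.inr p.1.1))))
    (Sum.elim (fun e => .inr (.inr e)) (fun p => .inl (.inr p.1.1)))
    ?_ ?_ ?_ ?_ ?_ ?_ ?_ ?_ ?_ ?_ ?_ ?_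
  · rintro (v | v) <;> rfl
  · rintro (v | v) <;> rfl
  · rintro (v | v | v) <;> rfl
  · rintro (v | v) <;> rfl
  · rintro (v | v) <;> rfl
  · rintro (v | v) <;> rfl
  · rintro (v | v | v) <;> rfl
  · rintro (v | v) <;> rfl
  · rintro (e | e | ⟨⟨f, e⟩, h⟩)
    · rfl
    · rfl
    · exact congrArg (Sum.map id Sum.inr) ((congrArg (H.toWiring.tgt ∘ Sum.inl) h).trans (hI e))
  · rintro (e | ⟨⟨f, e⟩, h⟩)
    · rfl
    · exact congrArg (Sum.map id Sum.inr) ((congrArg (H.toWiring.tgt ∘ Sum.inl) h).trans (hT e))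
  · rintro (e | ⟨⟨f, e⟩, h⟩)
    · exact congrArg (Sum.elim _ _) (kI e)
    · exact (congrArg (Sum.elim _ _) (kT f)).trans
        (congrArg (Sum.map id Sum.inr) ((congrArg (H.toWiring.tgt ∘ Sum.inl) h).trans (hI e)))
  · rintro ⟨⟨f, e⟩, h⟩
    exact (congrArg (Sum.elim _ _) (kT f)).trans
        (congrArg (Sum.map id Sum.inr) ((congrArg (H.toWiring.tgt ∘ Sum.inl) h).trans (hT e)))

/-- Graphs with isomorphic wirings are isomorphic. -/
theorem nonempty_iso_of_toWiring {G G' : OGraph k l}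
    (f : Wiring.Iso (.refl _) (.refl _) G.toWiring G'.toWiring) : Nonempty (Iso G G') := by
  obtain ⟨fV, fH, hcol, hsrc, hinl, hinr⟩ := f
  -- The colour separates vertices from loops. In the same way, the side of the target separates
  -- internal edges from output edges, and input edges from input-output edges.
  obtain ⟨v, v', hv⟩ := Equiv.exists_eq_sumCongr (A := G.V) (R := G.L) (A' := G'.V) (R' := G'.L)
    fV (by
      rintro (x | x)
      · have := hcol (.inl x)
        rcases e : (fV (.inl x) : G'.V ⊕ G'.L) with y | y
        · rfl
        · rw [e] at this; cases this
      · have := hcol (.inr x)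
        rcases e : (fV (.inr x) : G'.V ⊕ G'.L) with y | y
        · rw [e] at this; cases this
        · rfl)
  subst hv
  obtain ⟨h, h', hh⟩ := Equiv.exists_eq_sumCongr (A := G.E) (R := G.O) (A' := G'.E) (R' := G'.O)
    fH (by
      rintro (x | x)
      · have := hinr (.inl x)
        rcases e : (fH (.inl x) : G'.E ⊕ G'.O) with y | y
        · rfl
        · rw [e] at this; cases this
      · have := hinr (.inr x)
        rcases e : (fH (.inr x) : G'.E ⊕ G'.O) with y | y
        · rw [e] at this; cases this
        · rfl)
  subst hh
  have hinl : ∀ x, G'.toWiring.tgt (.inl x) = Sum.map id (Sum.map v v') (G.toWiring.tgt (.inl x)) :=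
    hinl
  have ht : ∀ x, G'.inIdx (((Equiv.ofBijective _ G.inIdx_bij).trans
      (Equiv.ofBijective _ G'.inIdx_bij).symm) x) = G.inIdx x := fun x =>
    Equiv.ofBijective_apply_symm_apply _ G'.inIdx_bij _
  obtain ⟨i, t, hit⟩ := Equiv.exists_eq_sumCongr
    ((Equiv.ofBijective _ G.inIdx_bij).trans (Equiv.ofBijective _ G'.inIdx_bij).symm) (by
      rintro (x | x)
      · have h1 := hinl (G.inIdx (.inl x))
        have h2 := ht (.inl x)
        rcases e : ((Equiv.ofBijective _ G.inIdx_bij).trans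
          (Equiv.ofBijective _ G'.inIdx_bij).symm) (.inl x) with y | y
        · rfl
        · rw [toWiring_tgt_I, ← h2, e, toWiring_tgt_T] at h1
          cases h1
      · have h1 := hinl (G.inIdx (.inr x))
        have h2 := ht (.inr x)
        rcases e : ((Equiv.ofBijective _ G.inIdx_bij).trans
          (Equiv.ofBijective _ G'.inIdx_bij).symm) (.inr x) with y | y
        · rw [toWiring_tgt_T, ← h2, e, toWiring_tgt_I] at h1
          cases h1
        · rfl)
  rw [hit] at ht
  have hI : ∀ x, G'.inIdx (.inl (i x)) = G.inIdx (.inl x) := fun x => ht (.inl x)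
  have hT : ∀ x, G'.inIdx (.inr (t x)) = G.inIdx (.inr x) := fun x => ht (.inr x)
  refine ⟨⟨v, h, i, h', t, v', fun e => Sum.inl_injective (hsrc (.inl e)),
    fun e => Sum.inl_injective (hsrc (.inr e)),
    fun e => Sum.inl_injective (Sum.inr_injective (hinr (.inl e))), fun e => ?_, hI, hT,
    fun e => Sum.inl_injective (hinr (.inr e)), fun e => ?_⟩⟩
  · have := hinl (G.inIdx (.inl e))
    rw [toWiring_tgt_I, ← hI, toWiring_tgt_I] at this
    exact Sum.inl_injective (Sum.inr_injective this)
  · have := hinl (G.inIdx (.inr e))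
    rw [toWiring_tgt_T, ← hT, toWiring_tgt_T] at this
    exact Sum.inl_injective this

end OGraph

/-! ### Wirings that come from graphs. -/

namespace Wiring

variable {X Y Z X' Y' A B R : Type} {k l : ℕ}

/-- Coloured vertices are isolated. -/
structure Proper (W : Wiring X Y) : Prop where
  col_src : ∀ o, W.col (W.src o) = false
  col_tgt : ∀ s v, W.tgt s = .inr v → W.col v = false

/-- No edge starts or ends at a loop. This condition passes to `low` and `high`, so the parts of a
graph cut along a lower set are again graphs. -/
theorem _root_.OGraph.proper_toWiring (G : OGraph k l) : G.toWiring.Proper where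
  col_src _ := rfl
  col_tgt := by
    rintro (i | e | e) v h
    · obtain ⟨e | e, rfl⟩ := G.inIdx_bij.2 i
      · rw [OGraph.toWiring_tgt_I] at h
        cases h
        rfl
      · rw [OGraph.toWiring_tgt_T] at h
        cases h
    · cases h
      rfl
    · cases h

theorem Proper.iso {a : X ≃ X'} {b : Y ≃ Y'} {W : Wiring X Y} {W' : Wiring X' Y'}
    (h : W.Proper) (f : Iso a b W W') : W'.Proper where
  col_src o := by
    obtain ⟨o, rfl⟩ := f.fH.surjective o
    rw [f.src_eq, f.col_eq, h.col_src]
  col_tgt s v hs := by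
    obtain ⟨v, rfl⟩ := f.fV.surjective v
    rw [f.col_eq]
    rcases s with x | o
    · obtain ⟨x, rfl⟩ := a.surjective x
      rw [f.tgt_inl] at hs
      rcases e : W.tgt (.inl x) with y | w <;> simp [e] at hs
      exact h.col_tgt (.inl x) _ (e.trans (congrArg _ hs))
    · obtain ⟨x, rfl⟩ := f.fH.surjective o
      rw [f.tgt_inr] at hs
      rcases e : W.tgt (.inr x) with y | w <;> simp [e] at hs
      exact h.col_tgt (.inr x) _ (e.trans (congrArg _ hs))

theorem Proper.low {W : Wiring X Y} (h : W.Proper) (S : Set W.V) : (W.low S).Proper where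
  col_src o := h.col_src o.1
  col_tgt := by
    rintro (x | o) v hs
    · cases hs
      exact h.col_tgt _ _ (Hits.inr_vertex _ x.2)
    · by_cases h' : Hits S (W.tgt (.inr o.1))
      · simp only [h', dif_pos, Sum.inr.injEq] at hs
        subst hs
        exact h.col_tgt _ _ (Hits.inr_vertex _ h')
      · simp [h'] at hs

theorem Proper.high {W : Wiring X Y} (h : W.Proper) {S : Set W.V} (hS : W.IsLower S) :
    (high hS).Proper where
  col_src o := h.col_src o.1
  col_tgt := by
    have key : ∀ s (h' : ¬ Hits S (W.tgt s)) v, Hits.off _ h' = .inr v → W.col v = false := by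
      intro s h' v hv
      have := Hits.map_off _ h'
      rw [hv] at this
      exact h.col_tgt _ _ this.symm
    rintro ((o | x) | o) v hs
    · exact key _ _ _ hs
    · exact key _ _ _ hs
    · exact key _ _ _ hs

/-- The graph of a wiring in which the coloured vertices are isolated. -/
def toOGraph (W : Wiring (Fin k) (Fin l)) (hW : W.Proper) : OGraph k l where
  V := {v // W.col v = false}
  E := {o // (W.tgt (.inr o)).isRight}
  I := {x // (W.tgt (.inl x)).isRight}
  O := {o // (W.tgt (.inr o)).isLeft}
  T := {x // (W.tgt (.inl x)).isLeft}
  L := {v // W.col v = true}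
  src
    | .inl e => ⟨W.src e.1, hW.col_src _⟩
    | .inr e => ⟨W.src e.1, hW.col_src _⟩
  tgt
    | .inl e => ⟨(W.tgt (.inr e.1)).getRight e.2, hW.col_tgt (.inr e.1) _ (by simp)⟩
    | .inr e => ⟨(W.tgt (.inl e.1)).getRight e.2, hW.col_tgt (.inl e.1) _ (by simp)⟩
  inIdx
    | .inl e => e.1
    | .inr e => e.1
  outIdx
    | .inl e => (W.tgt (.inr e.1)).getLeft e.2
    | .inr e => (W.tgt (.inl e.1)).getLeft e.2
  inIdx_bij := by
    constructor
    · rintro (⟨e, h⟩ | ⟨e, h⟩) (⟨e', h'⟩ | ⟨e', h'⟩) hh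
      all_goals obtain rfl : e = e' := hh
      · rfl
      · exact absurd h' (by simpa using h)
      · exact absurd h (by simpa using h')
      · rfl
    · intro i
      rcases h : W.tgt (.inl i) with y | v
      · exact ⟨.inr ⟨i, by simp [h]⟩, rfl⟩
      · exact ⟨.inl ⟨i, by simp [h]⟩, rfl⟩
  outIdx_bij := by
    constructor
    · rintro (⟨e, h⟩ | ⟨e, h⟩) (⟨e', h'⟩ | ⟨e', h'⟩) hh
      all_goals
        obtain ⟨y, hy⟩ := Sum.isLeft_iff.1 h
        obtain ⟨y', hy'⟩ := Sum.isLeft_iff.1 h'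
        simp only [hy, hy', Sum.getLeft_inl] at hh
        subst hh
        cases (W.existsUnique_tgt y).unique hy hy'
        try rfl
    · intro j
      obtain ⟨x | o, h, -⟩ := W.existsUnique_tgt j
      · exact ⟨.inr ⟨x, by simp [h]⟩, by simp [h]⟩
      · exact ⟨.inl ⟨o, by simp [h]⟩, by simp [h]⟩

/-- Sorting vertices by colour, and half-edges and inputs by the side of their target, loses
nothing. Hence proper wirings with numbered ends are, up to isomorphism, the wirings of graphs. -/
theorem nonempty_iso_toOGraph (W : Wiring (Fin k) (Fin l)) (hW : W.Proper) :
    Nonempty (Iso (.refl _) (.refl _) (W.toOGraph hW).toWiring W) := by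
  have hV : Function.Bijective (Sum.elim Subtype.val Subtype.val :
      {v // W.col v = false} ⊕ {v // W.col v = true} → W.V) := by
    constructor
    · rintro (⟨e, h⟩ | ⟨e, h⟩) (⟨e', h'⟩ | ⟨e', h'⟩) hh
      all_goals obtain rfl : e = e' := hh
      all_goals first | rfl | (rw [h] at h'; cases h')
    · intro v
      rcases h : W.col v
      · exact ⟨.inl ⟨v, h⟩, rfl⟩
      · exact ⟨.inr ⟨v, h⟩, rfl⟩
  have hH : Function.Bijective (Sum.elim Subtype.val Subtype.val :
      {o // (W.tgt (.inr o)).isRight} ⊕ {o // (W.tgt (.inr o)).isLeft} → W.H) := by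
    constructor
    · rintro (⟨e, h⟩ | ⟨e, h⟩) (⟨e', h'⟩ | ⟨e', h'⟩) hh
      all_goals obtain rfl : e = e' := hh
      · rfl
      · exact absurd h' (by simpa using h)
      · exact absurd h (by simpa using h')
      · rfl
    · intro o
      rcases h : W.tgt (.inr o) with y | v
      · exact ⟨.inr ⟨o, by simp [h]⟩, rfl⟩
      · exact ⟨.inl ⟨o, by simp [h]⟩, rfl⟩
  refine ⟨OGraph.wiringIsoOf _ W (.ofBijective _ hV) (.ofBijective _ hH) Subtype.val Subtype.val
    Subtype.val Subtype.val (fun _ => rfl) (fun _ => rfl) (fun _ => rfl) (fun _ => rfl)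
    (fun v => v.2) (fun v => v.2) (fun _ => rfl) (fun _ => rfl) (fun e => ?_) (fun e => ?_)
    (fun e => ?_) (fun e => ?_)⟩
  · exact (Sum.inr_getRight _ e.2).symm
  · exact (Sum.inl_getLeft _ e.2).symm
  · exact (Sum.inr_getRight _ e.2).symm
  · exact (Sum.inl_getLeft _ e.2).symm

end Wiring

/-! ### Indecomposable wirings and their value. -/

theorem ProP.At.hc_one_empty {𝕜 : Type u} [Field 𝕜] {P : ProP.{u, v} 𝕜} {X Y : Type} [Finite X]
    [Finite Y] (p : P.At X Y) :
    rl (.sumEmpty X Empty) (.sumEmpty Y Empty) (hc p (one P Empty)) = p := by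
  -- `Nat.card Empty` equals `0` only propositionally. The identity on `Empty` is thus transported
  -- to `I_0` before the unit law is applied.
  have e : Fin 0 ≃ Fin (Nat.card Empty) := finCongr (by simp)
  have h1 : hc p (one P Empty) = P.tr ((finSumCongr (.refl _) e).trans (enumSum X Empty))
      ((finSumCongr (.refl _) e).trans (enumSum Y Empty)) p := by
    have h := P.tr_hcomp (.refl _) (.refl _) e e p (P.idn 0)
    rw [tr_refl, tr_idn] at h
    rw [hc, one, h, tr_tr]
    exact congrArg _ (P.hcomp_unit0 p)
  have h2 : ∀ X : Type, ∀ [Finite X], ((finSumCongr (.refl _) e).trans (enumSum X Empty)).trans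
      (enum (Equiv.sumEmpty X Empty)) = .refl _ := by
    intro X _
    refine Equiv.ext fun i => ?_
    change enum (Equiv.sumEmpty X Empty) (enumSum X Empty (finSumCongr (.refl _) e
      (finSumFinEquiv (.inl i)))) = i
    simp [enum, enumSum, finSumCongr, -finSumFinEquiv_apply_left]
  rw [h1, rl, tr_tr, h2, h2, tr_refl]

namespace Wiring

open ProP ProP.At

variable {X Y : Type}

/-- The wiring which connects every input to the output of the same name. -/
abbrev id (X : Type) : Wiring X X where
  V := Empty
  H := Empty
  col := Empty.elim
  src := Empty.elim
  tgt := Sum.elim .inl Empty.elim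
  existsUnique_tgt x := by
    refine ⟨.inl x, rfl, ?_⟩
    rintro (y | ⟨⟨⟩⟩) h
    exact congrArg _ (Sum.inl_injective h)

/-- A wiring as the composite of itself with an identity. -/
def isoIdComp (C : Wiring X Y) : Iso (Equiv.sumEmpty X Empty).symm (Equiv.sumEmpty Y Empty).symm C
    ((id (Y ⊕ Empty)).comp C) := by
  refine .ofFun (Equiv.sumEmpty C.V Empty).symm (Equiv.sumEmpty C.H Empty).symm .inl .inl
    (fun _ => rfl) (fun _ => rfl) (fun _ => rfl) (fun _ => rfl) (fun x => ?_) (fun o => ?_)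
  · rcases h : C.tgt (.inl x) with y | v <;> simp [h]
  · rcases h : C.tgt (.inr o) with y | v <;> simp [h]

variable {𝕜 : Type u} [Field 𝕜] {P : ProP.{u, v} 𝕜} [Finite X] [Finite Y]

/-- Peeling all of `C` at once leaves an identity wiring, so the value is the weight itself. -/
theorem Val.of_indec (φ : Weight P) {C : Wiring X Y} (hC : C.Indec) : Val φ C (φ.toFun C) := by
  refine .step C.isoIdComp hC (q := one P _) ?_ ?_
  · exact .perm inferInstance (.refl _) (fun _ => rfl) (rl_refl _).symm
  · rw [st, one_vc]
    have := congrArg (rl (Equiv.sumEmpty X Empty).symm (Equiv.sumEmpty Y Empty).symm)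
      (hc_one_empty (φ.toFun C))
    rw [rl_symm_apply] at this
    exact this.symm

end Wiring

/-! ### Values of graphs and their compatibility with the operations. -/

namespace OGraph

open ProP ProP.At Wiring

variable {k l m k' l' : ℕ} {𝕜 : Type u} [Field 𝕜] {P : ProP.{u, v} 𝕜} (φ : Weight P)

/-- The value of a graph. -/
noncomputable def value (G : OGraph k l) : P.carrier k l :=
  -- `At` enumerates `Fin k` by an arbitrary bijection, which has to be undone in order to return to
  -- the standard numbering.
  P.tr (Finite.equivFin (Fin k)).symm (Finite.equivFin (Fin l)).symm
    (Val.exists φ G.toWiring).choose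

variable {φ}

/-- By `Val.unique` the chosen decomposition is immaterial: any convenient one computes the value.
-/
theorem value_eq {G : OGraph k l} {p : P.At (Fin k) (Fin l)} (h : Val φ G.toWiring p) :
    G.value φ = P.tr (Finite.equivFin (Fin k)).symm (Finite.equivFin (Fin l)).symm p := by
  rw [value, (Val.exists φ G.toWiring).choose_spec.unique h]

theorem exists_val (φ : Weight P) (G : OGraph k l) : ∃ p, Val φ G.toWiring p ∧
    G.value φ = P.tr (Finite.equivFin (Fin k)).symm (Finite.equivFin (Fin l)).symm p :=
  ⟨_, (Val.exists φ G.toWiring).choose_spec, rfl⟩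

theorem value_relabel (a : Fin k ≃ Fin k') (b : Fin l ≃ Fin l') (G : OGraph k l) :
    (G.relabel a b).value φ = P.tr a b (G.value φ) := by
  obtain ⟨p, hp, h⟩ := G.exists_val φ
  rw [h, value_eq (hp.iso (isoToWiringRelabel a b G)), rl, tr_tr, tr_tr]
  congr 1 <;> ext <;> simp [enum]

theorem Iso.value_eq {G G' : OGraph k l} (f : Iso G G') : G.value φ = G'.value φ := by
  obtain ⟨p, hp, h⟩ := G.exists_val φ
  rw [h, OGraph.value_eq (hp.iso f.toWiring), rl_refl]

theorem value_vcomp (H : OGraph l m) (K : OGraph k l) :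
    (H.vcomp K).value φ = P.vcomp (H.value φ) (K.value φ) := by
  obtain ⟨p, hp, h⟩ := H.exists_val φ
  obtain ⟨q, hq, h'⟩ := K.exists_val φ
  rw [h, h', value_eq ((hq.vcomp hp).iso (isoToWiringVcomp H K).symm), tr_vcomp]
  congr 1
  exact rl_refl _

theorem value_idn (n : ℕ) : (idn n).value φ = P.idn n := by
  have h : Val φ (idn n).toWiring (one P (Fin n)) :=
    .perm (inferInstanceAs (IsEmpty (Empty ⊕ Empty))) (.refl _)
      (fun x => (idn n).toWiring_tgt_T x) (rl_refl _).symm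
  rw [value_eq h, one, tr_idn]

theorem value_hcomp_idn (G : OGraph k l) (n : ℕ) :
    (G.hcomp (idn n)).value φ = P.hcomp (G.value φ) (P.idn n) := by
  obtain ⟨p, hp, h⟩ := G.exists_val φ
  have h1 := P.tr_hcomp (Finite.equivFin (Fin k)).symm (Finite.equivFin (Fin l)).symm
    (Finite.equivFin (Fin n)).symm (Finite.equivFin (Fin n)).symm p (P.idn _)
  rw [tr_idn] at h1
  rw [h, h1, value_eq ((hp.addId (Fin n)).iso (isoToWiringHcompIdn G n).symm), rl, hc, tr_tr, tr_tr]
  congr 1 <;> ext i <;> obtain ⟨i | i, rfl⟩ := finSumFinEquiv.surjective i <;>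
    simp [enum, enumSum, finSumCongr, -finSumFinEquiv_apply_left, -finSumFinEquiv_apply_right]

/-- Reduced to padding on the right by commutativity of the horizontal product up to block swaps,
which holds both for graphs and in `P`. -/
theorem value_idn_hcomp (n : ℕ) (G : OGraph k l) :
    ((idn n).hcomp G).value φ = P.hcomp (P.idn n) (G.value φ) := by
  have h := (isoHcompComm (idn n) G).value_eq (φ := φ)
  rw [value_relabel, value_relabel, value_hcomp_idn, ← hcomp_comm_tr, tr_tr] at h
  have h' := congrArg (P.tr (blockSwap n k).symm (blockSwap n l).symm) h
  rw [tr_tr, tr_tr, Equiv.self_trans_symm, Equiv.self_trans_symm, tr_refl] at h'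
  rw [h']
  refine .trans ?_ (P.tr_refl _)
  congr 1 <;> ext i <;> simp [blockSwap, finAddFlip]

/-- By interchange `G * H = (G * I) ∘ (I * H)`, so vertical composition and padding by identities
suffice. -/
theorem value_hcomp (G : OGraph k l) (H : OGraph k' l') :
    (G.hcomp H).value φ = P.hcomp (G.value φ) (H.value φ) := by
  have h := (((isoVcompIdn G).symm.hcomp (isoIdnVcomp H).symm).trans
    (isoInterchange G (idn l') (idn k) H).symm).value_eq (φ := φ)
  rw [h, value_vcomp, value_hcomp_idn, value_idn_hcomp, P.interchange, P.vcomp_idn, P.idn_vcomp]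

end OGraph

namespace OGraph

open Wiring

variable {k l m k' l' : ℕ}

/-! ### Indecomposable graphs and indecomposable wirings -/

theorem IsIndecomposable.relabel_equiv {G : OGraph k l} (hG : G.IsIndecomposable)
    (a : Fin k ≃ Fin k') (b : Fin l ≃ Fin l') : (G.relabel a b).IsIndecomposable := by
  obtain rfl := ProP.eq_of_finEquiv a
  obtain rfl := ProP.eq_of_finEquiv b
  exact hG.relabel a b

/-- Any factorisation with vertices in both factors exhibits a proper nonempty lower set. If the
graph has a loop, the loop alone is a lower set, hence the whole graph. -/
theorem isIndecomposable_of_indec {G : OGraph k l} (h : G.toWiring.Indec) :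
    G.IsIndecomposable := by
  have hT : IsEmpty G.T := by
    refine ⟨fun t => ?_⟩
    obtain ⟨v, hv⟩ := h.noThrough (G.inIdx (.inr t))
    rw [toWiring_tgt_T] at hv
    cases hv
  rcases isEmpty_or_nonempty G.L with hL | ⟨⟨x⟩⟩
  · refine .inr ⟨?_, hT, hL, fun m H K ⟨f⟩ => ?_, fun k₁ l₁ k₂ l₂ H K a b ⟨f⟩ => ?_⟩
    · obtain ⟨v | v⟩ := h.nonempty
      exacts [⟨v⟩, isEmptyElim v]
    · by_contra! hne
      obtain ⟨⟨w⟩, ⟨v⟩⟩ := hne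
      -- In `H ∘ K` every strand goes from `K` to `H`, so the vertices of `K` contain their
      -- predecessors; they miss `w`.
      have hs := (f.toWiring.indec h).eq_univ {x | ∃ v : K.V, x = .inl (.inl v)} (by
        rintro ((e | e | e) | e) _ ⟨v, rfl⟩ ho
        · exact ⟨_, rfl⟩
        · cases ho
        · cases ho
        · cases ho) ⟨_, v, rfl⟩
      obtain ⟨v', hv'⟩ := Set.eq_univ_iff_forall.1 hs (.inl (.inr w))
      cases hv'
    · by_contra! hne
      obtain ⟨⟨w⟩, ⟨v⟩⟩ := hne
      -- A disjoint union has no edges between its factors, so the vertices of either one form a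
      -- lower set.
      have hs := ((isoToWiringRelabel a b _).symm.indec (f.toWiring.indec h)).eq_univ
        {x | ∃ v : K.V, x = .inl (.inr v)} (by
          rintro ((e | e) | e) _ ⟨v, rfl⟩ ho
          · cases ho
          · exact ⟨_, rfl⟩
          · cases ho) ⟨_, v, rfl⟩
      obtain ⟨v', hv'⟩ := Set.eq_univ_iff_forall.1 hs (.inl (.inl w))
      cases hv'
  · have hs := h.eq_univ {.inr x} (by
      rintro (e | e) _ rfl ho <;> cases ho) ⟨_, rfl⟩
    have hs' : ∀ y, y = Sum.inr x := fun y => by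
      have : y ∈ Set.univ := trivial
      rwa [← hs] at this
    have hV : IsEmpty G.V := ⟨fun v => by cases hs' (.inl v)⟩
    refine .inl ⟨hV, ⟨fun e => isEmptyElim (G.src (.inl e))⟩,
      ⟨fun e => isEmptyElim (G.tgt (.inr e))⟩, ⟨fun e => isEmptyElim (G.src (.inr e))⟩, hT, ?_⟩
    exact Nat.card_eq_one_iff_exists.2 ⟨x, fun y => Sum.inr_injective (hs' (.inr y))⟩

theorem nonempty_V_of_col {G : OGraph k l} {x : G.V ⊕ G.L} (h : G.toWiring.col x = false) :
    Nonempty G.V := by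
  rcases x with v | v
  exacts [⟨v⟩, nomatch h]

/-- A graph as a vertical composition with respect to a lower set of vertices. -/
theorem exists_vcomp (G : OGraph k l) {S : Set (G.V ⊕ G.L)} (hS : G.toWiring.IsLower S) :
    ∃ (a b r : ℕ) (C : OGraph a b) (H : OGraph (b + r) l) (e : Fin k ≃ Fin (a + r)),
      Nonempty (Iso (G.relabel e (.refl _)) (H.vcomp (C.hcomp (idn r)))) ∧
      (∃ α β, Nonempty (Wiring.Iso α β (G.toWiring.low S) C.toWiring)) ∧
      ∃ α β, Nonempty (Wiring.Iso α β (high hS) H.toWiring) := by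
  classical
  let eA := Finite.equivFin {x // Hits S (G.toWiring.tgt (.inl x))}
  let eB := Finite.equivFin {o : {o // G.toWiring.src o ∈ S} // ¬ Hits S (G.toWiring.tgt (.inr o.1))}
  let eR := Finite.equivFin {x // ¬ Hits S (G.toWiring.tgt (.inl x))}
  have c := isoRelabel eA eB (G.toWiring.low S)
  have h := isoRelabel ((Equiv.sumCongr eB eR).trans finSumFinEquiv) (.refl _) (high hS)
  -- Once their ends are numbered, both parts are proper wirings and can be realised by graphs.
  obtain ⟨c'⟩ := nonempty_iso_toOGraph _ ((G.proper_toWiring.low S).iso c)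
  obtain ⟨h'⟩ := nonempty_iso_toOGraph _ ((G.proper_toWiring.high hS).iso h)
  have c₁ := c.trans c'.symm
  have h₁ := h.trans h'.symm
  refine ⟨_, _, _, _, _, (Equiv.sumCompl _).symm.trans ((Equiv.sumCongr eA eR).trans finSumFinEquiv),
    ?_, ⟨_, _, ⟨c₁⟩⟩, ⟨_, _, ⟨h₁⟩⟩⟩
  have f := (isoSplit hS).trans ((h₁.vcomp (((c₁.addId eR).trans
    (isoToWiringHcompIdn _ _).symm).cast rfl rfl)).trans (isoToWiringVcomp _ _).symm)
  exact nonempty_iso_of_toWiring (((isoToWiringRelabel _ (.refl _) G).symm.trans f).cast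
    (Equiv.symm_trans_self _) rfl)

/-- A proper nonempty lower set, be it a union of connected components or not, gives a factorisation
`H ∘ (C * I_r)` with vertices in both factors, so vertical indecomposability already excludes it. A
single loop has only one vertex in its wiring. -/
theorem IsIndecomposable.indec {G : OGraph k l} (hG : G.IsIndecomposable) : G.toWiring.Indec := by
  rcases hG with ⟨hV, hE, hI, hO, hT, hL⟩ | ⟨hV, hT, hL, hG, -⟩
  · obtain ⟨x, hx⟩ := Nat.card_eq_one_iff_exists.1 hL
    refine ⟨⟨.inr x⟩, fun i => ?_, fun S _ ⟨y, hy⟩ => ?_⟩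
    · obtain ⟨e | e, -⟩ := G.inIdx_bij.2 i <;> exact isEmptyElim e
    · have : ∀ z : G.V ⊕ G.L, z = .inr x := by
        rintro (z | z)
        exacts [isEmptyElim z, congrArg _ (hx z)]
      ext z
      rw [this z, ← this y]
      exact ⟨fun _ => trivial, fun _ => hy⟩
  · refine ⟨hV.map .inl, fun i => ?_, fun S hS ⟨y, hy⟩ => ?_⟩
    · obtain ⟨e | e, rfl⟩ := G.inIdx_bij.2 i
      exacts [⟨_, toWiring_tgt_I G e⟩, isEmptyElim e]
    · by_contra hne
      obtain ⟨z, hz⟩ := (Set.ne_univ_iff_exists_notMem S).1 hne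
      obtain ⟨a, b, r, C, H, e, ⟨f⟩, ⟨_, _, ⟨c⟩⟩, ⟨_, _, ⟨h⟩⟩⟩ := G.exists_vcomp hS
      -- Without loops, a vertex of either part of the wiring is a genuine vertex of the
      -- corresponding graph.
      have hcol : ∀ x, G.toWiring.col x = false := by
        rintro (x | x)
        exacts [rfl, isEmptyElim x]
      have hC : Nonempty C.V := nonempty_V_of_col ((c.col_eq ⟨y, hy⟩).trans (hcol y))
      have hH : Nonempty H.V := nonempty_V_of_col ((h.col_eq ⟨z, hz⟩).trans (hcol z))
      obtain rfl := ProP.eq_of_finEquiv e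
      have f' := (f.relabel e.symm (.refl _)).trans (isoRelabelVcomp _ _ _ _)
      rcases hG _ _ _ ⟨(by simpa [OGraph.relabel] using f')⟩ with h | ⟨⟨h⟩⟩
      · exact h.elim hH.some
      · exact h (.inl hC.some)

end OGraph

/-! ### Behaviour of morphisms on identities and renumberings. -/

theorem GraphClass.exists_mk_eq {k l : ℕ} (x : GraphClass k l) : ∃ G, mk G = x :=
  Quotient.exists_rep x

theorem ProP.tr_zero {𝕜 : Type u} [Field 𝕜] (P : ProP.{u, v} 𝕜) {k l k' l' : ℕ}
    (a : Fin k ≃ Fin k') (b : Fin l ≃ Fin l') : P.tr a b 0 = 0 := by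
  obtain rfl := eq_of_finEquiv a
  obtain rfl := eq_of_finEquiv b
  rw [tr_perm, map_zero, map_zero]

theorem ProP.idn_succ {𝕜 : Type u} [Field 𝕜] (P : ProP.{u, v} 𝕜) (n : ℕ) :
    P.idn (n + 1) = P.hcomp (P.idn n) P.unit1 := rfl

namespace ProP.Hom

variable {𝕜 : Type u} [Field 𝕜] {P : ProP.{u, v} 𝕜} {Q : ProP.{u, w} 𝕜}

theorem map_idn (Φ : ProP.Hom P Q) (n : ℕ) : Φ.toFun (P.idn n) = Q.idn n := by
  induction n with
  | zero => exact Φ.map_unit0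
  | succ n ih => rw [idn_succ, Φ.map_hcomp, ih, Φ.map_unit1, idn_succ]

theorem map_tr (Φ : ProP.Hom P Q) {k l k' l' : ℕ} (a : Fin k ≃ Fin k') (b : Fin l ≃ Fin l')
    (p : P.carrier k l) : Φ.toFun (P.tr a b p) = Q.tr a b (Φ.toFun p) := by
  obtain rfl := eq_of_finEquiv a
  obtain rfl := eq_of_finEquiv b
  rw [tr_perm, Φ.map_lact, Φ.map_ract, tr_perm]

end ProP.Hom

namespace OGraph

open ProP ProP.At Wiring

variable {k l m k' l' : ℕ} (𝕜 : Type u) [Field 𝕜] {P : ProP.{u, v} 𝕜}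

/-! ### Graphs as elements of the ProP of graphs -/

/-- The basis vector of a graph. -/
noncomputable def basis (G : OGraph k l) : (gr 𝕜).carrier k l :=
  Finsupp.single (GraphClass.mk G) (1 : 𝕜)

variable {𝕜}

theorem Iso.basis_eq {G G' : OGraph k l} (f : Iso G G') : G.basis 𝕜 = G'.basis 𝕜 :=
  congrArg (Finsupp.single · (1 : 𝕜)) (GraphClass.mk_eq f)

theorem basis_relabel (a : Fin k ≃ Fin k') (b : Fin l ≃ Fin l') (G : OGraph k l) :
    (G.relabel a b).basis 𝕜 = (gr 𝕜).tr a b (G.basis 𝕜) := by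
  obtain rfl := eq_of_finEquiv a
  obtain rfl := eq_of_finEquiv b
  rw [tr_perm]
  refine (Finsupp.mapDomain_single.trans ?_).symm.trans
    (congrArg (Finsupp.mapDomain _) Finsupp.mapDomain_single).symm
  rfl

theorem basis_vcomp (H : OGraph l m) (K : OGraph k l) :
    (H.vcomp K).basis 𝕜 = (gr 𝕜).vcomp (H.basis 𝕜) (K.basis 𝕜) :=
  ((bilinExt_single 𝕜 _ _ _ _ _).trans (by rw [mul_one]; rfl)).symm

theorem basis_hcomp (G : OGraph k l) (H : OGraph k' l') :
    (G.hcomp H).basis 𝕜 = (gr 𝕜).hcomp (G.basis 𝕜) (H.basis 𝕜) :=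
  ((bilinExt_single 𝕜 _ _ _ _ _).trans (by rw [mul_one]; rfl)).symm

theorem basis_idn (n : ℕ) : (idn n).basis 𝕜 = (gr 𝕜).idn n := (grData_idn 𝕜 n).symm

/-- A graph without vertices and loops is a permutation of input-output edges. -/
theorem exists_iso_idn (G : OGraph k l) [IsEmpty G.V] [IsEmpty G.L] :
    ∃ e : Fin k ≃ Fin l, Nonempty (Iso G ((idn k).relabel (.refl _) e)) := by
  obtain ⟨e, he⟩ := G.toWiring.exists_equiv_of_isEmpty
  have hH : IsEmpty (G.E ⊕ G.O) := ⟨fun o => isEmptyElim (G.src o)⟩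
  refine ⟨e, nonempty_iso_of_toWiring (.ofFun (Equiv.equivOfIsEmpty (G.V ⊕ G.L) (Empty ⊕ Empty))
    (Equiv.equivOfIsEmpty (G.E ⊕ G.O) (Empty ⊕ Empty)) isEmptyElim (hH.elim) (fun v => isEmptyElim v)
    (fun o => hH.elim o) (fun v => isEmptyElim v) (fun o => hH.elim o) (fun x => ?_)
    (fun o => hH.elim o))⟩
  exact (((idn k).relabel (.refl _) e).toWiring_tgt_T x).trans (by rw [he x]; rfl)

/-- The indecomposable graphs generate: `G` is a renumbering of `H ∘ (C * I_r)` with `C`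
indecomposable and `H` having fewer vertices and loops. The induction ends with graphs made of
input-output edges only. -/
theorem _root_.ProP.Hom.basis_eq_of_indecomposable (Φ Ψ : ProP.Hom (gr 𝕜) P)
    (h : ∀ (k l : ℕ) (G : OGraph k l), G.IsIndecomposable →
      Φ.toFun (G.basis 𝕜) = Ψ.toFun (G.basis 𝕜)) (G : OGraph k l) :
    Φ.toFun (G.basis 𝕜) = Ψ.toFun (G.basis 𝕜) := by
  induction hn : Nat.card (G.V ⊕ G.L) using Nat.strong_induction_on generalizing k l with
  | _ n ih =>
  rcases isEmpty_or_nonempty (G.V ⊕ G.L) with hV | hV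
  · rw [isEmpty_sum] at hV
    obtain ⟨_, _⟩ := hV
    obtain ⟨e, ⟨f⟩⟩ := G.exists_iso_idn
    rw [f.basis_eq, basis_relabel, basis_idn, Φ.map_tr, Ψ.map_tr, Φ.map_idn, Ψ.map_idn]
  · obtain ⟨S, hS, hI⟩ := G.toWiring.exists_isLower_minimal
    obtain ⟨a, b, r, C, H, e, ⟨f⟩, ⟨_, _, ⟨c⟩⟩, ⟨_, _, ⟨g⟩⟩⟩ := G.exists_vcomp hS
    have hC := h _ _ C (isIndecomposable_of_indec (c.indec hI))
    have hlt : Nat.card (H.V ⊕ H.L) < n := by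
      rw [← hn, ← Nat.card_congr g.fV]
      exact (isoSplit hS).card_lt hI.nonempty
    have hH := ih _ hlt H rfl
    have key : G = (G.relabel e (.refl _)).relabel e.symm (.refl _) := by simp [OGraph.relabel]
    rw [key, basis_relabel, f.basis_eq, basis_vcomp, basis_hcomp, basis_idn, Φ.map_tr, Ψ.map_tr,
      Φ.map_vcomp, Ψ.map_vcomp, Φ.map_hcomp, Ψ.map_hcomp, hC, hH, Φ.map_idn, Ψ.map_idn]

/-! ### The morphism induced by the values of graphs -/

/-- The linear extension of the value of graphs. -/
noncomputable def valueLin (φ : Weight P) (k l : ℕ) : (GraphClass k l →₀ 𝕜) →ₗ[𝕜] P.carrier k l :=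
  Finsupp.linearCombination 𝕜 (Quotient.lift (value φ) fun _ _ ⟨f⟩ => f.value_eq)

theorem valueLin_single (φ : Weight P) (G : OGraph k l) (r : 𝕜) :
    valueLin φ k l (.single (.mk G) r) = r • G.value φ :=
  Finsupp.linearCombination_single _ _ _

theorem valueLin_relabel (φ : Weight P) (a : Equiv.Perm (Fin k)) (b : Equiv.Perm (Fin l))
    (x : GraphClass k l →₀ 𝕜) :
    valueLin φ k l (Finsupp.lmapDomain 𝕜 𝕜 (GraphClass.relabel a b) x) =
      P.lact b (P.ract a⁻¹ (valueLin φ k l x)) := by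
  induction x using Finsupp.induction_linear with
  | zero => simp only [map_zero]
  | add p q hp hq => simp only [map_add, hp, hq]
  | single x r =>
    obtain ⟨G, rfl⟩ := x.exists_mk_eq
    rw [Finsupp.lmapDomain_apply, Finsupp.mapDomain_single]
    refine (valueLin_single φ (G.relabel a b) r).trans ?_
    rw [value_relabel, tr_perm, ← map_smul, ← map_smul]
    exact congrArg _ (congrArg _ (valueLin_single φ G r).symm)

theorem valueLin_hcomp (φ : Weight P) (x : GraphClass k l →₀ 𝕜) (y : GraphClass k' l' →₀ 𝕜) :
    valueLin φ _ _ (bilinExt 𝕜 GraphClass.hcomp x y) =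
      P.hcomp (valueLin φ k l x) (valueLin φ k' l' y) := by
  induction x using Finsupp.induction_linear with
  | zero => simp only [map_zero, LinearMap.zero_apply]
  | add p q hp hq => simp only [map_add, LinearMap.add_apply, hp, hq]
  | single x r =>
  induction y using Finsupp.induction_linear with
  | zero => simp only [map_zero]
  | add p q hp hq => simp only [map_add, hp, hq]
  | single y s =>
    obtain ⟨G, rfl⟩ := x.exists_mk_eq
    obtain ⟨H, rfl⟩ := y.exists_mk_eq
    rw [bilinExt_single]
    refine (valueLin_single φ (G.hcomp H) _).trans (.trans ?_
      (congrArg₂ (fun p q => P.hcomp p q) (valueLin_single φ G r) (valueLin_single φ H s)).symm)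
    rw [value_hcomp, map_smul, map_smul, LinearMap.smul_apply, smul_smul, mul_comm]

theorem valueLin_vcomp (φ : Weight P) (x : GraphClass l m →₀ 𝕜) (y : GraphClass k l →₀ 𝕜) :
    valueLin φ _ _ (bilinExt 𝕜 GraphClass.vcomp x y) =
      P.vcomp (valueLin φ l m x) (valueLin φ k l y) := by
  induction x using Finsupp.induction_linear with
  | zero => simp only [map_zero, LinearMap.zero_apply]
  | add p q hp hq => simp only [map_add, LinearMap.add_apply, hp, hq]
  | single x r =>
  induction y using Finsupp.induction_linear with
  | zero => simp only [map_zero]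
  | add p q hp hq => simp only [map_add, hp, hq]
  | single y s =>
    obtain ⟨G, rfl⟩ := x.exists_mk_eq
    obtain ⟨H, rfl⟩ := y.exists_mk_eq
    rw [bilinExt_single]
    refine (valueLin_single φ (G.vcomp H) _).trans (.trans ?_
      (congrArg₂ (fun p q => P.vcomp p q) (valueLin_single φ G r) (valueLin_single φ H s)).symm)
    rw [value_vcomp, map_smul, map_smul, LinearMap.smul_apply, smul_smul, mul_comm]

/-- The morphism of ProPs which maps every graph to its value. -/
noncomputable def valueHom (φ : Weight P) : ProP.Hom (gr 𝕜) P where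
  toFun {k l} := valueLin φ k l
  map_lact σ p := (valueLin_relabel φ (.refl _) σ p).trans (congrArg _ (P.one_ract _))
  map_ract τ p := (valueLin_relabel φ τ⁻¹ (.refl _) p).trans
    ((P.one_lact _).trans (by rw [inv_inv]; rfl))
  map_hcomp p p' := valueLin_hcomp φ p p'
  map_vcomp p q := valueLin_vcomp φ p q
  map_unit0 := (valueLin_single φ (idn 0) 1).trans (by rw [one_smul, value_idn]; rfl)
  map_unit1 := by
    refine (valueLin_single φ (idn 1) 1).trans ?_
    -- By recursion `I_1` is `I_0 * I_1`, so the left unit law is needed to return to `unit1`.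
    have h := P.unit0_hcomp P.unit1
    rw [one_smul, value_idn, idn_succ]
    exact h

theorem valueHom_basis (φ : Weight P) (G : OGraph k l) :
    (valueHom φ).toFun (G.basis 𝕜) = G.value φ :=
  (valueLin_single φ G 1).trans (one_smul _ _)

/-! ### The weight of a morphism of modules on the indecomposable graphs -/

variable (𝕜) in
/-- An indecomposable graph as an element of the module of indecomposable graphs. -/
noncomputable def indBasis (G : OGraph k l) (hG : G.IsIndecomposable) : (grInd 𝕜).carrier k l :=
  ⟨G.basis 𝕜, Submodule.subset_span ⟨G, hG, rfl⟩⟩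

variable (φ : SBimodule.Hom (grInd 𝕜) P.toSBimodule)

theorem Iso.map_indBasis {G G' : OGraph k l} (hG : G.IsIndecomposable) (hG' : G'.IsIndecomposable)
    (f : Iso G G') : φ.toFun (G.indBasis 𝕜 hG) = φ.toFun (G'.indBasis 𝕜 hG') :=
  congrArg _ (Subtype.ext f.basis_eq)

theorem map_indBasis_relabel {G : OGraph k l} (hG : G.IsIndecomposable) (a : Fin k ≃ Fin k')
    (b : Fin l ≃ Fin l') : φ.toFun ((G.relabel a b).indBasis 𝕜 (hG.relabel_equiv a b)) =
      P.tr a b (φ.toFun (G.indBasis 𝕜 hG)) := by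
  obtain rfl := eq_of_finEquiv a
  obtain rfl := eq_of_finEquiv b
  rw [tr_perm, ← φ.map_ract, ← φ.map_lact]
  exact congrArg _ (Subtype.ext (basis_relabel a b G))

open Classical in
/-- The values of the morphism `φ` on the wirings of indecomposable graphs. -/
noncomputable def weightFun {A B : Type} [Finite A] [Finite B] (C : Wiring A B) : P.At A B :=
  if h : ∃ G : OGraph (Nat.card A) (Nat.card B), G.IsIndecomposable ∧
      Nonempty (Wiring.Iso (Finite.equivFin A) (Finite.equivFin B) C G.toWiring) then
    φ.toFun (h.choose.indBasis 𝕜 h.choose_spec.1)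
  else 0

/-- Two graphs that realise the same wiring are isomorphic, so the choice in `weightFun` has no
effect. -/
theorem weightFun_eq {A B : Type} [Finite A] [Finite B] {C : Wiring A B}
    {G : OGraph (Nat.card A) (Nat.card B)} (hG : G.IsIndecomposable)
    (f : Wiring.Iso (Finite.equivFin A) (Finite.equivFin B) C G.toWiring) :
    weightFun φ C = φ.toFun (G.indBasis 𝕜 hG) := by
  have h : ∃ G : OGraph (Nat.card A) (Nat.card B), G.IsIndecomposable ∧
      Nonempty (Wiring.Iso (Finite.equivFin A) (Finite.equivFin B) C G.toWiring) := ⟨G, hG, ⟨f⟩⟩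
  rw [weightFun, dif_pos h]
  obtain ⟨g⟩ := h.choose_spec.2
  obtain ⟨i⟩ := nonempty_iso_of_toWiring
    ((g.symm.trans f).cast (Equiv.symm_trans_self _) (Equiv.symm_trans_self _))
  exact i.map_indBasis φ _ _

/-- The weight of a morphism of modules on the indecomposable graphs. -/
noncomputable def weight : Weight P where
  toFun := weightFun φ
  map_iso {A B A' B' _ _ _ _ a b C C'} f := by
    by_cases h : ∃ G : OGraph (Nat.card A) (Nat.card B), G.IsIndecomposable ∧
      Nonempty (Wiring.Iso (Finite.equivFin A) (Finite.equivFin B) C G.toWiring)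
    · obtain ⟨G, hG, ⟨g⟩⟩ := h
      rw [weightFun_eq φ hG g, rl, ← map_indBasis_relabel]
      refine weightFun_eq φ _ (((f.symm.trans g).trans (isoToWiringRelabel (enum a) (enum b) G)).cast
        ?_ ?_) <;> ext <;> simp [enum]
    -- Being realised by an indecomposable graph is invariant under isomorphism. Otherwise both
    -- weights take the default value `0`, which relabelling preserves.
    · have h' : ¬ ∃ G : OGraph (Nat.card A') (Nat.card B'), G.IsIndecomposable ∧
          Nonempty (Wiring.Iso (Finite.equivFin A') (Finite.equivFin B') C' G.toWiring) := by
        rintro ⟨G, hG, ⟨g⟩⟩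
        refine h ⟨G.relabel (enum a.symm) (enum b.symm), hG.relabel_equiv _ _,
          ⟨((f.trans g).trans (isoToWiringRelabel (enum a.symm) (enum b.symm) G)).cast ?_ ?_⟩⟩ <;>
          ext <;> simp [enum]
      rw [weightFun, weightFun, dif_neg h, dif_neg h']
      exact (P.tr_zero _ _).symm

/-- The wiring of `G` is indecomposable, so its value is its weight, that is, `φ` at `G` renumbered
by the enumerations of `Fin k` and `Fin l`. Equivariance of `φ` cancels this renumbering against the
one in `value`. -/
theorem value_weight {G : OGraph k l} (hG : G.IsIndecomposable) :
    G.value (weight φ) = φ.toFun (G.indBasis 𝕜 hG) := by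
  have h := weightFun_eq φ (hG.relabel_equiv (Finite.equivFin (Fin k)) (Finite.equivFin (Fin l)))
    (isoToWiringRelabel _ _ G)
  rw [value_eq (.of_indec (weight φ) hG.indec)]
  refine (congrArg _ (h.trans (map_indBasis_relabel φ hG _ _))).trans ?_
  rw [tr_tr, Equiv.self_trans_symm, Equiv.self_trans_symm, tr_refl]

end OGraph

/-! ### The universal property. -/

theorem mainTheorem1 {𝕜 : Type u} [Field 𝕜] (P : ProP.{u, v} 𝕜)
    (φ : SBimodule.Hom (grInd 𝕜) P.toSBimodule) :
    ∃! Φ : ProP.Hom (gr 𝕜) P,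
      ∀ (k l : ℕ) (x : (grInd 𝕜).carrier k l),
        Φ.toFun ((grIndIncl 𝕜).toFun x) = φ.toFun x := by
  refine ⟨OGraph.valueHom (OGraph.weight φ), fun k l x => ?_, fun Ψ hΨ => ?_⟩
  · obtain ⟨x, hx⟩ := x
    -- Both sides are linear on the span, so it suffices to compare them on indecomposable graphs.
    induction hx using Submodule.span_induction with
    | mem x h =>
      obtain ⟨G, hG, rfl⟩ := h
      exact (OGraph.valueHom_basis _ G).trans (OGraph.value_weight φ hG)
    | zero => exact (map_zero _).trans (map_zero φ.toFun).symm
    | add x y hx hy ihx ihy =>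
      exact (map_add _ _ _).trans ((congrArg₂ (· + ·) ihx ihy).trans
        (map_add φ.toFun ⟨x, hx⟩ ⟨y, hy⟩).symm)
    | smul r x hx ih =>
      exact (map_smul _ _ _).trans ((congrArg (r • ·) ih).trans (map_smul φ.toFun r ⟨x, hx⟩).symm)
  · have key : ∀ (k l : ℕ) (G : OGraph k l),
        Ψ.toFun (G.basis 𝕜) = (OGraph.valueHom (OGraph.weight φ)).toFun (G.basis 𝕜) := by
      intro k l G
      refine Ψ.basis_eq_of_indecomposable _ (fun k l G hG => ?_) G
      exact (hΨ k l (G.indBasis 𝕜 hG)).trans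
        ((OGraph.value_weight φ hG).symm.trans (OGraph.valueHom_basis _ G).symm)
    refine ProP.Hom.ext (funext fun k => funext fun l => Finsupp.lhom_ext' fun x => ?_)
    obtain ⟨G, rfl⟩ := x.exists_mk_eq
    exact LinearMap.ext_ring (key k l G)
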